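/- Let $k$ be a field and let $A=kQ/I$ be a gentle algebra: $Q$ is a finite quiver, $I$ is generated by a set $R$ of paths of length two, $A$ is finite dimensional, every vertex of $Q$ has at most two incoming and at most two outgoing arrows, and for each arrow $\alpha$ there is at most one arrow $\beta$ with $\alpha\beta$ a path not in $I$, at most one $\gamma$ with $\gamma\alpha$ a path not in $I$, at most one $\beta$ with $\alpha\beta$ a path in $I$, and at most one $\gamma$ with $\gamma\alpha$ a path in $I$. Assume that $A$ is a brick algebra, i.e. every indecomposable module in $\operatorname{mod}(A)$ has a division ring as endomorphism ring. Here $\operatorname{mod}$ denotes finitely generated left modules, and subcategories are full and closed under isomorphism. **Strings.** A string of a bound quiver is a lazy path $e_i$ or a reduced walk $w=\gamma_d^{\epsilon_d}\cdots\gamma_1^{\epsilon_1}$ in arrows and formal inverses such that neither $w$ nor $w^{-1}$ contains a subpath lying in the ideal of relations; $M(w)$ denotes its string module. Let $\operatorname{Str}(A)$ be the set of strings of $A$, with $w$ and $w^{-1}$ identified. A set $B\subseteq\operatorname{Str}(A)$ is closed if $u,v\in B$ implies $v\gamma^{\pm1}u\in B$ for every arrow $\gamma$ such that $v\gamma^{\pm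 1}u$ is a string, and biclosed if $B$ and $\operatorname{Str}(A)\setminus B$ are closed. $\operatorname{Bic}(A)$ is the set of biclosed sets, ordered by inclusion. **The doubled algebra.** Let $\overline Q$ be obtained from $Q$ by adding an arrow $\gamma^*:j\to i$ for each arrow $\gamma:i\to j$, and let $\Pi(A)=k\overline Q/\langle \beta\alpha,\ \alpha^*\beta^* : \beta\alpha\in R\rangle$. The projection $\Pi(A)\to A$ killing all $\gamma^*$ allows us to regard $\operatorname{mod}(A)$ as a subcategory of $\operatorname{mod}(\Pi(A))$. A string $\widetilde w$ of $\Pi(A)$ specializes to $w$ if $w$ arises from $\widetilde w$ by replacing each $\gamma^*$ by $\gamma^{-1}$ and each $(\gamma^*)^{-1}$ by $\gamma$. Let $\mathcal M=\operatorname{add}\big(\bigoplus M(\widetilde w)\big)$, over all strings $\widetilde w$ of $\Pi(A)$ that specialize to strings of $A$. **Torsion shadows.** For an algebra $\Lambda$, $\operatorname{tors}(\Lambda)$ is the set of torsion classes of $\operatorname{mod}(\Lambda)$ (subcategories containing $0$ and closed under quotients and extensions), ordered by inclusion. $\operatorname{torshad}_{\mathcal M}(\Pi(A))=\{\mathcal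 T\cap\mathcal M:\mathcal T\in\operatorname{tors}(\Pi(A))\}$, ordered by inclusion. The specialization of a torsion shadow $\widetilde{\mathfrak T}$ is the subcategory $\mathfrak T=\operatorname{add}\big(\bigoplus M(w)\big)$ of $\operatorname{mod}(A)$, over all $w\in\operatorname{Str}(A)$ such that $M(\widetilde w)\in\widetilde{\mathfrak T}$ for some string $\widetilde w$ of $\Pi(A)$ specializing to $w$. **Biclosed subcategories.** A subcategory $\mathcal C$ of $\operatorname{mod}(A)$ is weakly extension-closed if for each short exact sequence $0\to X\to Y\to Z\to0$ of indecomposable modules, $X,Z\in\mathcal C$ implies $Y\in\mathcal C$. A subcategory $\mathcal C$ of $\operatorname{mod}(A)$ that is additive (closed under finite direct sums and direct summands) is biclosed if both $\mathcal C$ and $\mathcal C^c=\{X:\operatorname{add}(X)\cap\mathcal C=0\}$ are weakly extension-closed. **Theorem.** $\operatorname{Bic}(A)$ and $\operatorname{torshad}_{\mathcal M}(\Pi(A))$ are complete lattices, and there is an order isomorphism $\Phi:\operatorname{Bic}(A)\to\operatorname{torshad}_{\mathcal M}(\Pi(A))$, whose inverse sends $\widetilde{\mathfrak T}$ to the set of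 all $w\in\operatorname{Str}(A)$ such that $M(\widetilde w)\in\widetilde{\mathfrak T}$ for some $\widetilde w$ specializing to $w$. Moreover: 1. For $B\in\operatorname{Bic}(A)$, the specialization of $\Phi(B)$ is $\operatorname{add}\big(\bigoplus_{w\in B}M(w)\big)$, and the biclosed subcategories of $\operatorname{mod}(A)$ are exactly the specializations $\mathfrak T$ of the torsion shadows $\widetilde{\mathfrak T}\in\operatorname{torshad}_{\mathcal M}(\Pi(A))$. 2. For each $\mathcal T\in\operatorname{tors}(\Pi(A))$ one has $\mathcal T\cap\operatorname{mod}(A)\in\operatorname{tors}(A)$ and $(\mathcal T\cap\mathcal M)\cap\operatorname{mod}(A)=\mathcal T\cap\operatorname{mod}(A)$, so the map $\mathcal T\mapsto\mathcal T\cap\operatorname{mod}(A)$ factors as $\operatorname{tors}(\Pi(A))\to\operatorname{torshad}_{\mathcal M}(\Pi(A))\to\operatorname{tors}(A)$. 3. $\Phi$ identifies the map $\operatorname{torshad}_{\mathcal M}(\Pi(A))\to\operatorname{tors}(A)$, $\widetilde{\mathfrak T}\mapsto\widetilde{\mathfrak T}\cap\operatorname{mod}(A)$, with the map $\operatorname{Bic}(A)\to\operatorname{tors}(A)$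 sending $B$ to the torsion class of all $X\in\operatorname{mod}(A)$ all of whose quotients lie in $\operatorname{add}\big(\bigoplus_{w\in B}M(w)\big)$. That is, for every $B\in\operatorname{Bic}(A)$ the latter subcategory is a torsion class of $\operatorname{mod}(A)$ and equals $\Phi(B)\cap\operatorname{mod}(A)$. -/

import Mathlib

open CategoryTheory

universe u v w

/-! ## Bound quivers with quadratic monomial relations and their algebras -/

/-- A finite quiver together with a set of paths of length two: `rel β α` says that the path `βα`
(first `α`, then `β`) is one of the chosen generators of the ideal `I`. -/
structure BoundQuiver where
  /-- vertices -/
  V : Type v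
  /-- arrows -/
  E : Type v
  [fintypeV : Fintype V]
  [fintypeE : Fintype E]
  /-- source of an arrow -/
  s : E → V
  /-- target of an arrow -/
  t : E → V
  /-- `rel β α`: the path `βα` is one of the generators of `I` -/
  rel : E → E → Prop
  /-- the generators are paths, i.e. `α` ends where `β` starts -/
  rel_comp : ∀ β α, rel β α → s β = t α

attribute [instance] BoundQuiver.fintypeV BoundQuiver.fintypeE

namespace BoundQuiver

/-- The generators of `kQ / I`: lazy paths and arrows. -/
abbrev Gen (Q : BoundQuiver.{v}) : Type v := Q.V ⊕ Q.E

/-- Defining relations of `kQ / I`. The first five kinds present the path algebra `kQ` of the finite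
quiver `Q` (products are written as compositions, so `β * α` is "first `α`, then `β`"), the last one
kills the generators of `I`. -/
inductive AlgRel (k : Type u) [Field k] (Q : BoundQuiver.{v}) :
    FreeAlgebra k Q.Gen → FreeAlgebra k Q.Gen → Prop
  | idem (i : Q.V) : AlgRel k Q
      (FreeAlgebra.ι k (Sum.inl i) * FreeAlgebra.ι k (Sum.inl i)) (FreeAlgebra.ι k (Sum.inl i))
  | orth (i j : Q.V) (h : i ≠ j) : AlgRel k Q
      (FreeAlgebra.ι k (Sum.inl i) * FreeAlgebra.ι k (Sum.inl j)) 0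
  | one : AlgRel k Q (∑ i : Q.V, FreeAlgebra.ι k (Sum.inl i)) 1
  | tgt (α : Q.E) : AlgRel k Q
      (FreeAlgebra.ι k (Sum.inl (Q.t α)) * FreeAlgebra.ι k (Sum.inr α)) (FreeAlgebra.ι k (Sum.inr α))
  | src (α : Q.E) : AlgRel k Q
      (FreeAlgebra.ι k (Sum.inr α) * FreeAlgebra.ι k (Sum.inl (Q.s α))) (FreeAlgebra.ι k (Sum.inr α))
  | zero (β α : Q.E) (h : Q.rel β α) : AlgRel k Q
      (FreeAlgebra.ι k (Sum.inr β) * FreeAlgebra.ι k (Sum.inr α)) 0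

/-- The bound quiver algebra `kQ / I`. -/
abbrev Alg (k : Type u) [Field k] (Q : BoundQuiver.{v}) : Type (max u v) :=
  RingQuot (AlgRel k Q)

/-- The class of the lazy path `e_i` in `kQ / I`. -/
noncomputable def idemp (k : Type u) [Field k] (Q : BoundQuiver.{v}) (i : Q.V) : Alg k Q :=
  RingQuot.mkAlgHom k (AlgRel k Q) (FreeAlgebra.ι k (Sum.inl i))

/-- The class of the arrow `α` in `kQ / I`. -/
noncomputable def arrow (k : Type u) [Field k] (Q : BoundQuiver.{v}) (α : Q.E) : Alg k Q :=
  RingQuot.mkAlgHom k (AlgRel k Q) (FreeAlgebra.ι k (Sum.inr α))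

/-- `A = kQ / I` is a gentle algebra. (Here `I` is generated by paths of length two by construction,
so `A` is finite dimensional if and only if `I` is admissible.) -/
structure IsGentle (k : Type u) [Field k] (Q : BoundQuiver.{v}) : Prop where
  finite : Module.Finite k (Alg k Q)
  out_le_two : ∀ i : Q.V, {α : Q.E | Q.s α = i}.ncard ≤ 2
  in_le_two : ∀ i : Q.V, {α : Q.E | Q.t α = i}.ncard ≤ 2
  not_rel_right : ∀ α : Q.E, {β : Q.E | Q.s α = Q.t β ∧ ¬ Q.rel α β}.Subsingleton
  not_rel_left : ∀ α : Q.E, {γ : Q.E | Q.s γ = Q.t α ∧ ¬ Q.rel γ α}.Subsingleton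
  rel_right : ∀ α : Q.E, {β : Q.E | Q.rel α β}.Subsingleton
  rel_left : ∀ α : Q.E, {γ : Q.E | Q.rel γ α}.Subsingleton

/-! ## Strings -/

/-- Arrows (`(α, true)`) and formal inverses of arrows (`(α, false)`). -/
abbrev Letter (Q : BoundQuiver.{v}) : Type v := Q.E × Bool

variable {Q : BoundQuiver.{v}}

/-- Source of a letter. -/
def Letter.src (l : Q.Letter) : Q.V := if l.2 then Q.s l.1 else Q.t l.1

/-- Target of a letter. -/
def Letter.tgt (l : Q.Letter) : Q.V := if l.2 then Q.t l.1 else Q.s l.1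

/-- Formal inverse of a letter. -/
def Letter.inv (l : Q.Letter) : Q.Letter := (l.1, !l.2)

/-- A word `γ_d^{ε_d} ⋯ γ_1^{ε_1}`, stored as its starting vertex and the list
`[γ_1^{ε_1}, …, γ_d^{ε_d}]` in the order in which the letters are traversed. The word with vertex `i`
and no letters is `e_i`. -/
@[ext]
structure Word (Q : BoundQuiver.{v}) where
  /-- the vertex where the word starts -/
  start : Q.V
  /-- the letters in the order of traversal -/
  letters : List Q.Letter

namespace Word

/-- Length of a word. -/
def length (w : Q.Word) : ℕ := w.letters.length

/-- The list `[x_1, …, x_{d+1}]` of the vertices visited by a word. -/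
def vertices (w : Q.Word) : List Q.V := w.start :: w.letters.map Letter.tgt

theorem length_vertices (w : Q.Word) : w.vertices.length = w.length + 1 := by
  simp [vertices, length]

/-- The `j`-th vertex visited by a word, counted from `0`. -/
def vertex (w : Q.Word) (j : Fin (w.length + 1)) : Q.V :=
  w.vertices[j.val]'(w.length_vertices.symm ▸ j.isLt)

/-- The vertex where the word terminates. -/
def finish (w : Q.Word) : Q.V := w.vertex (Fin.last _)

/-- The inverse word. -/
def inv (w : Q.Word) : Q.Word := ⟨w.finish, (w.letters.map Letter.inv).reverse⟩

/-- The word `v l u`: first `u`, then the letter `l`, then `v`. -/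
def concat (v : Q.Word) (l : Q.Letter) (u : Q.Word) : Q.Word :=
  ⟨u.start, u.letters ++ l :: v.letters⟩

end Word

/-- `m` may follow `l` in a string: they are composable, `m` is not the inverse of `l`, and neither
`m l` nor its inverse is one of the generators of `I`. -/
def Step (l m : Q.Letter) : Prop :=
  m.src = l.tgt ∧ m ≠ l.inv ∧
    ¬ (l.2 = true ∧ m.2 = true ∧ Q.rel m.1 l.1) ∧
    ¬ (l.2 = false ∧ m.2 = false ∧ Q.rel l.1 m.1)

/-- The word is a string of `(Q, I)`. (A path contains a subpath in `I` if and only if two consecutive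
arrows of it form a generator of `I`.) -/
def Word.IsString (w : Q.Word) : Prop :=
  (∀ l ∈ w.letters.head?, l.src = w.start) ∧ w.letters.IsChain Step

/-- Closedness of a set of words among the strings: whenever `u, v ∈ B` and the concatenation
`v γ^{±1} u` exists and is a string, it belongs to `B`. -/
def IsClosedSet (B : Set Q.Word) : Prop :=
  ∀ u ∈ B, ∀ v ∈ B, ∀ l : Q.Letter, l.src = u.finish → l.tgt = v.start →
    (Word.concat v l u).IsString → Word.concat v l u ∈ B

/-- Biclosed sets of strings. A subset of `Str(A)`, where `w` and `w⁻¹` are identified, is given as a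
set of strings which is stable under inversion. -/
structure IsBiclosed (B : Set Q.Word) : Prop where
  isString : ∀ w ∈ B, w.IsString
  inv_mem : ∀ w ∈ B, w.inv ∈ B
  closed : IsClosedSet B
  coclosed : IsClosedSet {w : Q.Word | w.IsString ∧ w ∉ B}

/-- The poset `Bic(A)` of biclosed sets of strings, ordered by inclusion. -/
abbrev Bic (Q : BoundQuiver.{v}) : Type v := {B : Set Q.Word // IsBiclosed B}

/-! ## String modules -/

/-- In the diagram of `w`, the arrow `α` leads from the `j`-th to the `i`-th vertex. -/
def Word.ArrowFromTo (w : Q.Word) (α : Q.E) (j i : Fin (w.length + 1)) : Prop :=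
  (i.val = j.val + 1 ∧ w.letters[j.val]? = some (α, true)) ∨
    (j.val = i.val + 1 ∧ w.letters[i.val]? = some (α, false))

/-- `X` is (isomorphic to) the string module `M(w)`: it has a `k`-basis `x_0, …, x_d` indexed by the
vertices visited by `w`, with `x_j` sitting at the `j`-th vertex, and an arrow `α` sends `x_j` to `x_i`
if the diagram of `w` contains `α : j → i`, and to zero if no such `i` exists. -/
def IsStringModule (k : Type u) [Field k] (w : Q.Word)
    (X : ModuleCat.{max u v} (Alg k Q)) : Prop :=
  ∃ (_ : Module k X) (_ : IsScalarTower k (Alg k Q) X)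
    (x : Module.Basis (Fin (w.length + 1)) k X),
    (∀ j, idemp k Q (w.vertex j) • x j = x j) ∧
    (∀ i j, w.vertex j ≠ i → idemp k Q i • x j = 0) ∧
    (∀ α j i, w.ArrowFromTo α j i → arrow k Q α • x j = x i) ∧
    (∀ α j, (∀ i, ¬ w.ArrowFromTo α j i) → arrow k Q α • x j = 0)

end BoundQuiver

/-! ## Subcategories of `mod Λ`

`mod Λ` consists of the finitely generated modules. A full subcategory is given by a property of
objects. -/

section Subcategories

variable {Λ : Type w} [Ring Λ]

/-- `add P`: the direct summands of finite direct sums of modules in `P`. -/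
def addClosure (P : ObjectProperty (ModuleCat.{w} Λ)) : ObjectProperty (ModuleCat.{w} Λ) :=
  fun X => ∃ (n : ℕ) (Y : Fin n → ModuleCat.{w} Λ),
    (∀ i, P (Y i)) ∧ Nonempty (Retract X (ModuleCat.of Λ (∀ i, Y i)))

/-- Torsion classes of `mod Λ`: full additive subcategories closed under quotients and extensions. -/
structure IsTorsionClass (T : ObjectProperty (ModuleCat.{w} Λ)) : Prop where
  le_fg : T ≤ ModuleCat.isFG Λ
  zero : T.ContainsZero
  quotients : T.IsClosedUnderQuotients
  extensions : T.IsClosedUnderExtensions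

/-- The poset of `M`-torsion shadows `T ∩ M`, with `T` a torsion class of `mod Λ`, ordered by
inclusion. -/
abbrev TorsionShadow (M : ObjectProperty (ModuleCat.{w} Λ)) : Type (w + 1) :=
  {S : ObjectProperty (ModuleCat.{w} Λ) // ∃ T, IsTorsionClass T ∧ S = T ⊓ M}

/-- The endomorphism ring of `X` is a division ring. -/
def IsBrick (X : ModuleCat.{w} Λ) : Prop :=
  Nontrivial (End X) ∧ ∀ f : End X, f ≠ 0 → IsUnit f

variable (Λ) in
/-- Every indecomposable finitely generated module is a brick. -/
def IsBrickAlgebra : Prop :=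
  ∀ X : ModuleCat.{w} Λ, ModuleCat.isFG Λ X → Indecomposable X → IsBrick X

/-- For every short exact sequence `0 → X → Y → Z → 0` of indecomposable modules in `mod Λ`, if `X` and
`Z` are in `C`, then so is `Y`. -/
def IsWeaklyExtensionClosed (C : ObjectProperty (ModuleCat.{w} Λ)) : Prop :=
  ∀ S : ShortComplex (ModuleCat.{w} Λ), S.ShortExact →
    ModuleCat.isFG Λ S.X₁ → ModuleCat.isFG Λ S.X₂ → ModuleCat.isFG Λ S.X₃ →
    Indecomposable S.X₁ → Indecomposable S.X₂ → Indecomposable S.X₃ →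
    C S.X₁ → C S.X₃ → C S.X₂

/-- `C^c`: the modules `X` in `mod Λ` such that `add X ∩ C = 0`. -/
def complementSubcategory (C : ObjectProperty (ModuleCat.{w} Λ)) :
    ObjectProperty (ModuleCat.{w} Λ) :=
  fun X => ModuleCat.isFG Λ X ∧ ∀ Y, addClosure (fun Z => Z = X) Y → C Y → Limits.IsZero Y

/-- Biclosed subcategories of `mod Λ`: additive subcategories (full, closed under isomorphisms, finite
direct sums and direct summands) such that `C` and `C^c` are weakly extension-closed. -/
structure IsBiclosedSubcategory (C : ObjectProperty (ModuleCat.{w} Λ)) : Prop where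
  le_fg : C ≤ ModuleCat.isFG Λ
  additive : addClosure C ≤ C
  closed : IsWeaklyExtensionClosed C
  coclosed : IsWeaklyExtensionClosed (complementSubcategory C)

end Subcategories

namespace BoundQuiver

/-! ## The doubled algebra -/

/-- The relations of the doubled quiver: `βα` and `α*β*` for `βα` a relation of `Q`. The arrow `γ` of
`Q` is `Sum.inl γ` and its dual `γ*` is `Sum.inr γ`. -/
inductive DoubleRel (Q : BoundQuiver.{v}) : Q.E ⊕ Q.E → Q.E ⊕ Q.E → Prop
  | orig (β α : Q.E) (h : Q.rel β α) : DoubleRel Q (Sum.inl β) (Sum.inl α)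
  | dual (β α : Q.E) (h : Q.rel β α) : DoubleRel Q (Sum.inr α) (Sum.inr β)

/-- The doubled bound quiver: for each arrow `γ : i → j` there is an additional arrow `γ* : j → i`. -/
def double (Q : BoundQuiver.{v}) : BoundQuiver.{v} where
  V := Q.V
  E := Q.E ⊕ Q.E
  s := Sum.elim Q.s Q.t
  t := Sum.elim Q.t Q.s
  rel := DoubleRel Q
  rel_comp := by
    rintro _ _ (⟨β, α, h⟩ | ⟨β, α, h⟩)
    · exact Q.rel_comp β α h
    · exact (Q.rel_comp β α h).symm

/-- `Π(A)`, the algebra of the doubled bound quiver. -/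
abbrev PiAlg (k : Type u) [Field k] (Q : BoundQuiver.{v}) : Type (max u v) := Alg k Q.double

/-- Images of the generators under the projection `Π(A) → A`. -/
noncomputable def projGen (k : Type u) [Field k] (Q : BoundQuiver.{v}) : Q.double.Gen → Alg k Q
  | Sum.inl i => idemp k Q i
  | Sum.inr (Sum.inl γ) => arrow k Q γ
  | Sum.inr (Sum.inr _) => 0

theorem projGen_rel (k : Type u) [Field k] (Q : BoundQuiver.{v})
    ⦃x y : FreeAlgebra k Q.double.Gen⦄ (h : AlgRel k Q.double x y) :
    FreeAlgebra.lift k (projGen k Q) x = FreeAlgebra.lift k (projGen k Q) y := by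
  cases h with
  | idem i =>
    rw [map_mul, FreeAlgebra.lift_ι_apply]
    exact (map_mul _ _ _).symm.trans (RingQuot.mkAlgHom_rel k (AlgRel.idem (Q := Q) i))
  | orth i j h =>
    rw [map_mul, FreeAlgebra.lift_ι_apply, FreeAlgebra.lift_ι_apply, map_zero]
    exact (map_mul _ _ _).symm.trans
      ((RingQuot.mkAlgHom_rel k (AlgRel.orth (Q := Q) i j h)).trans (map_zero _))
  | one =>
    simp only [map_sum, FreeAlgebra.lift_ι_apply, map_one]
    exact (map_sum _ _ _).symm.trans
      ((RingQuot.mkAlgHom_rel k (AlgRel.one (k := k) (Q := Q))).trans (map_one _))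
  | tgt α =>
    rw [map_mul, FreeAlgebra.lift_ι_apply, FreeAlgebra.lift_ι_apply]
    rcases α with α | α
    · exact (map_mul _ _ _).symm.trans (RingQuot.mkAlgHom_rel k (AlgRel.tgt α))
    · exact mul_zero _
  | src α =>
    rw [map_mul, FreeAlgebra.lift_ι_apply, FreeAlgebra.lift_ι_apply]
    rcases α with α | α
    · exact (map_mul _ _ _).symm.trans (RingQuot.mkAlgHom_rel k (AlgRel.src α))
    · exact zero_mul _
  | zero β α h =>
    rw [map_mul, FreeAlgebra.lift_ι_apply, FreeAlgebra.lift_ι_apply, map_zero]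
    rcases h with ⟨β, α, h⟩ | ⟨β, α, h⟩
    · exact (map_mul _ _ _).symm.trans
        ((RingQuot.mkAlgHom_rel k (AlgRel.zero β α h)).trans (map_zero _))
    · exact zero_mul _

/-- The canonical projection `Π(A) → A`, which fixes the lazy paths and the arrows of `Q`, and kills the
dual arrows. -/
noncomputable def proj (k : Type u) [Field k] (Q : BoundQuiver.{v}) : PiAlg k Q →ₐ[k] Alg k Q :=
  RingQuot.liftAlgHom k ⟨FreeAlgebra.lift k (projGen k Q), projGen_rel k Q⟩

/-- `P ∩ mod A` for a subcategory `P` of `mod Π(A)`, where `A`-modules are regarded as `Π(A)`-modules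
along the projection `Π(A) → A`. -/
noncomputable def interMod (k : Type u) [Field k] (Q : BoundQuiver.{v})
    (P : ObjectProperty (ModuleCat.{max u v} (PiAlg k Q))) :
    ObjectProperty (ModuleCat.{max u v} (Alg k Q)) :=
  ModuleCat.isFG (Alg k Q) ⊓
    P.inverseImage (ModuleCat.restrictScalars (proj k Q : PiAlg k Q →+* Alg k Q))

/-! ## Specialization and torsion shadows -/

variable {Q : BoundQuiver.{v}}

/-- Replace `γ*` by `γ⁻¹` and `(γ*)⁻¹` by `γ`. -/
def specializeLetter : Q.double.Letter → Q.Letter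
  | (Sum.inl γ, ε) => (γ, ε)
  | (Sum.inr γ, ε) => (γ, !ε)

/-- The word of `Q` obtained by replacing every `γ*` by `γ⁻¹` and every `(γ*)⁻¹` by `γ`. -/
def specialize (w : Q.double.Word) : Q.Word := ⟨w.start, w.letters.map specializeLetter⟩

/-- `w` is a string of `Π(A)` which specializes to a string of `A`. -/
def IsLiftedString (w : Q.double.Word) : Prop := w.IsString ∧ (specialize w).IsString

/-- The subcategory `M` of `mod Π(A)`, additively generated by the string modules of strings which
specialize to strings of `A`. -/
def shadowCat (k : Type u) [Field k] (Q : BoundQuiver.{v}) :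
    ObjectProperty (ModuleCat.{max u v} (PiAlg k Q)) :=
  addClosure fun X => ∃ w : Q.double.Word, IsLiftedString w ∧ IsStringModule k w X

/-- The poset `torshad_M(Π(A))`. -/
abbrev TorShad (k : Type u) [Field k] (Q : BoundQuiver.{v}) : Type (max u v + 1) :=
  TorsionShadow (shadowCat k Q)

/-- The strings `w` of `A` such that `M(w')` is in `S` for some string `w'` specializing to `w`. -/
def stringsOf (k : Type u) [Field k] (S : ObjectProperty (ModuleCat.{max u v} (PiAlg k Q))) :
    Set Q.Word :=
  {w | ∃ w' : Q.double.Word, IsLiftedString w' ∧ specialize w' = w ∧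
    ∃ X, IsStringModule k w' X ∧ S X}

/-- `add (⨁ M(w) | w ∈ B)` in `mod A`, for a set `B` of strings of `A`. -/
def addStrings (k : Type u) [Field k] (B : Set Q.Word) :
    ObjectProperty (ModuleCat.{max u v} (Alg k Q)) :=
  addClosure fun X => ∃ w ∈ B, IsStringModule k w X

/-- The specialization of a torsion shadow `S`: the subcategory `add (⨁ M(w))` of `mod A`, over the
strings `w` to which some string `w'` with `M(w')` in `S` specializes. -/
def specialization (k : Type u) [Field k]
    (S : ObjectProperty (ModuleCat.{max u v} (PiAlg k Q))) :
    ObjectProperty (ModuleCat.{max u v} (Alg k Q)) :=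
  addStrings k (stringsOf k S)

/-- The map `Bic(A) → tors(A)`: it sends `B` to the subcategory of the modules in `mod A` all of whose
quotients are direct sums of string modules `M(w)` with `w ∈ B`. -/
def bicToTors (k : Type u) [Field k] (B : Set Q.Word) :
    ObjectProperty (ModuleCat.{max u v} (Alg k Q)) :=
  fun X => ModuleCat.isFG (Alg k Q) X ∧
    ∀ (Y : ModuleCat.{max u v} (Alg k Q)) (f : X ⟶ Y), Epi f → addStrings k B Y

end BoundQuiver

/-!
# Biclosed sets of strings and torsion shadows of gentle brick algebras

Let `A = kQ/I` be a gentle brick algebra. The brick hypothesis forces every string of `A` to be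
self-avoiding, i.e. to visit no vertex twice: from a minimal string that returns to a vertex one
obtains, up to rotation and continuation by one letter, an indecomposable string module with a
nonzero endomorphism that is not injective (`selfAvoiding_of_isBrickAlgebra`). For a self-avoiding
string `w`, with or without dual arrows, the submodules of `M(w)` are spanned by basis vectors, so
that the maximal intervals of `w` inside of a submodule `N`, and outside of it, give direct summands
of `N` and of `M(w)/N` (`IsStringModule.exists_runs`). Moreover, the nonzero endomorphisms of `M(w)`
are invertible, and `M(w)` determines `w` up to inversion. All finitely generated `A`-modules are
direct sums of string modules: in a nonzero module, the functorial filtrations at a vertex produce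
compatible vectors and linear forms along a string, which split off its string module
(`addStrings_of_finite`).

A set of strings closed under concatenation contains a string as soon as it contains its subwords on
the runs of some set of positions (`IsClosedSet.mem_of_runs`). Together with the description of
submodules, this turns closedness of `B` into closedness under extensions, both for the subcategory
`add (⨁ M(w) | w ∈ B)` of `mod A` and for the subcategory `torsOf k B` of the `Π(A)`-modules all of
whose quotients of the form `M(w')`, with `w'` a lift of some string `w`, satisfy `w ∈ B`.

The isomorphism sends `B` to the shadow of the torsion class `torsOf k B`. Two facts show that it is
one. First, for a biclosed set `B` every `w ∈ B` has a lift with module in `torsOf k B`: the letters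
are directed in such a way that all factors of the lift belong to `B` (`stringsOf_torsOf`).
Secondly, a torsion class `T` of `Π(A)` contains `M(w')` if every factor of `w'` has some lift with
module in `T`, since two lifts of the same word always share a subword which is a factor of the one
and a submodule of the other (`containsString_of_factors`); hence `T ∩ M` is determined by its
strings. Torsion shadows have infima because torsion classes can be intersected, so both posets are
complete lattices.
-/

set_option linter.unusedSectionVars false

namespace BoundQuiver

/-! ### Words, positions and subwords -/

variable {P : BoundQuiver.{v}}

@[simp] theorem Letter.src_inv (l : P.Letter) : l.inv.src = l.tgt := by
  rcases l with ⟨a, _ | _⟩ <;> rfl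

@[simp] theorem Letter.tgt_inv (l : P.Letter) : l.inv.tgt = l.src := by
  rcases l with ⟨a, _ | _⟩ <;> rfl

@[simp] theorem Letter.inv_inv (l : P.Letter) : l.inv.inv = l := by
  rcases l with ⟨a, _ | _⟩ <;> rfl

theorem Letter.inv_eq_comm {l m : P.Letter} : l.inv = m ↔ l = m.inv :=
  ⟨fun h => by rw [← h, Letter.inv_inv], fun h => by rw [h, Letter.inv_inv]⟩

theorem Step.inv {l m : P.Letter} (h : Step l m) : Step m.inv l.inv := by
  obtain ⟨h1, h2, h3, h4⟩ := h
  refine ⟨by simp [h1], fun h => h2 (by simpa using h.symm), ?_, ?_⟩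
  · rcases l with ⟨a, _ | _⟩ <;> rcases m with ⟨b, _ | _⟩ <;> simp_all [Letter.inv]
  · rcases l with ⟨a, _ | _⟩ <;> rcases m with ⟨b, _ | _⟩ <;> simp_all [Letter.inv]

namespace Word

/-- The vertex at position `j` of a word; the value is irrelevant for `j > w.length`. -/
def vtx (w : P.Word) (j : ℕ) : P.V := (w.vertices)[j]?.getD w.start

/-- In the diagram of `w`, the arrow `α` leads from position `j` to position `i`
(positions are natural numbers here). -/
def Arr (w : P.Word) (α : P.E) (j i : ℕ) : Prop :=
  (i = j + 1 ∧ w.letters[j]? = some (α, true)) ∨ (j = i + 1 ∧ w.letters[i]? = some (α, false))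

/-- The subword of `w` between the positions `a` and `b`. -/
def slice (w : P.Word) (a b : ℕ) : P.Word := ⟨w.vtx a, (w.letters.drop a).take (b - a)⟩

/-- A word is self-avoiding if it visits no vertex twice. -/
def SelfAvoiding (w : P.Word) : Prop :=
  ∀ i j, i ≤ w.length → j ≤ w.length → w.vtx i = w.vtx j → i = j

theorem vertex_eq (w : P.Word) (j : Fin (w.length + 1)) : w.vertex j = w.vtx j := by
  have : j.val < w.vertices.length := by rw [length_vertices]; exact j.2
  simp [vertex, vtx, List.getElem?_eq_getElem this]

theorem arrowFromTo_iff (w : P.Word) (α : P.E) (j i : Fin (w.length + 1)) :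
    w.ArrowFromTo α j i ↔ w.Arr α j i := Iff.rfl

@[simp] theorem vtx_zero (w : P.Word) : w.vtx 0 = w.start := rfl

theorem vtx_succ {w : P.Word} {j : ℕ} {l : P.Letter} (h : w.letters[j]? = some l) :
    w.vtx (j + 1) = l.tgt := by
  simp [vtx, vertices, h]

theorem lt_length {w : P.Word} {j : ℕ} {l : P.Letter} (h : w.letters[j]? = some l) :
    j < w.length := (List.getElem?_eq_some_iff.1 h).1

theorem exists_letter {w : P.Word} {j : ℕ} (h : j < w.length) : ∃ l, w.letters[j]? = some l :=
  ⟨_, List.getElem?_eq_getElem h⟩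

theorem finish_eq (w : P.Word) : w.finish = w.vtx w.length := w.vertex_eq _

theorem Arr.le {w : P.Word} {α : P.E} {j i : ℕ} (h : w.Arr α j i) :
    j ≤ w.length ∧ i ≤ w.length := by
  rcases h with ⟨rfl, h⟩ | ⟨rfl, h⟩ <;> have := lt_length h <;> omega

theorem IsString.step {w : P.Word} (hw : w.IsString) {j : ℕ} {l m : P.Letter}
    (h : w.letters[j]? = some l) (h' : w.letters[j + 1]? = some m) : Step l m := by
  obtain ⟨h1, rfl⟩ := List.getElem?_eq_some_iff.1 h
  obtain ⟨h2, rfl⟩ := List.getElem?_eq_some_iff.1 h'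
  exact List.isChain_iff_getElem.1 hw.2 j h2

theorem IsString.vtx_eq {w : P.Word} (hw : w.IsString) {j : ℕ} {l : P.Letter}
    (h : w.letters[j]? = some l) : w.vtx j = l.src := by
  cases j with
  | zero => exact (hw.1 l (by rw [List.head?_eq_getElem?]; exact h)).symm
  | succ j =>
    obtain ⟨m, hm⟩ := exists_letter (w := w) (j := j) (by have := lt_length h; omega)
    rw [vtx_succ hm, (hw.step hm h).1]

theorem isString_iff {w : P.Word} : w.IsString ↔
    (∀ l, w.letters[0]? = some l → l.src = w.start) ∧
    ∀ j l m, w.letters[j]? = some l → w.letters[j + 1]? = some m → Step l m := by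
  constructor
  · intro h
    exact ⟨fun l hl => (h.vtx_eq hl).symm, fun j l m => h.step⟩
  · rintro ⟨h1, h2⟩
    refine ⟨fun l hl => h1 l (by rw [← List.head?_eq_getElem?]; exact hl), ?_⟩
    rw [List.isChain_iff_getElem]
    intro j hj
    exact h2 j _ _ (List.getElem?_eq_getElem _) (List.getElem?_eq_getElem _)

theorem IsString.arr_src {w : P.Word} (hw : w.IsString) {α : P.E} {j i : ℕ} (h : w.Arr α j i) :
    P.s α = w.vtx j := by
  rcases h with ⟨rfl, h⟩ | ⟨rfl, h⟩
  · rw [hw.vtx_eq h]; rfl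
  · rw [vtx_succ h]; rfl

theorem IsString.arr_tgt {w : P.Word} (hw : w.IsString) {α : P.E} {j i : ℕ} (h : w.Arr α j i) :
    P.t α = w.vtx i := by
  rcases h with ⟨rfl, h⟩ | ⟨rfl, h⟩
  · rw [vtx_succ h]; rfl
  · rw [hw.vtx_eq h]; rfl

theorem IsString.arr_unique {w : P.Word} (hw : w.IsString) {α : P.E} {j i i' : ℕ}
    (h : w.Arr α j i) (h' : w.Arr α j i') : i = i' := by
  rcases h with ⟨rfl, h⟩ | ⟨rfl, h⟩ <;> rcases h' with ⟨rfl, h'⟩ | ⟨h0, h'⟩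
  · rfl
  · subst h0; exact absurd rfl (hw.step h' h).2.1
  · exact absurd rfl (hw.step h h').2.1
  · omega

theorem IsString.arr_unique' {w : P.Word} (hw : w.IsString) {α : P.E} {j j' i : ℕ}
    (h : w.Arr α j i) (h' : w.Arr α j' i) : j = j' := by
  rcases h with ⟨rfl, h⟩ | ⟨rfl, h⟩ <;> rcases h' with ⟨h0, h'⟩ | ⟨rfl, h'⟩
  · omega
  · exact absurd rfl (hw.step h h').2.1
  · subst h0; exact absurd rfl (hw.step h' h).2.1
  · rfl

theorem IsString.not_rel {w : P.Word} (hw : w.IsString) {α β : P.E} {j i m : ℕ}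
    (h : w.Arr α j i) (h' : w.Arr β i m) : ¬ P.rel β α := by
  intro hr
  rcases h with ⟨rfl, h⟩ | ⟨rfl, h⟩ <;> rcases h' with ⟨rfl, h'⟩ | ⟨h0, h'⟩
  · exact (hw.step h h').2.2.1 ⟨rfl, rfl, hr⟩
  · have : j = m := by omega
    subst this
    rw [h] at h'; simp at h'
  · rw [h] at h'; simp at h'
  · subst h0
    exact (hw.step h' h).2.2.2 ⟨rfl, rfl, hr⟩

/-! ### Subwords -/

theorem slice_length {w : P.Word} {a b : ℕ} (hb : b ≤ w.length) : (w.slice a b).length = b - a := by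
  have : w.length = w.letters.length := rfl
  simp [slice, length]; omega

theorem slice_getElem? (w : P.Word) (a b j : ℕ) :
    (w.slice a b).letters[j]? = if j < b - a then w.letters[a + j]? else none := by
  simp [slice, List.getElem?_take]

theorem slice_getElem?_of_lt {w : P.Word} {a b j : ℕ} (h : j < b - a) :
    (w.slice a b).letters[j]? = w.letters[a + j]? := by
  rw [slice_getElem?, if_pos h]

theorem slice_getElem?_eq_some {w : P.Word} {a b j : ℕ} {l : P.Letter} :
    (w.slice a b).letters[j]? = some l ↔ j < b - a ∧ w.letters[a + j]? = some l := by
  rw [slice_getElem?]; split_ifs with h <;> simp [h]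

theorem slice_vtx {w : P.Word} {a b j : ℕ} (h : j ≤ b - a) (hb : b ≤ w.length) :
    (w.slice a b).vtx j = w.vtx (a + j) := by
  cases j with
  | zero => rfl
  | succ j =>
    obtain ⟨l, hl⟩ := exists_letter (w := w) (j := a + j) (by omega)
    rw [vtx_succ (slice_getElem?_eq_some.2 ⟨by omega, hl⟩), ← add_assoc, vtx_succ hl]

theorem slice_finish {w : P.Word} {a b : ℕ} (hab : a ≤ b) (hb : b ≤ w.length) :
    (w.slice a b).finish = w.vtx b := by
  rw [finish_eq, slice_length hb, slice_vtx le_rfl hb, Nat.add_sub_cancel' hab]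

theorem slice_arr {w : P.Word} {a b j i : ℕ} {α : P.E} (hj : j ≤ b - a) (hi : i ≤ b - a) :
    (w.slice a b).Arr α j i ↔ w.Arr α (a + j) (a + i) := by
  unfold Arr
  simp only [slice_getElem?_eq_some]
  constructor
  · rintro (⟨rfl, _, h⟩ | ⟨rfl, _, h⟩)
    · exact Or.inl ⟨by omega, h⟩
    · exact Or.inr ⟨by omega, h⟩
  · rintro (⟨h0, h⟩ | ⟨h0, h⟩)
    · exact Or.inl ⟨by omega, by omega, h⟩
    · exact Or.inr ⟨by omega, by omega, h⟩

theorem IsString.slice {w : P.Word} (hw : w.IsString) (a b : ℕ) : (w.slice a b).IsString := by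
  rw [isString_iff]
  constructor
  · intro l hl
    rw [slice_getElem?_eq_some] at hl
    exact (hw.vtx_eq hl.2).symm
  · intro j l m hl hm
    rw [slice_getElem?_eq_some] at hl hm
    exact hw.step hl.2 hm.2

@[simp] theorem slice_self (w : P.Word) : w.slice 0 w.length = w := by
  ext1
  · rfl
  · simp [Word.slice, length]

theorem slice_concat {w : P.Word} {a b c : ℕ} {l : P.Letter} (hac : a ≤ c) (hcb : c < b)
    (hl : w.letters[c]? = some l) :
    concat (w.slice (c + 1) b) l (w.slice a c) = w.slice a b := by
  ext1
  · rfl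
  · apply List.ext_getElem?
    intro j
    have h1 : (w.letters.drop a).take (c - a) ++ l :: (w.letters.drop (c + 1)).take (b - (c + 1)) =
      (concat (w.slice (c + 1) b) l (w.slice a c)).letters := rfl
    have hc : c < w.letters.length := lt_length hl
    have hlen : ((w.letters.drop a).take (c - a)).length = c - a := by
      simp; omega
    rw [← h1, slice_getElem?, List.getElem?_append, hlen]
    rcases lt_trichotomy j (c - a) with h | h | h
    · rw [if_pos h, if_pos (by omega), List.getElem?_take, if_pos h, List.getElem?_drop]
    · rw [if_neg (by omega), if_pos (by omega), h, Nat.sub_self, Nat.add_sub_cancel' hac, hl]; rfl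
    · rw [if_neg (by omega)]
      obtain ⟨i, rfl⟩ := Nat.exists_eq_add_of_lt h
      rw [show c - a + i + 1 - (c - a) = i + 1 by omega, List.getElem?_cons_succ,
        List.getElem?_take, List.getElem?_drop]
      by_cases hi : i < b - (c + 1)
      · rw [if_pos hi, if_pos (by omega)]; congr 1; omega
      · rw [if_neg hi, if_neg (by omega)]

theorem slice_slice {w : P.Word} {a b c d : ℕ} (hd : a + d ≤ b) (hcd : c ≤ d) (hb : b ≤ w.length) :
    (w.slice a b).slice c d = w.slice (a + c) (a + d) := by
  ext1
  · exact slice_vtx (by omega) hb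
  · apply List.ext_getElem?
    intro j
    rw [slice_getElem?, slice_getElem?, slice_getElem?]
    by_cases h : j < d - c
    · rw [if_pos h, if_pos (by omega), if_pos (by omega), add_assoc]
    · rw [if_neg h, if_neg (by omega)]

theorem SelfAvoiding.slice {w : P.Word} (hw : w.SelfAvoiding) {a b : ℕ} (hab : a ≤ b)
    (hb : b ≤ w.length) : (w.slice a b).SelfAvoiding := by
  intro i j hi hj h
  rw [slice_length hb] at hi hj
  rw [slice_vtx hi hb, slice_vtx hj hb] at h
  have := hw _ _ (by omega) (by omega) h
  omega

/-! ### Inverse words -/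

@[simp] theorem inv_length (w : P.Word) : w.inv.length = w.length := by
  simp [inv, length]

theorem inv_getElem? {w : P.Word} {j : ℕ} (h : j < w.length) :
    w.inv.letters[j]? = (w.letters[w.length - 1 - j]?).map Letter.inv := by
  have : (w.letters.map Letter.inv).length = w.length := by simp [length]
  rw [inv, List.getElem?_reverse (by omega), this, List.getElem?_map]

theorem inv_getElem?_eq_some {w : P.Word} {i j : ℕ} {l : P.Letter} (h : i + j + 1 = w.length) :
    w.inv.letters[j]? = some l ↔ w.letters[i]? = some l.inv := by
  rw [inv_getElem? (by omega), show w.length - 1 - j = i by omega]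
  simp only [Option.map_eq_some_iff, Letter.inv_eq_comm]
  constructor
  · rintro ⟨a, h, rfl⟩; exact h
  · intro h; exact ⟨_, h, rfl⟩

theorem IsString.inv_vtx {w : P.Word} (hw : w.IsString) {i j : ℕ} (h : i + j = w.length) :
    w.inv.vtx j = w.vtx i := by
  cases j with
  | zero => rw [vtx_zero]; exact (finish_eq w).trans (by rw [← h]; rfl)
  | succ j =>
    obtain ⟨l, hl⟩ := exists_letter (w := w) (j := i) (by omega)
    rw [vtx_succ (l := l.inv) ((inv_getElem?_eq_some (i := i) (by omega)).2 (by simpa using hl)),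
      hw.vtx_eq hl, Letter.tgt_inv]

theorem IsString.inv {w : P.Word} (hw : w.IsString) : w.inv.IsString := by
  rw [isString_iff]
  constructor
  · intro l hl
    have := lt_length hl
    rw [inv_length] at this
    rw [inv_getElem?_eq_some (i := w.length - 1) (by omega)] at hl
    have h2 := vtx_succ hl
    rw [Nat.sub_add_cancel this, ← finish_eq, Letter.tgt_inv] at h2
    exact h2.symm
  · intro j l m hl hm
    have := lt_length hm
    rw [inv_length] at this
    rw [inv_getElem?_eq_some (i := w.length - 1 - j) (by omega)] at hl
    rw [inv_getElem?_eq_some (i := w.length - 1 - (j + 1)) (by omega)] at hm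
    have h := (hw.step hm (by
      rw [show w.length - 1 - (j + 1) + 1 = w.length - 1 - j by omega]; exact hl)).inv
    simpa using h

theorem inv_arr {w : P.Word} {α : P.E} {i j i' j' : ℕ} (hi : i + i' = w.length)
    (hj : j + j' = w.length) : w.inv.Arr α j' i' ↔ w.Arr α j i := by
  unfold Arr
  constructor
  · rintro (⟨h0, h⟩ | ⟨h0, h⟩)
    · rw [inv_getElem?_eq_some (i := i) (by omega)] at h
      exact Or.inr ⟨by omega, h⟩
    · rw [inv_getElem?_eq_some (i := j) (by omega)] at h
      exact Or.inl ⟨by omega, h⟩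
  · rintro (⟨h0, h⟩ | ⟨h0, h⟩)
    · right; refine ⟨by omega, ?_⟩
      rw [inv_getElem?_eq_some (i := j) (by omega)]; exact h
    · left; refine ⟨by omega, ?_⟩
      rw [inv_getElem?_eq_some (i := i) (by omega)]; exact h

theorem IsString.inv_inv {w : P.Word} (hw : w.IsString) : w.inv.inv = w := by
  ext1
  · have := hw.inv_vtx (i := 0) (j := w.length) (by omega)
    rw [← inv_length, ← finish_eq] at this
    exact this
  · simp [Word.inv, List.map_reverse, Function.comp_def]

theorem IsString.selfAvoiding_inv {w : P.Word} (hw : w.IsString) (h : w.SelfAvoiding) :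
    w.inv.SelfAvoiding := by
  intro i j hi hj hij
  rw [inv_length] at hi hj
  rw [hw.inv_vtx (i := w.length - i) (by omega), hw.inv_vtx (i := w.length - j) (by omega)] at hij
  have := h _ _ (by omega) (by omega) hij
  omega

end Word

/-! ### Runs of a subset of positions -/

/-- `[a, b]` is a run of the set `χ` of positions of a word of length `n`: membership in `χ` is
constant on `[a, b]`, and `[a, b]` is maximal with this property. -/
structure IsRun (χ : ℕ → Prop) (n a b : ℕ) : Prop where
  le : a ≤ b
  le_length : b ≤ n
  const : ∀ j, a ≤ j → j ≤ b → (χ j ↔ χ a)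
  left : a ≠ 0 → ¬ (χ (a - 1) ↔ χ a)
  right : b ≠ n → ¬ (χ (b + 1) ↔ χ a)

theorem exists_run_left (χ : ℕ → Prop) (b : ℕ) :
    ∃ a ≤ b, (∀ j, a ≤ j → j ≤ b → (χ j ↔ χ b)) ∧ (a ≠ 0 → ¬ (χ (a - 1) ↔ χ b)) := by
  classical
  have h : ∃ a, a ≤ b ∧ ∀ j, a ≤ j → j ≤ b → (χ j ↔ χ b) :=
    ⟨b, le_rfl, fun j h1 h2 => by rw [le_antisymm h2 h1]⟩
  refine ⟨Nat.find h, (Nat.find_spec h).1, (Nat.find_spec h).2, fun h0 h1 => ?_⟩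
  refine Nat.find_min h (m := Nat.find h - 1) (by omega) ⟨by have := (Nat.find_spec h).1; omega, ?_⟩
  intro j hj hjb
  rcases eq_or_lt_of_le hj with rfl | hj
  · exact h1
  · exact (Nat.find_spec h).2 j (by omega) hjb

theorem exists_run_right (χ : ℕ → Prop) {n c : ℕ} (hc : c ≤ n) :
    ∃ b, c ≤ b ∧ b ≤ n ∧ (∀ j, c ≤ j → j ≤ b → (χ j ↔ χ c)) ∧ (b ≠ n → ¬ (χ (b + 1) ↔ χ c)) := by
  classical
  obtain ⟨a, ha, h1, h2⟩ := exists_run_left (fun j => χ (n - j)) (n - c)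
  refine ⟨n - a, by omega, by omega, fun j hj hj' => ?_, fun h => ?_⟩
  · have := h1 (n - j) (by omega) (by omega)
    rwa [show n - (n - j) = j by omega, show n - (n - c) = c by omega] at this
  · have := h2 (by omega)
    rwa [show n - (a - 1) = n - a + 1 by omega, show n - (n - c) = c by omega] at this

theorem exists_run (χ : ℕ → Prop) {n c : ℕ} (hc : c ≤ n) :
    ∃ a b, a ≤ c ∧ c ≤ b ∧ IsRun χ n a b := by
  obtain ⟨a, ha, h1, h2⟩ := exists_run_left χ c
  obtain ⟨b, hb, hbn, h3, h4⟩ := exists_run_right χ hc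
  have hac := h1 a le_rfl ha
  refine ⟨a, b, ha, hb, by omega, hbn, fun j hj hj' => ?_, fun h => ?_, fun h => ?_⟩
  · rcases le_total j c with h | h
    · rw [h1 j hj h, hac]
    · rw [h3 j h hj', hac]
  · rw [hac]; exact h2 h
  · rw [hac]; exact h4 h

/-- A word is the concatenation of the subwords on its runs. -/
theorem IsClosedSet.mem_of_runs {C : Set P.Word} (hC : IsClosedSet C) {w : P.Word}
    (hw : w.IsString) (χ : ℕ → Prop)
    (h : ∀ a b, IsRun χ w.length a b → w.slice a b ∈ C) : w ∈ C := by
  have key : ∀ b, b ≤ w.length → (b ≠ w.length → ¬ (χ (b + 1) ↔ χ b)) → w.slice 0 b ∈ C := by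
    intro b
    induction b using Nat.strong_induction_on with
    | _ b ih =>
      intro hb hb'
      obtain ⟨a, ha, h1, h2⟩ := exists_run_left χ b
      have hrun : w.slice a b ∈ C := by
        have hab := h1 a le_rfl ha
        refine h a b ⟨ha, hb, fun j hj hj' => ?_, fun h0 => ?_, fun h0 => ?_⟩
        · rw [h1 j hj hj', hab]
        · rw [hab]; exact h2 h0
        · rw [hab]; exact hb' h0
      rcases Nat.eq_zero_or_pos a with rfl | hpos
      · exact hrun
      · obtain ⟨c, rfl⟩ : ∃ c, a = c + 1 := ⟨a - 1, by omega⟩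
        have hu := ih c (by omega) (by omega) (fun _ h3 => by
          have h4 := h2 (by omega)
          rw [Nat.add_sub_cancel] at h4
          exact h4 (h3.symm.trans (h1 _ le_rfl ha)))
        obtain ⟨l, hl⟩ := Word.exists_letter (w := w) (j := c) (by omega)
        rw [← Word.slice_concat (Nat.zero_le c) (by omega) hl]
        refine hC _ hu _ hrun l ?_ ?_ ?_
        · rw [Word.slice_finish (Nat.zero_le _) (by omega), hw.vtx_eq hl]
        · exact (Word.vtx_succ hl).symm
        · rw [Word.slice_concat (Nat.zero_le c) (by omega) hl]
          exact hw.slice _ _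
  simpa using key w.length le_rfl (fun h => absurd rfl h)

end BoundQuiver

namespace BoundQuiver

/-! ### Modules over a bound quiver algebra -/

section Generators

variable {k : Type u} [Field k] {P : BoundQuiver.{v}}

theorem idemp_mul_self (i : P.V) : idemp k P i * idemp k P i = idemp k P i :=
  (map_mul _ _ _).symm.trans (RingQuot.mkAlgHom_rel k (AlgRel.idem (Q := P) i))

theorem idemp_mul_of_ne {i j : P.V} (h : i ≠ j) : idemp k P i * idemp k P j = 0 :=
  (map_mul _ _ _).symm.trans
    ((RingQuot.mkAlgHom_rel k (AlgRel.orth (Q := P) i j h)).trans (map_zero _))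

theorem sum_idemp : ∑ i : P.V, idemp k P i = 1 :=
  (map_sum _ _ _).symm.trans
    ((RingQuot.mkAlgHom_rel k (AlgRel.one (k := k) (Q := P))).trans (map_one _))

theorem idemp_mul_arrow (α : P.E) : idemp k P (P.t α) * arrow k P α = arrow k P α :=
  (map_mul _ _ _).symm.trans (RingQuot.mkAlgHom_rel k (AlgRel.tgt α))

theorem arrow_mul_idemp (α : P.E) : arrow k P α * idemp k P (P.s α) = arrow k P α :=
  (map_mul _ _ _).symm.trans (RingQuot.mkAlgHom_rel k (AlgRel.src α))

theorem arrow_mul_arrow {β α : P.E} (h : P.rel β α) : arrow k P β * arrow k P α = 0 :=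
  (map_mul _ _ _).symm.trans
    ((RingQuot.mkAlgHom_rel k (AlgRel.zero β α h)).trans (map_zero _))

theorem alg_induction {p : Alg k P → Prop} (halg : ∀ c : k, p (algebraMap k _ c))
    (he : ∀ i, p (idemp k P i)) (ha : ∀ α, p (arrow k P α))
    (hmul : ∀ a b, p a → p b → p (a * b)) (hadd : ∀ a b, p a → p b → p (a + b)) (a : Alg k P) :
    p a := by
  obtain ⟨a, rfl⟩ := RingQuot.mkAlgHom_surjective k (AlgRel k P) a
  induction a using FreeAlgebra.induction with
  | grade0 c => rw [AlgHom.commutes]; exact halg c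
  | grade1 x =>
    rcases x with i | α
    · exact he i
    · exact ha α
  | mul a b iha ihb => rw [map_mul]; exact hmul _ _ iha ihb
  | add a b iha ihb => rw [map_add]; exact hadd _ _ iha ihb

/-- Algebra homomorphisms out of `kQ / I` are given by images of the generators that satisfy the
defining relations. -/
theorem exists_algHom {S : Type*} [Semiring S] [Algebra k S] (e : P.V → S) (a : P.E → S)
    (h1 : ∀ i, e i * e i = e i) (h2 : ∀ i j, i ≠ j → e i * e j = 0) (h3 : ∑ i, e i = 1)
    (h4 : ∀ α, e (P.t α) * a α = a α) (h5 : ∀ α, a α * e (P.s α) = a α)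
    (h6 : ∀ β α, P.rel β α → a β * a α = 0) :
    ∃ φ : Alg k P →ₐ[k] S, (∀ i, φ (idemp k P i) = e i) ∧ ∀ α, φ (arrow k P α) = a α := by
  have hrel : ∀ ⦃x y : FreeAlgebra k P.Gen⦄, AlgRel k P x y →
      FreeAlgebra.lift k (Sum.elim e a) x = FreeAlgebra.lift k (Sum.elim e a) y := by
    intro x y h
    cases h <;> simp only [map_mul, map_sum, map_zero, map_one, FreeAlgebra.lift_ι_apply,
      Sum.elim_inl, Sum.elim_inr, h1, h3, h4, h5]
    · exact h2 _ _ ‹_›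
    · exact h6 _ _ ‹_›
  refine ⟨RingQuot.liftAlgHom k ⟨FreeAlgebra.lift k (Sum.elim e a), hrel⟩, fun i => ?_, fun α => ?_⟩
  · rw [idemp, RingQuot.liftAlgHom_mkAlgHom_apply, FreeAlgebra.lift_ι_apply]; rfl
  · rw [arrow, RingQuot.liftAlgHom_mkAlgHom_apply, FreeAlgebra.lift_ι_apply]; rfl

variable {X : Type*} [AddCommGroup X] [Module k X] [Module (Alg k P) X]
  [IsScalarTower k (Alg k P) X]
variable {Y : Type*} [AddCommGroup Y] [Module k Y] [Module (Alg k P) Y]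
  [IsScalarTower k (Alg k P) Y]

/-- A `k`-linear map that commutes with the lazy paths and the arrows is a homomorphism of
modules. -/
def homOfGenerators (f : X →ₗ[k] Y) (he : ∀ (i : P.V) x, f (idemp k P i • x) = idemp k P i • f x)
    (ha : ∀ (α : P.E) x, f (arrow k P α • x) = arrow k P α • f x) : X →ₗ[Alg k P] Y where
  toFun := f
  map_add' := map_add f
  map_smul' := by
    intro a
    induction a using alg_induction with
    | halg c => intro x; simp [algebraMap_smul]
    | he i => exact he i
    | ha α => exact ha α
    | hmul a b iha ihb =>
      intro x
      rw [mul_smul, iha, ihb, RingHom.id_apply, RingHom.id_apply, RingHom.id_apply, mul_smul]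
    | hadd a b iha ihb =>
      intro x
      rw [add_smul, map_add, iha, ihb, RingHom.id_apply, RingHom.id_apply, RingHom.id_apply,
        add_smul]

@[simp] theorem homOfGenerators_apply (f : X →ₗ[k] Y) (he) (ha) (x : X) :
    homOfGenerators (P := P) f he ha x = f x := rfl

theorem linearMap_smul (f : X →ₗ[Alg k P] Y) (c : k) (x : X) : f (c • x) = c • f x := by
  rw [← algebraMap_smul (Alg k P) c x, map_smul, algebraMap_smul]

theorem sum_idemp_smul (x : X) : ∑ i : P.V, idemp k P i • x = x := by
  rw [← Finset.sum_smul, sum_idemp, one_smul]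

end Generators

/-! ### String modules -/

section StringBasis

variable {k : Type u} [Field k] {P : BoundQuiver.{v}}
variable {X : Type*} [AddCommGroup X] [Module k X] [Module (Alg k P) X]
  [IsScalarTower k (Alg k P) X]
variable {Y : Type*} [AddCommGroup Y] [Module k Y] [Module (Alg k P) Y]
  [IsScalarTower k (Alg k P) Y]

/-- The basis vector at position `j`, extended by zero to all natural numbers. -/
noncomputable def bvec {n : ℕ} (x : Module.Basis (Fin (n + 1)) k X) (j : ℕ) : X :=
  if h : j < n + 1 then x ⟨j, h⟩ else 0

theorem bvec_of_le {n : ℕ} (x : Module.Basis (Fin (n + 1)) k X) {j : ℕ} (h : j ≤ n) :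
    bvec x j = x ⟨j, Nat.lt_succ_of_le h⟩ := dif_pos _

theorem bvec_of_lt {n : ℕ} (x : Module.Basis (Fin (n + 1)) k X) {j : ℕ} (h : n < j) :
    bvec x j = 0 := dif_neg (by omega)

@[simp] theorem bvec_val {n : ℕ} (x : Module.Basis (Fin (n + 1)) k X) (j : Fin (n + 1)) :
    bvec x j = x j := dif_pos j.2

theorem bvec_ne_zero {n : ℕ} (x : Module.Basis (Fin (n + 1)) k X) {j : ℕ} (h : j ≤ n) :
    bvec x j ≠ 0 := by
  rw [bvec_of_le x h]; exact x.ne_zero _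

/-- The vectors `x_0, …, x_n` form a basis that realizes `X` as the string module of `w`. -/
structure IsStringBasis (w : P.Word) (x : Module.Basis (Fin (w.length + 1)) k X) : Prop where
  idemp_smul : ∀ j i, idemp k P i • bvec x j = open Classical in if w.vtx j = i then bvec x j else 0
  arrow_smul : ∀ {α j i}, w.Arr α j i → arrow k P α • bvec x j = bvec x i
  arrow_smul_zero : ∀ {α j}, (∀ i, ¬ w.Arr α j i) → arrow k P α • bvec x j = 0

theorem isStringModule_of_basis {k : Type u} [Field k] {P : BoundQuiver.{v}} {X : Type (max u v)}
    [AddCommGroup X] [Module k X] [Module (Alg k P) X]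
    [IsScalarTower k (Alg k P) X] {w : P.Word} {x : Module.Basis (Fin (w.length + 1)) k X}
    (h : IsStringBasis w x) : IsStringModule k w (ModuleCat.of (Alg k P) X) := by
  refine ⟨‹_›, ‹_›, x, fun j => ?_, fun i j hij => ?_, fun α j i hα => ?_, fun α j hα => ?_⟩
  · have := h.idemp_smul j (w.vtx j)
    rw [if_pos rfl, bvec_val] at this
    rw [Word.vertex_eq]; exact this
  · have := h.idemp_smul j i
    rw [if_neg (by rwa [← Word.vertex_eq]), bvec_val] at this
    exact this
  · have := h.arrow_smul ((w.arrowFromTo_iff α j i).1 hα)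
    rwa [bvec_val, bvec_val] at this
  · have := h.arrow_smul_zero (α := α) (j := j) (fun i hi =>
      hα ⟨i, Nat.lt_succ_of_le hi.le.2⟩ hi)
    rwa [bvec_val] at this

theorem IsStringModule.exists_basis {w : P.Word} {X : ModuleCat.{max u v} (Alg k P)}
    (h : IsStringModule k w X) : ∃ (_ : Module k X) (_ : IsScalarTower k (Alg k P) X)
    (x : Module.Basis (Fin (w.length + 1)) k X), IsStringBasis w x := by
  obtain ⟨i1, i2, x, h1, h2, h3, h4⟩ := h
  refine ⟨i1, i2, x, fun j i => ?_, fun {α j i} hα => ?_, fun {α j} hα => ?_⟩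
  · rcases lt_or_ge w.length j with hj | hj
    · simp [bvec_of_lt x hj]
    · rw [bvec_of_le x hj]
      split_ifs with h
      · rw [← h]; have := h1 ⟨j, Nat.lt_succ_of_le hj⟩
        rwa [Word.vertex_eq] at this
      · exact h2 i _ (by rwa [Word.vertex_eq])
  · rw [bvec_of_le x hα.le.1, bvec_of_le x hα.le.2]
    exact h3 _ _ _ hα
  · rcases lt_or_ge w.length j with hj | hj
    · simp [bvec_of_lt x hj]
    · rw [bvec_of_le x hj]
      exact h4 _ _ (fun i hi => hα i hi)

/-- On a module over `kQ / I` there is at most one compatible `k`-module structure. -/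
theorem module_unique {X : Type*} [AddCommGroup X] [Module (Alg k P) X] (i1 i2 : Module k X)
    (h1 : @IsScalarTower k (Alg k P) X _ _ i1.toSMul)
    (h2 : @IsScalarTower k (Alg k P) X _ _ i2.toSMul) : i1 = i2 := by
  apply Module.ext'
  intro c x
  have e1 := h1.smul_assoc c (1 : Alg k P) x
  have e2 := h2.smul_assoc c (1 : Alg k P) x
  rw [one_smul] at e1 e2
  exact e1.symm.trans e2

namespace IsStringBasis

variable {w : P.Word} {x : Module.Basis (Fin (w.length + 1)) k X}

theorem map (hx : IsStringBasis w x) (f : X ≃ₗ[Alg k P] Y) :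
    ∃ y : Module.Basis (Fin (w.length + 1)) k Y, IsStringBasis w y ∧
      ∀ j, f (bvec x j) = bvec y j := by
  let f' : X ≃ₗ[k] Y := { f.toAddEquiv with
    map_smul' := fun c x => linearMap_smul f.toLinearMap c x }
  have key : ∀ j, bvec (x.map f') j = f (bvec x j) := by
    intro j
    unfold bvec
    split_ifs
    · simp; rfl
    · simp
  refine ⟨x.map f', ⟨fun j i => ?_, fun {α j i} hα => ?_, fun {α j} hα => ?_⟩, fun j => (key j).symm⟩
  · rw [key, ← map_smul, hx.idemp_smul]; split_ifs <;> simp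
  · rw [key, key, ← map_smul, hx.arrow_smul hα]
  · rw [key, ← map_smul, hx.arrow_smul_zero hα, map_zero]

/-- Reading the basis backwards realizes the string module of the inverse word. -/
theorem inv (hx : IsStringBasis w x) (hw : w.IsString) :
    ∃ y : Module.Basis (Fin (w.inv.length + 1)) k X, IsStringBasis w.inv y ∧
      ∀ i j, i + j = w.length → bvec y j = bvec x i := by
  let e : Fin (w.length + 1) ≃ Fin (w.inv.length + 1) :=
    Fin.revPerm.trans (finCongr (by rw [Word.inv_length]))
  have key : ∀ i j, i + j = w.length → bvec (x.reindex e) j = bvec x i := by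
    intro i j hij
    rw [bvec_of_le _ (by rw [Word.inv_length]; omega), bvec_of_le _ (by omega),
      Module.Basis.reindex_apply]
    congr 1
    rw [Equiv.symm_apply_eq]
    ext
    simp [e, Fin.rev]
    omega
  refine ⟨x.reindex e, ⟨fun j i => ?_, fun {α j i} hα => ?_, fun {α j} hα => ?_⟩, key⟩
  · rcases lt_or_ge w.length j with hj | hj
    · rw [bvec_of_lt _ (by rwa [Word.inv_length])]; simp
    · rw [key (w.length - j) j (by omega), hx.idemp_smul,
        hw.inv_vtx (i := w.length - j) (j := j) (by omega)]
  · have := hα.le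
    rw [Word.inv_length] at this
    rw [key (w.length - j) j (by omega), key (w.length - i) i (by omega)]
    exact hx.arrow_smul ((Word.inv_arr (by omega) (by omega)).1 hα)
  · rcases lt_or_ge w.length j with hj | hj
    · rw [bvec_of_lt _ (by rwa [Word.inv_length])]; simp
    · rw [key (w.length - j) j (by omega)]
      refine hx.arrow_smul_zero (fun i hi => ?_)
      have := hi.le
      exact hα (w.length - i) ((Word.inv_arr (w := w) (i := i) (j := w.length - j)
        (by omega) (by omega)).2 hi)

/-- To check that a `k`-linear map out of a string module is a homomorphism, it suffices to consider
the basis vectors. -/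
theorem commutes (f : X →ₗ[k] Y) (a : Alg k P)
    (h : ∀ j ≤ w.length, f (a • bvec x j) = a • f (bvec x j)) (z : X) : f (a • z) = a • f z := by
  have : f ∘ₗ Algebra.lsmul k k X a = Algebra.lsmul k k Y a ∘ₗ f := by
    apply x.ext
    intro j
    have := h j (Nat.le_of_lt_succ j.2)
    rw [bvec_val] at this
    simpa using this
  exact LinearMap.congr_fun this z

/-- Homomorphisms out of a string module are given by vectors that satisfy the same relations as the
basis. -/
theorem exists_hom (hx : IsStringBasis w x) (y : ℕ → Y)
    (h1 : ∀ j ≤ w.length, idemp k P (w.vtx j) • y j = y j)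
    (h2 : ∀ α j i, w.Arr α j i → arrow k P α • y j = y i)
    (h3 : ∀ α, ∀ j ≤ w.length, (∀ i, ¬ w.Arr α j i) → arrow k P α • y j = 0) :
    ∃ f : X →ₗ[Alg k P] Y, ∀ j ≤ w.length, f (bvec x j) = y j := by
  let f : X →ₗ[k] Y := x.constr k (fun j => y j)
  have hf : ∀ j ≤ w.length, f (bvec x j) = y j := by
    intro j hj
    rw [bvec_of_le x hj]; simp [f]
  refine ⟨homOfGenerators f (fun i => commutes (x := x) f _ fun j hj => ?_)
    (fun α => commutes (x := x) f _ fun j hj => ?_), hf⟩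
  · rw [hx.idemp_smul, hf j hj]
    split_ifs with h
    · rw [hf j hj, ← h, h1 j hj]
    · rw [map_zero, ← h1 j hj, ← mul_smul, idemp_mul_of_ne (Ne.symm h), zero_smul]
  · rw [hf j hj]
    by_cases h : ∃ i, w.Arr α j i
    · obtain ⟨i, hi⟩ := h
      rw [hx.arrow_smul hi, hf i hi.le.2, h2 α j i hi]
    · push Not at h
      rw [hx.arrow_smul_zero h, map_zero, h3 α j hj h]

theorem exists_equiv (hx : IsStringBasis w x) {y : Module.Basis (Fin (w.length + 1)) k Y}
    (hy : IsStringBasis w y) : Nonempty (X ≃ₗ[Alg k P] Y) := by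
  obtain ⟨f, hf⟩ := hx.exists_hom (bvec y) (fun j _ => by rw [hy.idemp_smul, if_pos rfl])
    (fun α j i => hy.arrow_smul) (fun α j _ => hy.arrow_smul_zero)
  obtain ⟨g, hg⟩ := hy.exists_hom (bvec x) (fun j _ => by rw [hx.idemp_smul, if_pos rfl])
    (fun α j i => hx.arrow_smul) (fun α j _ => hx.arrow_smul_zero)
  refine ⟨LinearEquiv.ofLinearMap f g ?_ ?_⟩
  · have : (f ∘ₗ g).restrictScalars k = LinearMap.id := y.ext fun j => by
      have hj := Nat.le_of_lt_succ j.2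
      have := hg j hj
      rw [bvec_val] at this
      simp only [LinearMap.restrictScalars_apply, LinearMap.comp_apply, LinearMap.id_apply]
      rw [this, hf j hj, bvec_val]
    ext z; exact LinearMap.congr_fun this z
  · have : (g ∘ₗ f).restrictScalars k = LinearMap.id := x.ext fun j => by
      have hj := Nat.le_of_lt_succ j.2
      have := hf j hj
      rw [bvec_val] at this
      simp only [LinearMap.restrictScalars_apply, LinearMap.comp_apply, LinearMap.id_apply]
      rw [this, hg j hj, bvec_val]
    ext z; exact LinearMap.congr_fun this z

end IsStringBasis

/-- Every vector space with a basis indexed by the positions of a string carries the structure of the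
string module. -/
theorem exists_module_of_basis {V : Type*} [AddCommGroup V] [Module k V] {w : P.Word}
    (hw : w.IsString) (b : Module.Basis (Fin (w.length + 1)) k V) :
    ∃ (_ : Module (Alg k P) V) (_ : IsScalarTower k (Alg k P) V), IsStringBasis w b := by
  classical
  let e : P.V → Module.End k V := fun i =>
    b.constr k (fun j => if w.vtx j = i then bvec b j else 0)
  let a : P.E → Module.End k V := fun α =>
    b.constr k (fun j => if h : ∃ i, w.Arr α j i then bvec b h.choose else 0)
  have he : ∀ i j, e i (bvec b j) = if w.vtx j = i then bvec b j else 0 := by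
    intro i j
    rcases lt_or_ge w.length j with hj | hj
    · simp [bvec_of_lt b hj]
    · have : bvec b j = b ⟨j, Nat.lt_succ_of_le hj⟩ := bvec_of_le b hj
      simp only [e]
      conv_lhs => rw [this, Module.Basis.constr_basis]
  have ha : ∀ {α j i}, w.Arr α j i → a α (bvec b j) = bvec b i := by
    intro α j i h
    have hex : ∃ i, w.Arr α j i := ⟨i, h⟩
    rw [bvec_of_le b h.le.1]
    simp only [a]
    rw [Module.Basis.constr_basis, dif_pos hex, hw.arr_unique hex.choose_spec h]
  have ha0 : ∀ {α j}, (∀ i, ¬ w.Arr α j i) → a α (bvec b j) = 0 := by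
    intro α j h
    rcases lt_or_ge w.length j with hj | hj
    · simp [bvec_of_lt b hj]
    · rw [bvec_of_le b hj]
      simp only [a]
      rw [Module.Basis.constr_basis, dif_neg (by push Not; exact h)]
  have ext : ∀ f g : Module.End k V, (∀ j, f (bvec b j) = g (bvec b j)) → f = g := by
    intro f g h
    apply b.ext
    intro j
    have := h j
    rwa [bvec_val] at this
  obtain ⟨φ, hφe, hφa⟩ := exists_algHom (k := k) (P := P) e a
    (fun i => ext _ _ fun j => by
      rw [Module.End.mul_apply, he]; split_ifs with h <;> simp [he, h])
    (fun i i' hii => ext _ _ fun j => by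
      rw [Module.End.mul_apply, he]
      split_ifs with h
      · rw [he, if_neg (by rw [h]; exact Ne.symm hii)]; rfl
      · simp)
    (ext _ _ fun j => by
      rw [LinearMap.sum_apply]
      simp [he])
    (fun α => ext _ _ fun j => by
      rw [Module.End.mul_apply]
      by_cases h : ∃ i, w.Arr α j i
      · obtain ⟨i, hi⟩ := h
        rw [ha hi, he, if_pos (hw.arr_tgt hi).symm]
      · push Not at h
        rw [ha0 h, map_zero])
    (fun α => ext _ _ fun j => by
      rw [Module.End.mul_apply, he]
      by_cases h : ∃ i, w.Arr α j i
      · obtain ⟨i, hi⟩ := h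
        rw [if_pos (hw.arr_src hi).symm]
      · push Not at h
        split_ifs
        · rfl
        · rw [ha0 h, map_zero])
    (fun β α hr => ext _ _ fun j => by
      rw [Module.End.mul_apply]
      by_cases h : ∃ i, w.Arr α j i
      · obtain ⟨i, hi⟩ := h
        rw [ha hi, ha0 (fun m hm => hw.not_rel hi hm hr)]; rfl
      · push Not at h
        rw [ha0 h, map_zero]; rfl)
  let _ : Module (Alg k P) V := Module.compHom V (φ : Alg k P →+* Module.End k V)
  have hsm : ∀ (c : Alg k P) (z : V), c • z = φ c z := fun _ _ => rfl
  refine ⟨inferInstance, ⟨fun c y z => ?_⟩, ⟨fun j i => ?_, fun hα => ?_, fun hα => ?_⟩⟩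
  · rw [hsm, hsm, map_smul]; rfl
  · rw [hsm, hφe, he]
  · rw [hsm, hφa, ha hα]
  · rw [hsm, hφa, ha0 hα]

theorem exists_isStringModule (k : Type u) [Field k] {w : P.Word} (hw : w.IsString) :
    ∃ X : ModuleCat.{max u v} (Alg k P), IsStringModule k w X := by
  obtain ⟨i1, i2, h⟩ := exists_module_of_basis (V := ULift.{v} (Fin (w.length + 1) → k)) hw
    ((Pi.basisFun k (Fin (w.length + 1))).map ULift.moduleEquiv.symm)
  exact ⟨_, isStringModule_of_basis h⟩

end StringBasis

end BoundQuiver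

namespace BoundQuiver

/-! ### Subwords, submodules and quotients of string modules -/

section Slices

variable {k : Type u} [Field k] {P : BoundQuiver.{v}}
variable {X : Type*} [AddCommGroup X] [Module k X] [Module (Alg k P) X]
  [IsScalarTower k (Alg k P) X]
variable {Y : Type*} [AddCommGroup Y] [Module k Y] [Module (Alg k P) Y]
  [IsScalarTower k (Alg k P) Y]
variable {Z : Type*} [AddCommGroup Z] [Module k Z] [Module (Alg k P) Z]
  [IsScalarTower k (Alg k P) Z]

open Classical in
/-- The `k`-linear projection from the string module of `w` to that of the subword on `[a, b]`, killing
the basis vectors outside of `[a, b]`. -/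
noncomputable def sliceProj {w : P.Word} {a b : ℕ} (x : Module.Basis (Fin (w.length + 1)) k X)
    (y : Module.Basis (Fin ((w.slice a b).length + 1)) k Y) : X →ₗ[k] Y :=
  x.constr k (fun j => if a ≤ j.1 ∧ j.1 ≤ b then bvec y (j.1 - a) else 0)

open Classical in
theorem sliceProj_bvec {w : P.Word} {a b : ℕ} (hb : b ≤ w.length)
    (x : Module.Basis (Fin (w.length + 1)) k X)
    (y : Module.Basis (Fin ((w.slice a b).length + 1)) k Y) (j : ℕ) :
    sliceProj x y (bvec x j) = if a ≤ j ∧ j ≤ b then bvec y (j - a) else 0 := by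
  rcases lt_or_ge w.length j with hj | hj
  · rw [bvec_of_lt x hj, map_zero, if_neg (by omega)]
  · rw [bvec_of_le x hj, sliceProj, Module.Basis.constr_basis]

/-- The `k`-linear inclusion of the string module of the subword on `[a, b]`. -/
noncomputable def sliceIncl {w : P.Word} {a b : ℕ} (x : Module.Basis (Fin (w.length + 1)) k X)
    (y : Module.Basis (Fin ((w.slice a b).length + 1)) k Y) : Y →ₗ[k] X :=
  y.constr k (fun j => bvec x (a + j.1))

theorem sliceIncl_bvec {w : P.Word} {a b : ℕ} (hb : b ≤ w.length)
    (x : Module.Basis (Fin (w.length + 1)) k X)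
    (y : Module.Basis (Fin ((w.slice a b).length + 1)) k Y) {j : ℕ} (hj : j ≤ b - a) :
    sliceIncl x y (bvec y j) = bvec x (a + j) := by
  rw [bvec_of_le y (by rwa [Word.slice_length hb]), sliceIncl, Module.Basis.constr_basis]

theorem sliceProj_sliceIncl {w : P.Word} {a b : ℕ} (hab : a ≤ b) (hb : b ≤ w.length)
    (x : Module.Basis (Fin (w.length + 1)) k X)
    (y : Module.Basis (Fin ((w.slice a b).length + 1)) k Y) (z : Y) :
    sliceProj x y (sliceIncl x y z) = z := by
  have : sliceProj x y ∘ₗ sliceIncl x y = LinearMap.id := by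
    apply y.ext
    intro j
    have hj : j.1 ≤ b - a := by
      have h1 := j.2
      have h2 := Word.slice_length (w := w) (a := a) hb
      omega
    rw [← bvec_val y j, LinearMap.comp_apply, sliceIncl_bvec hb x y hj, sliceProj_bvec hb,
      if_pos (by omega), LinearMap.id_apply, Nat.add_sub_cancel_left]
  exact LinearMap.congr_fun this z

namespace IsStringBasis

variable {w : P.Word} {x : Module.Basis (Fin (w.length + 1)) k X}
variable {a b : ℕ} {y : Module.Basis (Fin ((w.slice a b).length + 1)) k Y}

theorem sliceProj_idemp (hx : IsStringBasis w x) (hy : IsStringBasis (w.slice a b) y)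
    (hb : b ≤ w.length) (i : P.V) (z : X) :
    sliceProj x y (idemp k P i • z) = idemp k P i • sliceProj x y z := by
  refine commutes (x := x) _ _ (fun j _ => ?_) z
  rw [hx.idemp_smul, sliceProj_bvec hb]
  by_cases h : a ≤ j ∧ j ≤ b
  · rw [if_pos h, hy.idemp_smul, Word.slice_vtx (by omega) hb, Nat.add_sub_cancel' h.1]
    split_ifs
    · rw [sliceProj_bvec hb, if_pos h]
    · rw [map_zero]
  · rw [if_neg h, smul_zero]
    split_ifs
    · rw [sliceProj_bvec hb, if_neg h]
    · rw [map_zero]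

theorem sliceProj_arrow (hx : IsStringBasis w x) (hy : IsStringBasis (w.slice a b) y)
    (hw : w.IsString) (hb : b ≤ w.length) {α : P.E} {j : ℕ}
    (h : ∀ i, w.Arr α j i → a ≤ i → i ≤ b → a ≤ j ∧ j ≤ b) :
    sliceProj x y (arrow k P α • bvec x j) = arrow k P α • sliceProj x y (bvec x j) := by
  rw [sliceProj_bvec hb]
  by_cases hα : ∃ i, w.Arr α j i
  · obtain ⟨i, hi⟩ := hα
    rw [hx.arrow_smul hi, sliceProj_bvec hb]
    by_cases hj : a ≤ j ∧ j ≤ b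
    · rw [if_pos hj]
      split_ifs with hi'
      · rw [hy.arrow_smul]
        rw [Word.slice_arr (by omega) (by omega), Nat.add_sub_cancel' hj.1,
          Nat.add_sub_cancel' hi'.1]
        exact hi
      · rw [hy.arrow_smul_zero]
        intro i' hi''
        have hle := hi''.le
        rw [Word.slice_length hb] at hle
        rw [Word.slice_arr hle.1 hle.2, Nat.add_sub_cancel' hj.1] at hi''
        have := hw.arr_unique hi hi''
        omega
    · rw [if_neg hj, if_neg (fun hi' => hj (h i hi hi'.1 hi'.2)), smul_zero]
  · push Not at hα
    rw [hx.arrow_smul_zero hα, map_zero]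
    split_ifs with hj
    · rw [hy.arrow_smul_zero]
      intro i' hi''
      have hle := hi''.le
      rw [Word.slice_length hb] at hle
      rw [Word.slice_arr hle.1 hle.2, Nat.add_sub_cancel' hj.1] at hi''
      exact hα _ hi''
    · rw [smul_zero]

theorem sliceIncl_idemp (hx : IsStringBasis w x) (hy : IsStringBasis (w.slice a b) y)
    (hb : b ≤ w.length) (i : P.V) (z : Y) :
    sliceIncl x y (idemp k P i • z) = idemp k P i • sliceIncl x y z := by
  refine commutes (x := y) _ _ (fun j hj => ?_) z
  rw [Word.slice_length hb] at hj
  rw [hy.idemp_smul, sliceIncl_bvec hb x y hj, hx.idemp_smul, Word.slice_vtx hj hb]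
  split_ifs
  · rw [sliceIncl_bvec hb x y hj]
  · rw [map_zero]

/-- If no arrow of the diagram leaves the interval `[a, b]`, then the string module of the subword is
a submodule. -/
theorem exists_sliceIncl (hx : IsStringBasis w x) (hy : IsStringBasis (w.slice a b) y)
    (hab : a ≤ b) (hb : b ≤ w.length)
    (h : ∀ α j i, w.Arr α j i → a ≤ j → j ≤ b → a ≤ i ∧ i ≤ b) :
    ∃ s : Y →ₗ[Alg k P] X, ∀ z, s z = sliceIncl x y z := by
  refine ⟨homOfGenerators (sliceIncl x y) (sliceIncl_idemp hx hy hb)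
    (fun α => commutes (x := y) _ _ fun j hj => ?_), fun _ => rfl⟩
  rw [Word.slice_length hb] at hj
  by_cases hα : ∃ i, (w.slice a b).Arr α j i
  · obtain ⟨i, hi⟩ := hα
    have hi' := hi.le.2
    rw [Word.slice_length hb] at hi'
    rw [hy.arrow_smul hi, sliceIncl_bvec hb x y hj, sliceIncl_bvec hb x y hi', hx.arrow_smul]
    rwa [Word.slice_arr hj hi'] at hi
  · push Not at hα
    rw [hy.arrow_smul_zero hα, map_zero, sliceIncl_bvec hb x y hj]
    rw [hx.arrow_smul_zero]
    intro i hi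
    have h1 := h α _ _ hi (by omega) (by omega)
    refine hα (i - a) ?_
    rw [Word.slice_arr hj (by omega), Nat.add_sub_cancel' h1.1]
    exact hi

/-- If no arrow of the diagram enters the interval `[a, b]`, then the string module of the subword is
a quotient. -/
theorem exists_sliceProj (hx : IsStringBasis w x) (hy : IsStringBasis (w.slice a b) y)
    (hw : w.IsString) (hb : b ≤ w.length)
    (h : ∀ α j i, w.Arr α j i → a ≤ i → i ≤ b → a ≤ j ∧ j ≤ b) :
    ∃ p : X →ₗ[Alg k P] Y, ∀ z, p z = sliceProj x y z :=
  ⟨homOfGenerators (sliceProj x y) (sliceProj_idemp hx hy hb)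
    (fun α => commutes (x := x) _ _ fun j _ =>
      sliceProj_arrow hx hy hw hb (fun i => h α j i)), fun _ => rfl⟩

/-- A decomposition of the positions of a string into two intervals, with no arrow from the first to
the second one, gives a short exact sequence of string modules. -/
theorem exists_exact (hx : IsStringBasis w x) (hy : IsStringBasis (w.slice a b) y) {a' b' : ℕ}
    {z : Module.Basis (Fin ((w.slice a' b').length + 1)) k Z}
    (hz : IsStringBasis (w.slice a' b') z) (hw : w.IsString) (hab : a ≤ b) (hb : b ≤ w.length)
    (hab' : a' ≤ b') (hb' : b' ≤ w.length)
    (hcompl : ∀ j ≤ w.length, (a ≤ j ∧ j ≤ b) ↔ ¬ (a' ≤ j ∧ j ≤ b'))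
    (h : ∀ α j i, w.Arr α j i → a ≤ j → j ≤ b → a ≤ i ∧ i ≤ b) :
    ∃ (s : Y →ₗ[Alg k P] X) (p : X →ₗ[Alg k P] Z), Function.Injective s ∧ Function.Surjective p ∧
      Function.Exact s p := by
  obtain ⟨s, hs⟩ := exists_sliceIncl hx hy hab hb h
  obtain ⟨p, hp⟩ := exists_sliceProj hx hz hw hb' (fun α j i hα h1 h2 => by
    by_contra h3
    have h4 := (hcompl j hα.le.1).2 h3
    exact (hcompl i hα.le.2).1 (h α j i hα h4.1 h4.2) ⟨h1, h2⟩)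
  refine ⟨s, p, ?_, ?_, ?_⟩
  · exact Function.LeftInverse.injective (g := sliceProj x y) fun m => by
      rw [hs, sliceProj_sliceIncl hab hb]
  · exact Function.RightInverse.surjective (g := sliceIncl x z) fun m => by
      rw [hp, sliceProj_sliceIncl hab' hb']
  · -- `x_j` is the sum of its components in the two intervals
    have key : sliceIncl x y ∘ₗ sliceProj x y + sliceIncl x z ∘ₗ sliceProj x z = LinearMap.id := by
      apply x.ext
      intro j
      have hj := Nat.le_of_lt_succ j.2
      rw [← bvec_val x j, LinearMap.add_apply, LinearMap.comp_apply, LinearMap.comp_apply,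
        sliceProj_bvec hb, sliceProj_bvec hb', LinearMap.id_apply]
      by_cases h1 : a ≤ j.1 ∧ j.1 ≤ b
      · rw [if_pos h1, if_neg ((hcompl j hj).1 h1), map_zero, add_zero,
          sliceIncl_bvec hb x y (by omega), Nat.add_sub_cancel' h1.1]
      · have h2 : a' ≤ j.1 ∧ j.1 ≤ b' := by
          by_contra h2; exact h1 ((hcompl j hj).2 h2)
        rw [if_neg h1, if_pos h2, map_zero, zero_add,
          sliceIncl_bvec hb' x z (by omega), Nat.add_sub_cancel' h2.1]
    intro m
    constructor
    · intro hm
      refine ⟨sliceProj x y m, ?_⟩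
      have := LinearMap.congr_fun key m
      rw [LinearMap.add_apply, LinearMap.comp_apply, LinearMap.comp_apply, ← hp, hm, map_zero,
        add_zero, ← hs] at this
      exact this
    · rintro ⟨m, rfl⟩
      have : p.restrictScalars k ∘ₗ s.restrictScalars k = 0 := by
        apply y.ext
        intro j
        have hj := (Nat.le_of_lt_succ j.2).trans_eq (Word.slice_length hb)
        rw [← bvec_val y j, LinearMap.comp_apply, LinearMap.restrictScalars_apply,
          LinearMap.restrictScalars_apply, hs, sliceIncl_bvec hb x y hj, hp, sliceProj_bvec hb',
          if_neg ((hcompl _ (by omega)).1 (by omega))]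
        rfl
      exact LinearMap.congr_fun this m

/-! ### Self-avoiding strings: every vertex occurs at most once in the module -/

theorem idemp_smul_eq_repr (hx : IsStringBasis w x) (hsa : w.SelfAvoiding)
    (j : Fin (w.length + 1)) (z : X) : idemp k P (w.vtx j) • z = x.repr z j • x j := by
  have : Algebra.lsmul k k X (idemp k P (w.vtx j)) = (x.coord j).smulRight (x j) := by
    apply x.ext
    intro i
    rw [LinearMap.smulRight_apply, Module.Basis.coord_apply, Module.Basis.repr_self,
      Algebra.lsmul_coe, ← bvec_val x i]
    change idemp k P (w.vtx j) • bvec x i = _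
    rw [hx.idemp_smul, Finsupp.single_apply]
    by_cases h : i = j
    · subst h; simp
    · rw [if_neg h, if_neg, zero_smul]
      intro h'
      exact h (Fin.ext (hsa _ _ (Nat.le_of_lt_succ i.2) (Nat.le_of_lt_succ j.2) h'))
  exact LinearMap.congr_fun this z

theorem mem_of_repr_ne_zero (hx : IsStringBasis w x) (hsa : w.SelfAvoiding)
    (N : Submodule (Alg k P) X) {z : X} (hz : z ∈ N) {j : Fin (w.length + 1)}
    (h : x.repr z j ≠ 0) : x j ∈ N := by
  have h1 := N.smul_mem (idemp k P (w.vtx j)) hz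
  rw [idemp_smul_eq_repr hx hsa] at h1
  have h2 := (N.restrictScalars k).smul_mem (x.repr z j)⁻¹ h1
  rwa [smul_smul, inv_mul_cancel₀ h, one_smul] at h2

/-- Submodules of the string module of a self-avoiding string are spanned by basis vectors. -/
theorem induction_submodule (hx : IsStringBasis w x) (hsa : w.SelfAvoiding)
    (N : Submodule (Alg k P) X) (f g : X →ₗ[k] Y)
    (h : ∀ j ≤ w.length, bvec x j ∈ N → f (bvec x j) = g (bvec x j)) {z : X} (hz : z ∈ N) :
    f z = g z := by
  rw [← x.sum_repr z, map_sum, map_sum]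
  refine Finset.sum_congr rfl fun j _ => ?_
  rw [map_smul, map_smul]
  by_cases h0 : x.repr z j = 0
  · rw [h0, zero_smul, zero_smul]
  · have := h j (Nat.le_of_lt_succ j.2)
    rw [bvec_val] at this
    rw [this (mem_of_repr_ne_zero hx hsa N hz h0)]

theorem arr_run {χ : ℕ → Prop} (hr : IsRun χ w.length a b) {α : P.E} {j i : ℕ}
    (h : w.Arr α j i) (hχ : χ j ↔ χ i) : (a ≤ i ∧ i ≤ b) ↔ (a ≤ j ∧ j ≤ b) := by
  have hle := h.le
  have hadj : i = j + 1 ∨ j = i + 1 := by rcases h with h | h <;> simp [h.1]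
  have hl := hr.left
  have hr' := hr.right
  have hab := hr.le
  constructor
  · rintro ⟨h1, h2⟩
    have hc := hr.const i h1 h2
    by_contra hn
    rcases lt_or_ge j a with hj | hj
    · have : a - 1 = j := by omega
      exact hl (by omega) (by rw [this, hχ, hc])
    · have : b + 1 = j := by omega
      exact hr' (by omega) (by rw [this, hχ, hc])
  · rintro ⟨h1, h2⟩
    have hc := hr.const j h1 h2
    by_contra hn
    rcases lt_or_ge i a with hj | hj
    · have : a - 1 = i := by omega
      exact hl (by omega) (by rw [this, ← hχ, hc])
    · have : b + 1 = i := by omega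
      exact hr' (by omega) (by rw [this, ← hχ, hc])

/-- For a submodule `N` of a string module, the string modules of the runs inside of `N` are direct
summands of `N`. -/
theorem exists_retract_sub (hx : IsStringBasis w x) (hy : IsStringBasis (w.slice a b) y)
    (hw : w.IsString) (hsa : w.SelfAvoiding) (N : Submodule (Alg k P) X)
    (hr : IsRun (fun j => bvec x j ∈ N) w.length a b) (ha : bvec x a ∈ N) :
    ∃ (s : Y →ₗ[Alg k P] N) (p : N →ₗ[Alg k P] Y), ∀ z, p (s z) = z := by
  have hb := hr.le_length
  have hN : ∀ {α j i}, w.Arr α j i → bvec x j ∈ N → bvec x i ∈ N := fun h hj => by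
    rw [← hx.arrow_smul h]; exact N.smul_mem _ hj
  obtain ⟨s, hs⟩ := exists_sliceIncl hx hy hr.le hb (fun α j i hα h1 h2 => by
    have hj := (hr.const j h1 h2).2 ha
    exact (arr_run hr hα (by simp [hj, hN hα hj])).2 ⟨h1, h2⟩)
  have hsN : ∀ z, s z ∈ N := by
    intro z
    rw [← y.sum_repr z, map_sum]
    refine N.sum_mem fun j _ => ?_
    rw [linearMap_smul, hs, ← bvec_val y j]
    have hj := (Nat.le_of_lt_succ j.2).trans_eq (Word.slice_length hb)
    rw [sliceIncl_bvec hb x y hj]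
    exact (N.restrictScalars k).smul_mem _
      ((hr.const (a + j) (by omega) (by have := hr.le; omega)).2 ha)
  have hα : ∀ α, ∀ z ∈ N,
      sliceProj x y (arrow k P α • z) = arrow k P α • sliceProj x y z := fun α z hz =>
    induction_submodule hx hsa N (sliceProj x y ∘ₗ Algebra.lsmul k k X (arrow k P α))
      (Algebra.lsmul k k Y (arrow k P α) ∘ₗ sliceProj x y) (fun j hj hjN =>
        sliceProj_arrow hx hy hw hb fun i hi h1 h2 =>
          (arr_run hr hi (by simp [hjN, hN hi hjN])).1 ⟨h1, h2⟩) hz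
  let p : N →ₗ[k] Y := (sliceProj x y).comp (N.subtype.restrictScalars k)
  have hp : ∀ z : N, p z = sliceProj x y z.1 := fun z => rfl
  refine ⟨s.codRestrict N hsN, homOfGenerators (k := k) (P := P) (X := N) p
    (fun i z => by rw [hp, hp, N.coe_smul, sliceProj_idemp hx hy hb])
    (fun α z => by rw [hp, hp, N.coe_smul, hα α z.1 z.2]), fun z => ?_⟩
  rw [homOfGenerators_apply, hp, LinearMap.codRestrict_apply, hs, sliceProj_sliceIncl hr.le hb]

/-- For a submodule `N` of a string module `X`, the string modules of the runs outside of `N` are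
direct summands of `X / N`. -/
theorem exists_retract_quot (hx : IsStringBasis w x) (hy : IsStringBasis (w.slice a b) y)
    (hw : w.IsString) (hsa : w.SelfAvoiding) (N : Submodule (Alg k P) X)
    (hr : IsRun (fun j => bvec x j ∈ N) w.length a b) (ha : bvec x a ∉ N) :
    ∃ (s : Y →ₗ[Alg k P] X ⧸ N) (p : (X ⧸ N) →ₗ[Alg k P] Y), ∀ z, p (s z) = z := by
  have hb := hr.le_length
  have hN : ∀ {α j i}, w.Arr α j i → bvec x j ∈ N → bvec x i ∈ N := fun h hj => by
    rw [← hx.arrow_smul h]; exact N.smul_mem _ hj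
  have hout : ∀ j, a ≤ j → j ≤ b → bvec x j ∉ N := fun j h1 h2 h3 =>
    ha ((hr.const j h1 h2).1 h3)
  have hker : ∀ z ∈ N, sliceProj x y z = 0 := fun z hz =>
    induction_submodule hx hsa N (sliceProj x y) 0 (fun j hj hjN => by
      rw [sliceProj_bvec hb, if_neg (fun h => hout j h.1 h.2 hjN)]; rfl) hz
  let p : (X ⧸ N) →ₗ[k] Y := (N.restrictScalars k).liftQ (sliceProj x y) hker
  have hp : ∀ z : X, p (N.mkQ z) = sliceProj x y z := fun z => rfl
  obtain ⟨s, hs⟩ := hy.exists_hom (fun j => N.mkQ (bvec x (a + j)))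
    (fun j hj => by
      rw [Word.slice_length hb] at hj
      rw [Word.slice_vtx hj hb, ← map_smul, hx.idemp_smul, if_pos rfl])
    (fun α j i hα => by
      have hle := hα.le
      rw [Word.slice_length hb] at hle
      rw [← map_smul, hx.arrow_smul ((Word.slice_arr hle.1 hle.2).1 hα)])
    (fun α j hj hα => by
      rw [Word.slice_length hb] at hj
      rw [← map_smul]
      by_cases h : ∃ i, w.Arr α (a + j) i
      · obtain ⟨i, hi⟩ := h
        rw [hx.arrow_smul hi, Submodule.mkQ_apply, Submodule.Quotient.mk_eq_zero]
        by_contra hiN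
        have hab := hr.le
        have hjN := hout (a + j) (by omega) (by omega)
        have hi' := (arr_run hr hi (by simp [hiN, hjN])).2 ⟨by omega, by omega⟩
        refine hα (i - a) ((Word.slice_arr hj (by omega)).2 ?_)
        rwa [Nat.add_sub_cancel' hi'.1]
      · push Not at h
        rw [hx.arrow_smul_zero h, map_zero])
  refine ⟨s, homOfGenerators p (fun i z => ?_) (fun α z => ?_), fun z => ?_⟩
  · obtain ⟨z, rfl⟩ := N.mkQ_surjective z
    rw [← map_smul, hp, hp, sliceProj_idemp hx hy hb]
  · obtain ⟨z, rfl⟩ := N.mkQ_surjective z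
    rw [← map_smul, hp, hp]
    refine commutes (x := x) _ _ (fun j hj => ?_) z
    by_cases hjN : bvec x j ∈ N
    · rw [hker _ hjN, hker _ (N.smul_mem _ hjN), smul_zero]
    · refine sliceProj_arrow hx hy hw hb fun i hi h1 h2 =>
        (arr_run hr hi (by simp [hjN, hout i h1 h2])).1 ⟨h1, h2⟩
  · have : p ∘ₗ s.restrictScalars k = LinearMap.id := by
      apply y.ext
      intro j
      have hj := Nat.le_of_lt_succ j.2
      have h1 := hs j hj
      replace hj := hj.trans_eq (Word.slice_length hb)
      have hab := hr.le
      rw [← bvec_val y j, LinearMap.comp_apply, LinearMap.restrictScalars_apply, h1, hp,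
        sliceProj_bvec hb, if_pos (by omega), Nat.add_sub_cancel_left, LinearMap.id_apply]
    exact LinearMap.congr_fun this z

/-- Each `e_i X` is at most one-dimensional, so endomorphisms are diagonal; as the diagram is connected,
the diagonal entries agree. -/
theorem exists_eq_smul (hx : IsStringBasis w x) (hsa : w.SelfAvoiding) (f : X →ₗ[Alg k P] X) :
    ∃ c : k, ∀ z, f z = c • z := by
  have h1 : ∀ j : Fin (w.length + 1), f (x j) = x.repr (f (x j)) j • x j := by
    intro j
    rw [← idemp_smul_eq_repr hx hsa, ← map_smul, idemp_smul_eq_repr hx hsa]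
    simp
  have h2 : ∀ j, ∃ c : k, j ≤ w.length → f (bvec x j) = c • bvec x j := by
    intro j
    by_cases hj : j ≤ w.length
    · exact ⟨_, fun _ => by rw [bvec_of_le x hj]; exact h1 _⟩
    · exact ⟨0, fun h => absurd h hj⟩
  choose c hc using h2
  have harr : ∀ {α j i}, w.Arr α j i → c j = c i := by
    intro α j i h
    have h3 := hc i h.le.2
    rw [← hx.arrow_smul h, map_smul, hc j h.le.1, smul_algebra_smul_comm, hx.arrow_smul h] at h3
    exact smul_left_injective k (bvec_ne_zero x h.le.2) h3
  have hconst : ∀ j ≤ w.length, c j = c 0 := by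
    intro j
    induction j with
    | zero => intro _; rfl
    | succ j ih =>
      intro hj
      rw [← ih (by omega)]
      obtain ⟨⟨α, _ | _⟩, hl⟩ := Word.exists_letter (w := w) (j := j) (by omega)
      · exact harr (Or.inr ⟨rfl, hl⟩)
      · exact (harr (Or.inl ⟨rfl, hl⟩)).symm
  refine ⟨c 0, fun z => ?_⟩
  have : f.restrictScalars k = c 0 • LinearMap.id := by
    apply x.ext
    intro j
    have hj := Nat.le_of_lt_succ j.2
    rw [LinearMap.restrictScalars_apply, ← bvec_val x j, hc j hj, hconst j hj]
    rfl
  exact LinearMap.congr_fun this z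

theorem bijective_of_ne_zero (hx : IsStringBasis w x) (hsa : w.SelfAvoiding)
    (f : X →ₗ[Alg k P] X) (hf : f ≠ 0) : Function.Bijective f := by
  obtain ⟨c, hc⟩ := exists_eq_smul hx hsa f
  have hc0 : c ≠ 0 := by
    rintro rfl
    exact hf (LinearMap.ext fun z => by rw [hc, zero_smul]; rfl)
  constructor
  · intro z z' h
    rw [hc, hc] at h
    exact smul_right_injective X hc0 h
  · intro z
    exact ⟨c⁻¹ • z, by rw [hc, smul_smul, mul_inv_cancel₀ hc0, one_smul]⟩

end IsStringBasis

/-! ### Rigidity: a self-avoiding string is determined by its module up to inversion -/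

namespace Word

variable {w u : P.Word}

/-- Every vertex and every arrow of `w` occurs in `u`. -/
def Occurs (w u : P.Word) : Prop :=
  (∀ i ≤ w.length, ∃ j ≤ u.length, w.vtx i = u.vtx j) ∧
    ∀ α i i', w.Arr α i i' → ∃ j j', u.Arr α j j'

theorem exists_arr_of_occurs (h : Occurs w u) (hw : w.IsString)
    (hu : u.IsString) (hus : u.SelfAvoiding) {α : P.E} {i i' j : ℕ} (hα : w.Arr α i i')
    (hj : j ≤ u.length) (hij : w.vtx i = u.vtx j) : ∃ j', u.Arr α j j' ∧ w.vtx i' = u.vtx j' := by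
  obtain ⟨m, m', hm⟩ := h.2 α i i' hα
  have : j = m := hus _ _ hj hm.le.1 (by rw [← hij, ← hw.arr_src hα, hu.arr_src hm])
  subst this
  exact ⟨m', hm, by rw [← hw.arr_tgt hα, hu.arr_tgt hm]⟩

theorem exists_arr_of_occurs' (h : Occurs w u) (hw : w.IsString)
    (hu : u.IsString) (hus : u.SelfAvoiding) {α : P.E} {i i' j : ℕ} (hα : w.Arr α i' i)
    (hj : j ≤ u.length) (hij : w.vtx i = u.vtx j) : ∃ j', u.Arr α j' j ∧ w.vtx i' = u.vtx j' := by
  obtain ⟨m', m, hm⟩ := h.2 α i' i hα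
  have : j = m := hus _ _ hj hm.le.2 (by rw [← hij, ← hw.arr_tgt hα, hu.arr_tgt hm])
  subst this
  exact ⟨m', hm, by rw [← hw.arr_src hα, hu.arr_src hm]⟩

theorem letters_eq_of_occurs (h : Occurs w u) (hw : w.IsString)
    (hu : u.IsString) (hws : w.SelfAvoiding) (hus : u.SelfAvoiding) (h0 : w.start = u.start) :
    ∀ i < w.length, w.letters[i]? = u.letters[i]? := by
  have key : ∀ i, (i ≤ w.length → i ≤ u.length ∧ w.vtx i = u.vtx i) ∧
      (i < w.length → w.letters[i]? = u.letters[i]?) := by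
    intro i
    induction i using Nat.strong_induction_on with
    | _ i ih =>
      have h1 : i ≤ w.length → i ≤ u.length ∧ w.vtx i = u.vtx i := by
        intro hi
        cases i with
        | zero => exact ⟨Nat.zero_le _, h0⟩
        | succ i =>
          have hl := (ih i (by omega)).2 (by omega)
          obtain ⟨l, hl'⟩ := exists_letter (w := w) (j := i) (by omega)
          rw [hl'] at hl
          have := lt_length hl.symm
          exact ⟨by omega, by rw [vtx_succ hl', vtx_succ hl.symm]⟩
      refine ⟨h1, fun hi => ?_⟩
      obtain ⟨hiu, hv⟩ := h1 hi.le
      obtain ⟨⟨α, ε⟩, hl⟩ := exists_letter hi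
      -- the partner of position `i + 1` is adjacent to `i`, and it is not `i - 1`
      have hne : ∀ j', w.vtx (i + 1) = u.vtx j' → i ≠ j' + 1 := by
        rintro j' h2 rfl
        have h3 := (ih j' (by omega)).1 (by omega)
        have := hws _ _ (by omega) (by omega) (h2.trans h3.2.symm)
        omega
      cases ε with
      | true =>
        obtain ⟨j', h2, h3⟩ := exists_arr_of_occurs h hw hu hus (Or.inl ⟨rfl, hl⟩) hiu hv
        rcases h2 with ⟨h4, h5⟩ | ⟨h4, h5⟩
        · rw [hl, h5]
        · exact absurd h4 (hne _ h3)
      | false =>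
        obtain ⟨j', h2, h3⟩ := exists_arr_of_occurs' h hw hu hus (Or.inr ⟨rfl, hl⟩) hiu hv
        rcases h2 with ⟨h4, h5⟩ | ⟨h4, h5⟩
        · exact absurd h4 (hne _ h3)
        · rw [hl, h5]
  exact fun i => (key i).2

theorem eq_of_occurs_of_start (h : Occurs w u) (h' : Occurs u w) (hw : w.IsString)
    (hu : u.IsString) (hws : w.SelfAvoiding) (hus : u.SelfAvoiding) (h0 : w.start = u.start) :
    w = u := by
  have h1 := letters_eq_of_occurs h hw hu hws hus h0
  have h2 := letters_eq_of_occurs h' hu hw hus hws h0.symm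
  ext1
  · exact h0
  · apply List.ext_getElem?
    intro i
    by_cases hi : i < w.length
    · exact h1 i hi
    by_cases hi' : i < u.length
    · exact (h2 i hi').symm
    rw [List.getElem?_eq_none (by simpa [length] using hi),
      List.getElem?_eq_none (by simpa [length] using hi')]

theorem Occurs.inv_right (h : Occurs w u) (hu : u.IsString) : Occurs w u.inv := by
  refine ⟨fun i hi => ?_, fun α i i' hα => ?_⟩
  · obtain ⟨j, hj, h1⟩ := h.1 i hi
    exact ⟨u.length - j, by rw [inv_length]; omega, by
      rw [h1, hu.inv_vtx (i := j) (by omega)]⟩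
  · obtain ⟨j, j', h1⟩ := h.2 α i i' hα
    have := h1.le
    exact ⟨u.length - j, u.length - j', (inv_arr (by omega) (by omega)).2 h1⟩

theorem Occurs.inv_left (h : Occurs w u) (hw : w.IsString) : Occurs w.inv u := by
  refine ⟨fun i hi => ?_, fun α i i' hα => ?_⟩
  · rw [inv_length] at hi
    rw [hw.inv_vtx (i := w.length - i) (by omega)]
    exact h.1 _ (by omega)
  · have := hα.le
    rw [inv_length] at this
    exact h.2 α (w.length - i) (w.length - i') ((inv_arr (by omega) (by omega)).1 hα)

theorem eq_or_eq_inv_of_occurs (h : Occurs w u) (h' : Occurs u w) (hw : w.IsString)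
    (hu : u.IsString) (hws : w.SelfAvoiding) (hus : u.SelfAvoiding) : w = u ∨ w = u.inv := by
  obtain ⟨j, hj, hv⟩ := h.1 0 (Nat.zero_le _)
  have hend : j = 0 ∨ j = u.length := by
    by_contra hn
    -- both neighbours of position `j` in `u` would be partners of position `1` of `w`
    have key : ∀ α m m', (u.Arr α m m' ∨ u.Arr α m' m) → m = j → u.vtx m' = w.vtx 1 := by
      rintro α m m' hm rfl
      rcases hm with hm | hm
      · obtain ⟨i, h1, h2⟩ := exists_arr_of_occurs h' hu hw hws hm (Nat.zero_le _) hv.symm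
        have : i = 1 := by rcases h1 with h1 | h1 <;> omega
        rw [h2, this]
      · obtain ⟨i, h1, h2⟩ := exists_arr_of_occurs' h' hu hw hws hm (Nat.zero_le _) hv.symm
        have : i = 1 := by rcases h1 with h1 | h1 <;> omega
        rw [h2, this]
    have key2 : ∀ c < u.length, ∃ α, u.Arr α c (c + 1) ∨ u.Arr α (c + 1) c := by
      intro c hc
      obtain ⟨⟨α, _ | _⟩, hl⟩ := exists_letter hc
      · exact ⟨α, Or.inr (Or.inr ⟨rfl, hl⟩)⟩
      · exact ⟨α, Or.inl (Or.inl ⟨rfl, hl⟩)⟩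
    obtain ⟨α, h1⟩ := key2 j (by omega)
    obtain ⟨β, h2⟩ := key2 (j - 1) (by omega)
    rw [Nat.sub_add_cancel (by omega)] at h2
    have := hus _ _ (by omega) (by omega)
      ((key α _ _ h1 rfl).trans (key β _ _ h2.symm rfl).symm)
    omega
  rcases hend with rfl | rfl
  · exact Or.inl (eq_of_occurs_of_start h h' hw hu hws hus hv)
  · right
    refine eq_of_occurs_of_start (h.inv_right hu) (h'.inv_left hu) hw hu.inv hws
      (hu.selfAvoiding_inv hus) ?_
    exact hv.trans (finish_eq u).symm

end Word

theorem IsStringBasis.occurs {w u : P.Word} {x : Module.Basis (Fin (w.length + 1)) k X}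
    {y : Module.Basis (Fin (u.length + 1)) k X} (hx : IsStringBasis w x) (hy : IsStringBasis u y) :
    w.Occurs u := by
  have key : ∀ a : Alg k P, (∀ j, a • bvec y j = 0) → ∀ z : X, a • z = 0 := by
    intro a h z
    have : Algebra.lsmul k k X a = 0 := y.ext fun j => by
      have := h j
      rw [bvec_val] at this
      simpa using this
    exact LinearMap.congr_fun this z
  constructor
  · intro i hi
    by_contra! hn
    refine bvec_ne_zero x hi ?_
    have := key (idemp k P (w.vtx i)) (fun j => ?_) (bvec x i)
    · rwa [hx.idemp_smul, if_pos rfl] at this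
    · rcases lt_or_ge u.length j with hj | hj
      · rw [bvec_of_lt y hj, smul_zero]
      · rw [hy.idemp_smul, if_neg (hn j hj).symm]
  · intro α i i' hα
    by_contra! hn
    refine bvec_ne_zero x hα.le.2 ?_
    rw [← hx.arrow_smul hα]
    exact key _ (fun j => hy.arrow_smul_zero (hn j)) _

end Slices
end BoundQuiver

/-! ### Direct summands and finite direct sums -/

section Retracts

variable {Λ : Type w} [Ring Λ]

/-- `Y` is (isomorphic to) a direct summand of `X`. -/
def IsSummand (Λ : Type*) [Ring Λ] (Y X : Type*) [AddCommGroup Y] [Module Λ Y] [AddCommGroup X]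
    [Module Λ X] : Prop :=
  ∃ (s : Y →ₗ[Λ] X) (p : X →ₗ[Λ] Y), ∀ y, p (s y) = y

section Unbundled

variable {X Y Z : Type*} [AddCommGroup X] [Module Λ X] [AddCommGroup Y] [Module Λ Y]
  [AddCommGroup Z] [Module Λ Z]

theorem IsSummand.of_equiv (e : X ≃ₗ[Λ] Y) : IsSummand Λ X Y :=
  ⟨e.toLinearMap, e.symm.toLinearMap, fun y => e.symm_apply_apply y⟩

theorem IsSummand.trans (h1 : IsSummand Λ X Y) (h2 : IsSummand Λ Y Z) : IsSummand Λ X Z := by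
  obtain ⟨s, p, h⟩ := h1
  obtain ⟨s', p', h'⟩ := h2
  exact ⟨s' ∘ₗ s, p ∘ₗ p', fun x => by simp [h, h']⟩

theorem isSummand_single {n : ℕ} {Y : Fin n → Type*} [∀ i, AddCommGroup (Y i)]
    [∀ i, Module Λ (Y i)] (i : Fin n) : IsSummand Λ (Y i) (∀ i, Y i) :=
  ⟨LinearMap.single Λ Y i, LinearMap.proj i, fun y => by simp⟩

/-- A module with a direct summand `Y` is the direct sum of `Y` and of the kernel of the projection. -/
def prodKerEquiv (s : Y →ₗ[Λ] X) (p : X →ₗ[Λ] Y) (h : ∀ y, p (s y) = y) :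
    X ≃ₗ[Λ] Y × LinearMap.ker p where
  toFun x := (p x, ⟨x - s (p x), by simp [h]⟩)
  map_add' x y := by
    ext
    · simp
    · simp; abel
  map_smul' c x := by
    ext
    · simp
    · simp [smul_sub]
  invFun z := s z.1 + z.2
  left_inv x := by simp
  right_inv z := by
    have hz : p z.2 = 0 := z.2.2
    ext <;> simp [h, hz]

theorem bijective_of_isSummand (hX : ∀ f : X →ₗ[Λ] X, f ≠ 0 → Function.Bijective f) [Nontrivial Y]
    (h : IsSummand Λ Y X) : Nonempty (Y ≃ₗ[Λ] X) := by
  obtain ⟨s, p, h⟩ := h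
  obtain ⟨y, hy⟩ := exists_ne (0 : Y)
  have hb := hX (s ∘ₗ p) (fun h0 => hy (by
    have := congrArg p (LinearMap.congr_fun h0 (s y))
    simpa [h] using this))
  refine ⟨LinearEquiv.ofBijective s ⟨Function.LeftInverse.injective h, fun x => ?_⟩⟩
  obtain ⟨z, rfl⟩ := hb.2 x
  exact ⟨p z, rfl⟩

/-- If the identity of `X ≠ 0` is a sum of maps that factor through modules `Y i` all of whose nonzero
endomorphisms are bijective, then some `Y i` is a direct summand of `X`. -/
theorem exists_isSummand_of_sum_eq_one {ι : Type*} {Y : ι → Type*} [∀ i, AddCommGroup (Y i)]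
    [∀ i, Module Λ (Y i)] (hY : ∀ i, ∀ f : Y i →ₗ[Λ] Y i, f ≠ 0 → Function.Bijective f)
    [Nontrivial X] (t : Finset ι) :
    ∀ (s : ∀ i, X →ₗ[Λ] Y i) (r : ∀ i, Y i →ₗ[Λ] X),
      (∑ i ∈ t, r i ∘ₗ s i = LinearMap.id) → ∃ i ∈ t, Nontrivial (Y i) ∧ IsSummand Λ (Y i) X := by
  classical
  induction t using Finset.induction_on with
  | empty =>
    intro s r h
    obtain ⟨x, hx⟩ := exists_ne (0 : X)
    exact absurd (LinearMap.congr_fun h x).symm hx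
  | insert a t ha ih =>
    intro s r h
    by_cases h0 : s a ∘ₗ r a = 0
    · -- `r a ∘ s a` squares to zero, so the remaining summands still add up to a unit
      rw [Finset.sum_insert ha] at h
      obtain ⟨i, hi, h1⟩ := ih (fun i => s i ∘ₗ (LinearMap.id + r a ∘ₗ s a)) r (by
        have h2 : ∑ i ∈ t, r i ∘ₗ s i = LinearMap.id - r a ∘ₗ s a := by rw [← h]; abel
        have h3 : ∑ i ∈ t, r i ∘ₗ (s i ∘ₗ (LinearMap.id + r a ∘ₗ s a)) =
            (∑ i ∈ t, r i ∘ₗ s i) ∘ₗ (LinearMap.id + r a ∘ₗ s a) := by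
          ext x
          simp only [LinearMap.sum_apply, LinearMap.comp_apply]
        rw [h3, h2]
        ext x
        have := LinearMap.congr_fun h0 (s a x)
        simp only [LinearMap.comp_apply, LinearMap.zero_apply] at this
        simp [this])
      exact ⟨i, Finset.mem_insert_of_mem hi, h1⟩
    · refine ⟨a, Finset.mem_insert_self _ _, ?_, ?_⟩
      · by_contra hn
        rw [not_nontrivial_iff_subsingleton] at hn
        exact h0 (Subsingleton.elim _ _)
      let e := LinearEquiv.ofBijective _ (hY a _ h0)
      exact ⟨r a, e.symm.toLinearMap ∘ₗ s a, fun y => by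
        have : e y = s a (r a y) := rfl
        simp [← this]⟩

end Unbundled

theorem addClosure_iff {P : ObjectProperty (ModuleCat.{w} Λ)} {X : ModuleCat.{w} Λ} :
    addClosure P X ↔ ∃ (n : ℕ) (Y : Fin n → ModuleCat.{w} Λ), (∀ i, P (Y i)) ∧
      IsSummand Λ X (∀ i, Y i) := by
  constructor
  · rintro ⟨n, Y, hY, ⟨r⟩⟩
    refine ⟨n, Y, hY, r.i.hom, r.r.hom, fun y => ?_⟩
    have := r.retract
    exact LinearMap.congr_fun (congrArg ModuleCat.Hom.hom this) y
  · rintro ⟨n, Y, hY, s, p, h⟩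
    refine ⟨n, Y, hY, ⟨⟨ModuleCat.ofHom s, ModuleCat.ofHom p, ?_⟩⟩⟩
    ext y
    exact h y

variable {P : ObjectProperty (ModuleCat.{w} Λ)}

theorem addClosure_of_isSummand {X Y : ModuleCat.{w} Λ} (hX : addClosure P X)
    (h : IsSummand Λ Y X) : addClosure P Y := by
  rw [addClosure_iff] at hX ⊢
  obtain ⟨n, Z, hZ, h'⟩ := hX
  exact ⟨n, Z, hZ, h.trans h'⟩

theorem le_addClosure {X : ModuleCat.{w} Λ} (h : P X) : addClosure P X := by
  rw [addClosure_iff]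
  exact ⟨1, fun _ => X, fun _ => h, isSummand_single (Y := fun _ : Fin 1 => X) 0⟩

theorem addClosure_of_subsingleton {X : ModuleCat.{w} Λ} [Subsingleton X] : addClosure P X := by
  rw [addClosure_iff]
  exact ⟨0, Fin.elim0, fun i => i.elim0, 0, 0, fun _ => Subsingleton.elim _ _⟩

theorem addClosure_mono {P' : ObjectProperty (ModuleCat.{w} Λ)} (h : ∀ X, P X → P' X)
    {X : ModuleCat.{w} Λ} (hX : addClosure P X) : addClosure P' X := by
  obtain ⟨n, Y, hY, r⟩ := hX
  exact ⟨n, Y, fun i => h _ (hY i), r⟩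

theorem addClosure_prod {X Y Z : ModuleCat.{w} Λ} (hX : addClosure P X) (hY : addClosure P Y)
    (h : IsSummand Λ Z (X × Y)) : addClosure P Z := by
  rw [addClosure_iff] at hX hY ⊢
  obtain ⟨n, A, hA, s, p, hs⟩ := hX
  obtain ⟨m, B, hB, s', p', hs'⟩ := hY
  refine ⟨n + m, fun i => Fin.addCases A B i, fun i => ?_, h.trans ?_⟩
  · refine Fin.addCases (fun i => ?_) (fun i => ?_) i
    · simpa using hA i
    · simpa using hB i
  · let C : Fin (n + m) → ModuleCat.{w} Λ := fun i => Fin.addCases A B i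
    have hl : ∀ i, C (Fin.castAdd m i) = A i := fun i => Fin.addCases_left i
    have hr : ∀ i, C (Fin.natAdd n i) = B i := fun i => Fin.addCases_right i
    let el : ∀ i, C (Fin.castAdd m i) ≃ₗ[Λ] A i := fun i => (eqToIso (hl i)).toLinearEquiv
    let er : ∀ i, C (Fin.natAdd n i) ≃ₗ[Λ] B i := fun i => (eqToIso (hr i)).toLinearEquiv
    let F : (∀ i, C i) →ₗ[Λ] (∀ i, A i) × (∀ i, B i) := LinearMap.prod
      (LinearMap.pi fun i => (el i).toLinearMap ∘ₗ LinearMap.proj _)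
      (LinearMap.pi fun i => (er i).toLinearMap ∘ₗ LinearMap.proj _)
    have hF : Function.Bijective F := by
      constructor
      · intro f g hfg
        funext i
        refine Fin.addCases (fun i => ?_) (fun i => ?_) i
        · exact (el i).injective (congrFun (congrArg Prod.fst hfg) i)
        · exact (er i).injective (congrFun (congrArg Prod.snd hfg) i)
      · rintro ⟨f, g⟩
        refine ⟨fun i => Fin.addCases (motive := fun i => C i) (fun i => (el i).symm (f i))
          (fun i => (er i).symm (g i)) i, ?_⟩
        ext i
        · simp [F]
        · simp [F]
    let E := LinearEquiv.ofBijective F hF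
    refine IsSummand.trans (Y := (∀ i, A i) × (∀ i, B i))
      ⟨s.prodMap s', p.prodMap p', fun y => by ext <;> simp [hs, hs']⟩
      (IsSummand.of_equiv E.symm)

theorem addClosure_pi {n : ℕ} (Y : Fin n → ModuleCat.{w} Λ) (hY : ∀ i, addClosure P (Y i)) :
    addClosure P (ModuleCat.of Λ (∀ i, Y i)) := by
  induction n with
  | zero => exact addClosure_of_subsingleton
  | succ n ih =>
    refine addClosure_prod (hY 0) (ih (fun i => Y i.succ) (fun i => hY i.succ)) ?_
    exact IsSummand.of_equiv (Fin.consLinearEquiv Λ (fun i => Y i)).symm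

theorem addClosure_addClosure : addClosure (addClosure P) ≤ addClosure P := by
  intro X hX
  rw [addClosure_iff] at hX
  obtain ⟨n, Y, hY, h⟩ := hX
  exact addClosure_of_isSummand (addClosure_pi Y hY) h

/-- A module `X` in `add P` is the direct sum of direct summands that lie in `P`, if the modules in `P`
have finite length and nonzero endomorphisms of them are bijective. -/
theorem addClosure_summands (hP : ∀ Y, P Y → ∀ f : Y →ₗ[Λ] Y, f ≠ 0 → Function.Bijective f)
    (hfin : ∀ Y, P Y → Module.length Λ Y ≠ ⊤) {X : ModuleCat.{w} Λ} (hX : addClosure P X) :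
    addClosure (fun Y => P Y ∧ IsSummand Λ Y X) X := by
  have hlen : Module.length Λ X ≠ ⊤ := by
    obtain ⟨n, Y, hY, s, p, h⟩ := addClosure_iff.1 hX
    refine ne_top_of_le_ne_top ?_ (Module.length_le_of_injective s
      (Function.LeftInverse.injective h))
    rw [Module.length_pi_of_fintype]
    exact WithTop.sum_ne_top.2 fun i _ => hfin _ (hY i)
  obtain ⟨n, hn⟩ := ENat.ne_top_iff_exists.1 hlen
  clear hlen
  induction n using Nat.strong_induction_on generalizing X with
  | _ n ih =>
    rcases subsingleton_or_nontrivial X with hs | hs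
    · exact addClosure_of_subsingleton
    obtain ⟨m, Y, hY, s, p, h⟩ := addClosure_iff.1 hX
    obtain ⟨i, -, hYn, s', p', h'⟩ := exists_isSummand_of_sum_eq_one (X := X) (fun i => hP (Y i) (hY i))
      Finset.univ (fun i => LinearMap.proj i ∘ₗ s) (fun i => p ∘ₗ LinearMap.single Λ (fun i => Y i) i) (by
        ext x
        rw [LinearMap.sum_apply]
        simp only [LinearMap.comp_apply, LinearMap.proj_apply, LinearMap.coe_single,
          LinearMap.id_apply]
        rw [← map_sum]
        have := Finset.univ_sum_single (s x)
        rw [this, h])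
    let e := prodKerEquiv s' p' h'
    let K := ModuleCat.of Λ (LinearMap.ker p')
    have hK : IsSummand Λ K X :=
      IsSummand.trans (Y := (Y i) × K)
        ⟨LinearMap.inr Λ _ _, LinearMap.snd Λ _ _, fun y => rfl⟩ (IsSummand.of_equiv e.symm)
    have hle : Module.length Λ X = Module.length Λ (Y i) + Module.length Λ K := by
      rw [e.length_eq, Module.length_prod]
    have hKn : Module.length Λ K ≠ ⊤ := by
      intro hK'
      rw [hK', add_top] at hle
      rw [hle] at hn
      exact ENat.natCast_ne_top n hn
    obtain ⟨m', hm'⟩ := ENat.ne_top_iff_exists.1 hKn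
    have hlt : m' < n := by
      have h1 : 0 < Module.length Λ (Y i) := Module.length_pos
      obtain ⟨l, hl⟩ := ENat.ne_top_iff_exists.1 (hfin _ (hY i))
      rw [← hn, ← hl, ← hm'] at hle
      rw [← hl] at h1
      norm_cast at hle h1
      omega
    have := ih m' hlt (addClosure_of_isSummand hX hK) hm'
    refine addClosure_prod (X := Y i) (Y := K) (le_addClosure ⟨hY i, s', p', h'⟩)
      (addClosure_mono (fun Z hZ => ⟨hZ.1, hZ.2.trans hK⟩) this) (IsSummand.of_equiv e)

/-! ### Indecomposable modules and torsion classes -/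

theorem indecomposable_of_idempotents {X : ModuleCat.{w} Λ} [Nontrivial X]
    (h : ∀ f : X →ₗ[Λ] X, (∀ z, f (f z) = f z) → f = 0 ∨ f = LinearMap.id) :
    Indecomposable X := by
  refine ⟨fun h0 => not_subsingleton X (ModuleCat.subsingleton_of_isZero h0), fun Y Z e => ?_⟩
  let f : X ⟶ X := e.hom ≫ Limits.biprod.fst ≫ Limits.biprod.inl ≫ e.inv
  have hff : f ≫ f = f := by simp [f]
  rcases h f.hom (fun z => LinearMap.congr_fun (congrArg ModuleCat.Hom.hom hff) z) with h0 | h1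
  · left
    have hf : f = 0 := by ext1; exact h0
    have : 𝟙 Y = Limits.biprod.inl ≫ e.inv ≫ f ≫ e.hom ≫ Limits.biprod.fst := by simp [f]
    rw [Limits.IsZero.iff_id_eq_zero, this, hf]
    simp
  · right
    have hf : f = 𝟙 X := by ext1; exact h1
    have h2 : 𝟙 Z = Limits.biprod.inr ≫ e.inv ≫ 𝟙 X ≫ e.hom ≫ Limits.biprod.snd := by simp
    rw [Limits.IsZero.iff_id_eq_zero, h2, ← hf]
    simp [f]

theorem indecomposable_of_bijective {X : ModuleCat.{w} Λ} [Nontrivial X]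
    (hX : ∀ f : X →ₗ[Λ] X, f ≠ 0 → Function.Bijective f) : Indecomposable X := by
  refine indecomposable_of_idempotents fun f hf => ?_
  by_cases h0 : f = 0
  · exact Or.inl h0
  · exact Or.inr (LinearMap.ext fun z => (hX f h0).1 (hf z))

theorem nontrivial_of_indecomposable {X : ModuleCat.{w} Λ} (h : Indecomposable X) :
    Nontrivial X := by
  by_contra hn
  rw [not_nontrivial_iff_subsingleton] at hn
  exact h.1 (ModuleCat.isZero_of_subsingleton X)

theorem nonempty_equiv_of_indecomposable {X Y : ModuleCat.{w} Λ} (hX : Indecomposable X)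
    [Nontrivial Y] (h : IsSummand Λ Y X) : Nonempty (Y ≃ₗ[Λ] X) := by
  obtain ⟨s, p, h⟩ := h
  let e : X ≅ Y ⊞ ModuleCat.of Λ (LinearMap.ker p) :=
    (prodKerEquiv s p h).toModuleIso ≪≫ (ModuleCat.biprodIsoProd Y (ModuleCat.of Λ (LinearMap.ker p))).symm
  rcases hX.2 _ _ e with h0 | h0
  · exact absurd (ModuleCat.subsingleton_of_isZero h0) (not_subsingleton Y)
  · have := ModuleCat.subsingleton_of_isZero h0
    refine ⟨LinearEquiv.ofBijective s ⟨Function.LeftInverse.injective h, fun x => ⟨p x, ?_⟩⟩⟩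
    have h1 : (⟨x - s (p x), by simp [h]⟩ : LinearMap.ker p) = 0 := Subsingleton.elim _ _
    have h2 := congrArg Subtype.val h1
    exact (sub_eq_zero.1 h2).symm

namespace IsTorsionClass

variable {T : ObjectProperty (ModuleCat.{w} Λ)}

theorem of_surjective (hT : IsTorsionClass T) {X Y : ModuleCat.{w} Λ} (f : X →ₗ[Λ] Y)
    (hf : Function.Surjective f) (hX : T X) : T Y := by
  have := hT.quotients
  have : Epi (ModuleCat.ofHom f) := (ModuleCat.epi_iff_surjective _).2 hf
  exact T.prop_of_epi (ModuleCat.ofHom f) hX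

theorem of_isSummand (hT : IsTorsionClass T) {X Y : ModuleCat.{w} Λ} (h : IsSummand Λ Y X)
    (hX : T X) : T Y := by
  obtain ⟨s, p, h⟩ := h
  exact hT.of_surjective p (Function.RightInverse.surjective h) hX

theorem of_exact (hT : IsTorsionClass T) {X Y Z : ModuleCat.{w} Λ} (f : X →ₗ[Λ] Y)
    (g : Y →ₗ[Λ] Z) (hf : Function.Injective f) (hg : Function.Surjective g)
    (h : Function.Exact f g) (hX : T X) (hZ : T Z) : T Y := by
  have := hT.extensions
  let S : ShortComplex (ModuleCat.{w} Λ) := ShortComplex.mk (ModuleCat.ofHom f) (ModuleCat.ofHom g)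
    (by ext x; exact (h (f x)).2 ⟨x, rfl⟩)
  have hS : S.ShortExact := ModuleCat.shortComplex_shortExact S h hf hg
  exact T.prop_X₂_of_shortExact hS hX hZ

theorem of_subsingleton (hT : IsTorsionClass T) (X : ModuleCat.{w} Λ) [Subsingleton X] : T X := by
  have := hT.zero
  have := hT.quotients
  exact T.prop_of_isZero (ModuleCat.isZero_of_subsingleton X)

theorem of_prod (hT : IsTorsionClass T) {X Y Z : ModuleCat.{w} Λ} (hX : T X) (hY : T Y)
    (e : IsSummand Λ Z (X × Y)) : T Z := by
  have : T (ModuleCat.of Λ (X × Y)) := hT.of_exact (Y := ModuleCat.of Λ (X × Y))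
    (LinearMap.inl Λ X Y) (LinearMap.snd Λ X Y) LinearMap.inl_injective LinearMap.snd_surjective
    Function.Exact.inl_snd hX hY
  exact hT.of_isSummand e this

theorem addClosure_le (hT : IsTorsionClass T) : addClosure T ≤ T := by
  have key : ∀ (n : ℕ) (Y : Fin n → ModuleCat.{w} Λ), (∀ i, T (Y i)) →
      T (ModuleCat.of Λ (∀ i, Y i)) := by
    intro n
    induction n with
    | zero => intro Y hY; exact hT.of_subsingleton _
    | succ n ih =>
      intro Y hY
      refine hT.of_prod (hY 0) (ih (fun i => Y i.succ) (fun i => hY i.succ)) ?_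
      exact IsSummand.of_equiv (Fin.consLinearEquiv Λ (fun i => Y i)).symm
  intro X hX
  obtain ⟨n, Y, hY, h⟩ := addClosure_iff.1 hX
  exact hT.of_isSummand h (key n Y hY)

end IsTorsionClass

end Retracts

namespace BoundQuiver

/-! ### Strings over a brick algebra are self-avoiding -/

section Endomorphisms

variable {k : Type u} [Field k] {P : BoundQuiver.{v}}
variable {X : Type*} [AddCommGroup X] [Module k X] [Module (Alg k P) X]
  [IsScalarTower k (Alg k P) X]
variable {w : P.Word} {x : Module.Basis (Fin (w.length + 1)) k X}

open Classical in
/-- The coordinate at position `j`, extended by zero to all natural numbers. -/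
noncomputable def cvec {n : ℕ} (x : Module.Basis (Fin (n + 1)) k X) (j : ℕ) : X →ₗ[k] k :=
  if h : j < n + 1 then x.coord ⟨j, h⟩ else 0

open Classical in
theorem cvec_bvec {n : ℕ} (x : Module.Basis (Fin (n + 1)) k X) {i j : ℕ} (hj : j ≤ n) :
    cvec x i (bvec x j) = if i = j then 1 else 0 := by
  rw [bvec_of_le x hj, cvec]
  split_ifs with h1 h2 h2
  · subst h2; simp
  · rw [Module.Basis.coord_apply, Module.Basis.repr_self, Finsupp.single_apply,
      if_neg (fun h => h2 (by simpa using (congrArg Fin.val h).symm))]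
  · omega
  · rfl

theorem sum_cvec {n : ℕ} (x : Module.Basis (Fin (n + 1)) k X) (z : X) :
    ∑ j : Fin (n + 1), cvec x j z • bvec x j = z := by
  conv_rhs => rw [← x.sum_repr z]
  refine Finset.sum_congr rfl fun j _ => ?_
  rw [bvec_val, cvec, dif_pos j.2]
  rfl

namespace IsStringBasis

theorem cvec_idemp (hx : IsStringBasis w x) (v : P.V) (i : ℕ) (z : X) (h : w.vtx i ≠ v) :
    cvec x i (idemp k P v • z) = 0 := by
  have : cvec x i ∘ₗ Algebra.lsmul k k X (idemp k P v) = 0 := by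
    apply x.ext
    intro j
    have hj := Nat.le_of_lt_succ j.2
    rw [← bvec_val x j, LinearMap.comp_apply]
    change cvec x i (idemp k P v • bvec x j) = _
    rw [hx.idemp_smul]
    split_ifs with h1
    · rw [cvec_bvec x hj, if_neg (by rintro rfl; exact h h1)]; rfl
    · rw [map_zero]; rfl
  exact LinearMap.congr_fun this z

theorem cvec_arrow (hx : IsStringBasis w x) (hw : w.IsString) {α : P.E} {i i' : ℕ}
    (h : w.Arr α i i') (z : X) : cvec x i' (arrow k P α • z) = cvec x i z := by
  have : cvec x i' ∘ₗ Algebra.lsmul k k X (arrow k P α) = cvec x i := by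
    apply x.ext
    intro j
    have hj := Nat.le_of_lt_succ j.2
    rw [← bvec_val x j, LinearMap.comp_apply, cvec_bvec x hj]
    change cvec x i' (arrow k P α • bvec x j) = _
    by_cases h1 : ∃ l, w.Arr α j l
    · obtain ⟨l, hl⟩ := h1
      rw [hx.arrow_smul hl, cvec_bvec x hl.le.2]
      by_cases h2 : i' = l
      · subst h2
        rw [if_pos rfl, if_pos (hw.arr_unique' h hl)]
      · rw [if_neg h2, if_neg]
        rintro rfl
        exact h2 (hw.arr_unique h hl)
    · push Not at h1
      rw [hx.arrow_smul_zero h1, map_zero, if_neg]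
      rintro rfl
      exact h1 _ h
  exact LinearMap.congr_fun this z

theorem cvec_arrow_zero (hx : IsStringBasis w x) {α : P.E} {i' : ℕ}
    (h : ∀ i, ¬ w.Arr α i i') (z : X) : cvec x i' (arrow k P α • z) = 0 := by
  have : cvec x i' ∘ₗ Algebra.lsmul k k X (arrow k P α) = 0 := by
    apply x.ext
    intro j
    rw [← bvec_val x j, LinearMap.comp_apply]
    change cvec x i' (arrow k P α • bvec x j) = _
    by_cases h1 : ∃ l, w.Arr α j l
    · obtain ⟨l, hl⟩ := h1
      rw [hx.arrow_smul hl, cvec_bvec x hl.le.2, if_neg]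
      · rfl
      · rintro rfl
        exact h _ hl
    · push Not at h1
      rw [hx.arrow_smul_zero h1, map_zero]; rfl
  exact LinearMap.congr_fun this z

/-- If the off-diagonal matrix entries of every endomorphism of a string module lead from a set `S` of
positions to its complement, then every endomorphism is a scalar plus a map of square zero, and every
idempotent endomorphism is trivial. -/
theorem idempotent_trivial (hx : IsStringBasis w x) (hw : w.IsString) (S : ℕ → Prop)
    (hS : ∀ f : X →ₗ[Alg k P] X, ∀ i j, i ≤ w.length → j ≤ w.length → i ≠ j →
      cvec x i (f (bvec x j)) ≠ 0 → S j ∧ ¬ S i)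
    (f : X →ₗ[Alg k P] X) (hf : ∀ z, f (f z) = f z) : f = 0 ∨ f = LinearMap.id := by
  have hconst : ∀ j ≤ w.length, cvec x j (f (bvec x j)) = cvec x 0 (f (bvec x 0)) := by
    intro j
    induction j with
    | zero => intro _; rfl
    | succ j ih =>
      intro hj
      rw [← ih (by omega)]
      obtain ⟨⟨α, _ | _⟩, hl⟩ := Word.exists_letter (w := w) (j := j) (by omega)
      · have h : w.Arr α (j + 1) j := Or.inr ⟨rfl, hl⟩
        rw [← hx.arrow_smul h, map_smul, hx.cvec_arrow hw h]
      · have h : w.Arr α j (j + 1) := Or.inl ⟨rfl, hl⟩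
        rw [← hx.arrow_smul h, map_smul, hx.cvec_arrow hw h]
  generalize hc : cvec x 0 (f (bvec x 0)) = c at hconst
  let g : X →ₗ[k] X := f.restrictScalars k - c • LinearMap.id
  have hg : ∀ z, g z = f z - c • z := fun z => rfl
  have hgj : ∀ j ≤ w.length, g (bvec x j) = ∑ i : Fin (w.length + 1),
      (open Classical in if i.1 = j then 0 else cvec x i (f (bvec x j))) • bvec x i := by
    intro j hj
    have h1 : f (bvec x j) = ∑ i : Fin (w.length + 1), cvec x i (f (bvec x j)) • bvec x i :=
      (sum_cvec x _).symm
    have h2 : c • bvec x j = ∑ i : Fin (w.length + 1),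
        (open Classical in if i.1 = j then c else 0) • bvec x i := by
      rw [Finset.sum_eq_single ⟨j, Nat.lt_succ_of_le hj⟩]
      · simp
      · intro i _ hi
        rw [if_neg (fun h => hi (Fin.ext h)), zero_smul]
      · simp
    rw [hg, h2]
    nth_rw 1 [h1]
    rw [← Finset.sum_sub_distrib]
    refine Finset.sum_congr rfl fun i _ => ?_
    rw [← sub_smul]
    split_ifs with h
    · subst h
      rw [hconst _ hj, sub_self]
    · rw [sub_zero]
  have hg0 : ∀ j ≤ w.length, ¬ S j → g (bvec x j) = 0 := by
    intro j hj hSj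
    rw [hgj j hj]
    refine Finset.sum_eq_zero fun i _ => ?_
    split_ifs with h
    · rw [zero_smul]
    · by_cases h0 : cvec x i (f (bvec x j)) = 0
      · rw [h0, zero_smul]
      · exact absurd (hS f i j (Nat.le_of_lt_succ i.2) hj h h0).1 hSj
  have hgg : ∀ z, g (g z) = 0 := by
    have : g ∘ₗ g = 0 := by
      apply x.ext
      intro j
      have hj := Nat.le_of_lt_succ j.2
      rw [← bvec_val x j, LinearMap.comp_apply, hgj _ hj, map_sum]
      refine Finset.sum_eq_zero fun i _ => ?_
      rw [map_smul]
      split_ifs with h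
      · rw [zero_smul]
      · by_cases h0 : cvec x i (f (bvec x j)) = 0
        · rw [h0, zero_smul]
        · rw [hg0 i (Nat.le_of_lt_succ i.2) (hS f i j (Nat.le_of_lt_succ i.2) hj h h0).2, smul_zero]
    exact fun z => LinearMap.congr_fun this z
  have hfg : ∀ z, f z = c • z + g z := fun z => by rw [hg]; abel
  -- `f² = f` reads `(c² - c) + (2 c - 1) g = 0`
  have hE : ∀ z, (c * c - c) • z + (2 * c - 1) • g z = 0 := by
    intro z
    have h1 := hf z
    rw [hfg (f z), hfg z, map_add, map_smul, hgg] at h1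
    rw [← sub_eq_zero.2 h1]
    module
  have hE' : ∀ z, (c * c - c) • g z = 0 := by
    intro z
    have := hE (g z)
    rwa [hgg, smul_zero, add_zero] at this
  by_cases h0 : c * c - c = 0
  · have h2 : (2 * c - 1) * (2 * c - 1) = 1 := by linear_combination 4 * h0
    have hgz : ∀ z, g z = 0 := by
      intro z
      have := hE z
      rw [h0, zero_smul, zero_add] at this
      have h3 : ((2 * c - 1) * (2 * c - 1)) • g z = 0 := by rw [mul_smul, this, smul_zero]
      rwa [h2, one_smul] at h3
    have hc' : c * (c - 1) = 0 := by linear_combination h0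
    rcases mul_eq_zero.1 hc' with h | h
    · left; ext z; rw [hfg, hgz, h]; simp
    · right; ext z; rw [hfg, hgz, sub_eq_zero.1 h]; simp
  · exfalso
    have hgz : ∀ z, g z = 0 := fun z => (smul_eq_zero.1 (hE' z)).resolve_left h0
    have := hE (bvec x 0)
    rw [hgz, smul_zero, add_zero] at this
    exact (smul_ne_zero h0 (bvec_ne_zero x (Nat.zero_le _))) this

end IsStringBasis

theorem IsStringBasis.finite {X : Type*} [AddCommGroup X] [Module k X] [Module (Alg k P) X]
    [IsScalarTower k (Alg k P) X] {x : Module.Basis (Fin (w.length + 1)) k X}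
    (_ : IsStringBasis w x) : Module.Finite (Alg k P) X := by
  have : Module.Finite k X := Module.Finite.of_basis x
  exact Module.Finite.of_restrictScalars_finite k _ _

theorem IsStringModule.isFG {w : P.Word} {X : ModuleCat.{max u v} (Alg k P)}
    (h : IsStringModule k w X) : ModuleCat.isFG (Alg k P) X := by
  obtain ⟨_, _, x, hx⟩ := h.exists_basis
  exact hx.finite

theorem IsStringModule.nontrivial {w : P.Word} {X : ModuleCat.{max u v} (Alg k P)}
    (h : IsStringModule k w X) : Nontrivial X := by
  obtain ⟨_, _, x, hx⟩ := h.exists_basis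
  exact ⟨_, _, bvec_ne_zero x (Nat.zero_le _)⟩

/-- Over a brick algebra, no string module with only trivial idempotent endomorphisms has a nonzero
endomorphism that is not injective. -/
theorem not_isBrickAlgebra_of_string (hbrick : IsBrickAlgebra (Alg k P)) {w : P.Word}
    (hw : w.IsString)
    (S : ℕ → Prop)
    (hS : ∀ (X : Type (max u v)) [AddCommGroup X] [Module k X] [Module (Alg k P) X]
      [IsScalarTower k (Alg k P) X] (x : Module.Basis (Fin (w.length + 1)) k X),
      IsStringBasis w x → (∀ f : X →ₗ[Alg k P] X, ∀ i j, i ≤ w.length → j ≤ w.length → i ≠ j →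
      cvec x i (f (bvec x j)) ≠ 0 → S j ∧ ¬ S i) ∧
      ∃ f : X →ₗ[Alg k P] X, f ≠ 0 ∧ ¬ Function.Injective f) : False := by
  obtain ⟨X, hX⟩ := exists_isStringModule k hw
  have := hX.nontrivial
  have hfg := hX.isFG
  obtain ⟨_, _, x, hx⟩ := hX.exists_basis
  obtain ⟨h1, f, hf, hf'⟩ := hS X x hx
  have hb := hbrick X hfg (indecomposable_of_idempotents (hx.idempotent_trivial hw S h1))
  have hu := hb.2 (ModuleCat.ofHom f) (fun h => hf (by
    have := congrArg ModuleCat.Hom.hom h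
    exact this))
  have : IsIso (ModuleCat.ofHom f) := (isUnit_iff_isIso _).1 hu
  exact hf' ((ModuleCat.mono_iff_injective (ModuleCat.ofHom f)).1 inferInstance)

end Endomorphisms

section Cycles

variable {P : BoundQuiver.{v}}

namespace Word

/-- The word `w` followed by one more letter. -/
def snoc (w : P.Word) (l : P.Letter) : P.Word := ⟨w.start, w.letters ++ [l]⟩

theorem snoc_length (w : P.Word) (l : P.Letter) : (w.snoc l).length = w.length + 1 := by
  simp [snoc, length]

theorem snoc_getElem?_of_lt {w : P.Word} {l : P.Letter} {j : ℕ} (h : j < w.length) :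
    (w.snoc l).letters[j]? = w.letters[j]? := List.getElem?_append_left h

theorem snoc_getElem?_length {w : P.Word} {l : P.Letter} :
    (w.snoc l).letters[w.length]? = some l := by
  simp [snoc, length]

theorem snoc_getElem?_eq_some {w : P.Word} {l m : P.Letter} {j : ℕ} :
    (w.snoc l).letters[j]? = some m ↔
      (j < w.length ∧ w.letters[j]? = some m) ∨ (j = w.length ∧ m = l) := by
  constructor
  · intro h
    have hj := lt_length h
    rw [snoc_length] at hj
    rcases Nat.lt_succ_iff_lt_or_eq.1 hj with hj | rfl
    · rw [snoc_getElem?_of_lt hj] at h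
      exact Or.inl ⟨hj, h⟩
    · rw [snoc_getElem?_length] at h
      exact Or.inr ⟨rfl, (Option.some_inj.1 h).symm⟩
  · rintro (⟨hj, h⟩ | ⟨rfl, rfl⟩)
    · rwa [snoc_getElem?_of_lt hj]
    · exact snoc_getElem?_length

theorem snoc_vtx_of_le {w : P.Word} {l : P.Letter} {j : ℕ} (h : j ≤ w.length) :
    (w.snoc l).vtx j = w.vtx j := by
  cases j with
  | zero => rfl
  | succ j =>
    obtain ⟨m, hm⟩ := exists_letter (w := w) (j := j) (by omega)
    rw [vtx_succ hm, vtx_succ (l := m) (by rwa [snoc_getElem?_of_lt (by omega)])]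

theorem snoc_vtx_length {w : P.Word} {l : P.Letter} : (w.snoc l).vtx (w.length + 1) = l.tgt :=
  vtx_succ snoc_getElem?_length

theorem IsString.snoc {w : P.Word} (hw : w.IsString) {l : P.Letter} (hl : l.src = w.vtx w.length)
    (h : ∀ j m, j + 1 = w.length → w.letters[j]? = some m → Step m l) :
    (w.snoc l).IsString := by
  rw [isString_iff]
  constructor
  · intro m hm
    rw [snoc_getElem?_eq_some] at hm
    rcases hm with ⟨_, hm⟩ | ⟨h0, rfl⟩
    · rw [← hw.vtx_eq hm]; rfl
    · rw [hl, ← h0]; rfl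
  · intro j m m' hm hm'
    rw [snoc_getElem?_eq_some] at hm hm'
    rcases hm with ⟨h1, hm⟩ | ⟨h1, rfl⟩ <;> rcases hm' with ⟨h2, hm'⟩ | ⟨h2, rfl⟩
    · exact hw.step hm hm'
    · exact h j m h2 hm
    · omega
    · omega

/-- A string that returns to its starting vertex, with no other coincidence between the vertices
visited. -/
structure IsSimpleCycle (w : P.Word) : Prop where
  isString : w.IsString
  pos : 0 < w.length
  vtx_eq : w.vtx 0 = w.vtx w.length
  eq_of_vtx : ∀ i j, i < j → j ≤ w.length → w.vtx i = w.vtx j → i = 0 ∧ j = w.length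

theorem IsSimpleCycle.inv {w : P.Word} (hw : w.IsSimpleCycle) : w.inv.IsSimpleCycle := by
  have hs := hw.isString
  refine ⟨hs.inv, by rw [inv_length]; exact hw.pos, ?_, fun i j hij hj h => ?_⟩
  · rw [hs.inv_vtx (i := w.length) (by omega), hs.inv_vtx (i := 0) (by rw [inv_length]; omega),
      hw.vtx_eq]
  · rw [inv_length] at hj ⊢
    rw [hs.inv_vtx (i := w.length - i) (by omega), hs.inv_vtx (i := w.length - j) (by omega)] at h
    have := hw.eq_of_vtx _ _ (by omega) (by omega) h.symm
    omega

/-- Rotation of a cyclic word by one letter. -/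
def rotate (w : P.Word) (l : P.Letter) : P.Word := (w.snoc l).slice 1 (w.length + 1)

theorem IsSimpleCycle.rotate {w : P.Word} (hw : w.IsSimpleCycle) {l m : P.Letter}
    (hl : w.letters[0]? = some l) (hm : w.letters[w.length - 1]? = some m) (h : Step m l) :
    (w.rotate l).IsSimpleCycle := by
  have hs := hw.isString
  have hpos := hw.pos
  have hle : w.length + 1 ≤ (w.snoc l).length := (snoc_length w l).ge
  have hlen : (w.rotate l).length = w.length := slice_length hle
  have hsn : (w.snoc l).IsString := hs.snoc (by rw [← hs.vtx_eq hl, hw.vtx_eq])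
    (fun j m' hj hm' => by
      rw [show j = w.length - 1 by omega, hm] at hm'
      cases hm'; exact h)
  have hv : ∀ j < w.length, (w.rotate l).vtx j = w.vtx (j + 1) := by
    intro j hj
    rw [Word.rotate, slice_vtx (by omega) hle, snoc_vtx_of_le (by omega), add_comm]
  have hvn : (w.rotate l).vtx w.length = w.vtx 1 := by
    rw [Word.rotate, slice_vtx (by omega) hle, add_comm, snoc_vtx_length, vtx_succ hl]
  refine ⟨hsn.slice _ _, by omega, ?_, ?_⟩
  · rw [hlen, hvn, hv 0 hpos]
  · rw [hlen]
    intro i j hij hj hijv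
    rw [hv i (by omega)] at hijv
    rcases eq_or_lt_of_le hj with rfl | hj'
    · rw [hvn] at hijv
      refine ⟨?_, rfl⟩
      by_contra h0
      have := hw.eq_of_vtx 1 (i + 1) (by omega) (by omega) hijv.symm
      omega
    · rw [hv j hj'] at hijv
      have := hw.eq_of_vtx _ _ (by omega) (by omega) hijv
      omega

/-- The first and the last letter of a simple cycle of different directions can be composed. -/
theorem IsSimpleCycle.step {w : P.Word} (hw : w.IsSimpleCycle) {l m : P.Letter}
    (hl : w.letters[0]? = some l) (hm : w.letters[w.length - 1]? = some m) (h : l.2 ≠ m.2) :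
    Step m l := by
  have hs := hw.isString
  have hpos := hw.pos
  have htgt : m.tgt = w.vtx w.length := by
    rw [← vtx_succ hm, Nat.sub_add_cancel hpos]
  refine ⟨?_, ?_, ?_, ?_⟩
  · rw [htgt, ← hw.vtx_eq, hs.vtx_eq hl]
  · rintro rfl
    have h1 : w.length ≠ 1 := by
      intro h1
      rw [h1] at hm
      rw [hm] at hl
      exact h (congrArg Prod.snd (Option.some_inj.1 hl).symm)
    have h2 : w.length ≠ 2 := by
      intro h2
      rw [h2] at hm
      exact (hs.step hl hm).2.1 (by simp)
    have h3 : w.vtx 1 = w.vtx (w.length - 1) := by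
      rw [vtx_succ hl, hs.vtx_eq hm, Letter.tgt_inv]
    have := hw.eq_of_vtx 1 (w.length - 1) (by omega) (by omega) h3
    omega
  · rintro ⟨h1, h2, -⟩; exact h (h2.trans h1.symm)
  · rintro ⟨h1, h2, -⟩; exact h (h2.trans h1.symm)

theorem exists_isSimpleCycle {w : P.Word} (hw : w.IsString) (hsa : ¬ w.SelfAvoiding) :
    ∃ u : P.Word, u.IsSimpleCycle := by
  classical
  have hex : ∃ n, ∃ w : P.Word, w.IsString ∧ ¬ w.SelfAvoiding ∧ w.length = n := ⟨_, w, hw, hsa, rfl⟩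
  obtain ⟨u, hu, husa, hlen⟩ := Nat.find_spec hex
  have hmin : ∀ z : P.Word, z.IsString → z.length < u.length → z.SelfAvoiding := by
    intro z hz hlt
    by_contra hn
    exact Nat.find_min hex (hlen ▸ hlt) ⟨z, hz, hn, rfl⟩
  have hpos : 0 < u.length := by
    by_contra h
    exact husa fun i j hi hj _ => by omega
  have hA := hmin (u.slice 0 (u.length - 1)) (hu.slice _ _)
    (by rw [slice_length (by omega)]; omega)
  have hB := hmin (u.slice 1 u.length) (hu.slice _ _) (by rw [slice_length (by omega)]; omega)
  have key : ∀ i j, i < j → j ≤ u.length → u.vtx i = u.vtx j → i = 0 ∧ j = u.length := by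
    intro i j hij hj h
    constructor
    · by_contra h0
      have := hB (i - 1) (j - 1) (by rw [slice_length (by omega)]; omega)
        (by rw [slice_length (by omega)]; omega)
        (by
          rw [slice_vtx (by omega) (by omega), slice_vtx (by omega) (by omega),
            show 1 + (i - 1) = i by omega, show 1 + (j - 1) = j by omega, h])
      omega
    · by_contra h0
      have := hA i j (by rw [slice_length (by omega)]; omega)
        (by rw [slice_length (by omega)]; omega)
        (by
          rw [slice_vtx (by omega) (by omega), slice_vtx (by omega) (by omega),
            Nat.zero_add, Nat.zero_add, h])
      omega
  refine ⟨u, hu, hpos, ?_, key⟩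
  by_contra hne
  refine husa fun i j hi hj h => ?_
  by_contra hij
  rcases lt_or_gt_of_ne hij with h' | h'
  · obtain ⟨rfl, rfl⟩ := key i j h' hj h
    exact hne h
  · obtain ⟨rfl, rfl⟩ := key j i h' hi h.symm
    exact hne h.symm

end Word

variable {k : Type u} [Field k]

theorem cvec_eq_zero_of_vtx {w : P.Word} {X : Type*} [AddCommGroup X] [Module k X]
    [Module (Alg k P) X] [IsScalarTower k (Alg k P) X]
    {x : Module.Basis (Fin (w.length + 1)) k X} (hx : IsStringBasis w x) (f : X →ₗ[Alg k P] X)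
    {i j : ℕ} (h : w.vtx i ≠ w.vtx j) : cvec x i (f (bvec x j)) = 0 := by
  have := hx.idemp_smul j (w.vtx j)
  rw [if_pos rfl] at this
  rw [← this, map_smul, hx.cvec_idemp _ _ _ h]

/-- A simple cycle that starts and ends with direct letters has its base vertex both in the top and in
the socle of its string module. -/
theorem IsSimpleCycle.false_of_direct (hbrick : IsBrickAlgebra (Alg k P)) {w : P.Word}
    (hw : w.IsSimpleCycle) {α β : P.E} (hl : w.letters[0]? = some (α, true))
    (hm : w.letters[w.length - 1]? = some (β, true)) : False := by
  have hs := hw.isString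
  have hpos := hw.pos
  have harr : w.Arr β (w.length - 1) w.length := Or.inl ⟨by omega, hm⟩
  have hinto : ∀ γ j, ¬ w.Arr γ j 0 := by
    rintro γ j (⟨h0, h⟩ | ⟨h0, h⟩)
    · omega
    · rw [hl] at h; simp at h
  have hout : ∀ γ i, ¬ w.Arr γ w.length i := by
    rintro γ i (⟨h0, h⟩ | ⟨h0, h⟩)
    · have := Word.lt_length h; omega
    · rw [show i = w.length - 1 by omega, hm] at h; simp at h
  refine not_isBrickAlgebra_of_string hbrick hs (fun j => j = 0) ?_
  intro X _ _ _ _ x hx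
  constructor
  · intro f i j hi hj hij hne
    have hv : w.vtx i = w.vtx j := by
      by_contra h
      exact hne (cvec_eq_zero_of_vtx hx f h)
    rcases lt_or_gt_of_ne hij with h | h
    · exfalso
      obtain ⟨rfl, rfl⟩ := hw.eq_of_vtx i j h hj hv
      rw [← hx.arrow_smul harr, map_smul, hx.cvec_arrow_zero (hinto β)] at hne
      exact hne rfl
    · obtain ⟨rfl, rfl⟩ := hw.eq_of_vtx j i h hi hv.symm
      exact ⟨rfl, hpos.ne'⟩
  · obtain ⟨f, hf⟩ := hx.exists_hom (fun j => if j = 0 then bvec x w.length else 0)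
      (fun j _ => by
        split_ifs with h
        · rw [h, hw.vtx_eq, hx.idemp_smul, if_pos rfl]
        · rw [smul_zero])
      (fun γ j i h => by
        have hi : i ≠ 0 := by rintro rfl; exact hinto _ _ h
        rw [if_neg hi]
        split_ifs
        · rw [hx.arrow_smul_zero (hout γ)]
        · rw [smul_zero])
      (fun γ j _ _ => by
        split_ifs
        · rw [hx.arrow_smul_zero (hout γ)]
        · rw [smul_zero])
    refine ⟨f, fun h => ?_, fun h => ?_⟩
    · have := hf 0 (Nat.zero_le _)
      rw [h, if_pos rfl] at this
      exact bvec_ne_zero x le_rfl this.symm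
    · have := hf w.length le_rfl
      rw [if_neg hpos.ne'] at this
      exact bvec_ne_zero x le_rfl (h (this.trans (map_zero f).symm))

theorem IsSimpleCycle.false_of_eq (hbrick : IsBrickAlgebra (Alg k P)) {w : P.Word}
    (hw : w.IsSimpleCycle) {l m : P.Letter} (hl : w.letters[0]? = some l)
    (hm : w.letters[w.length - 1]? = some m) (h : l.2 = m.2) : False := by
  obtain ⟨α, ε⟩ := l
  obtain ⟨β, δ⟩ := m
  obtain rfl : ε = δ := h
  have hpos := hw.pos
  cases ε with
  | true => exact IsSimpleCycle.false_of_direct hbrick hw hl hm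
  | false =>
    refine IsSimpleCycle.false_of_direct hbrick hw.inv (α := β) (β := α) ?_ ?_
    · rw [Word.inv_getElem?_eq_some (i := w.length - 1) (by omega)]; exact hm
    · rw [Word.inv_length, Word.inv_getElem?_eq_some (i := 0) (by omega)]; exact hl

/-- Consider a simple cycle with a peak at its base vertex. Rotating it produces two consecutive direct
letters, unless its second letter is inverse. In the latter case, the cycle followed by its first letter
`a` once more has a string module that maps onto `M(a)`, which is also one of its submodules. -/
theorem IsSimpleCycle.false_of_peak (hbrick : IsBrickAlgebra (Alg k P)) {w : P.Word}
    (hw : w.IsSimpleCycle) {a b : P.E} (hl : w.letters[0]? = some (a, true))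
    (hm : w.letters[w.length - 1]? = some (b, false)) : False := by
  have hs := hw.isString
  have hpos := hw.pos
  have hstep := hw.step hl hm (by simp)
  have hn1 : w.length ≠ 1 := by
    intro h; rw [h, hl] at hm; simp at hm
  obtain ⟨⟨c, ε⟩, hc⟩ := Word.exists_letter (w := w) (j := 1) (by omega)
  cases ε with
  | true =>
    have hle : w.length + 1 ≤ (w.snoc (a, true)).length := (Word.snoc_length w _).ge
    have hlen : (w.rotate (a, true)).length = w.length := Word.slice_length hle
    refine IsSimpleCycle.false_of_eq hbrick (hw.rotate hl hm hstep) (l := (c, true))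
      (m := (a, true)) ?_ ?_ rfl
    · rw [Word.rotate, Word.slice_getElem?_of_lt (by omega), Word.snoc_getElem?_of_lt (by omega)]
      exact hc
    · rw [hlen, Word.rotate, Word.slice_getElem?_of_lt (by omega),
        show 1 + (w.length - 1) = w.length by omega, Word.snoc_getElem?_length]
  | false =>
    set z := w.snoc (a, true) with hz
    have hzlen : z.length = w.length + 1 := Word.snoc_length _ _
    have hzs : z.IsString := hs.snoc (by rw [← hs.vtx_eq hl, hw.vtx_eq])
      (fun j m' hj hm' => by
        rw [show j = w.length - 1 by omega, hm] at hm'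
        cases hm'; exact hstep)
    have hz0 : z.letters[0]? = some (a, true) := by rw [hz, Word.snoc_getElem?_of_lt hpos, hl]
    have hz1 : z.letters[1]? = some (c, false) := by
      rw [hz, Word.snoc_getElem?_of_lt (by omega), hc]
    have hzn : z.letters[w.length]? = some (a, true) := Word.snoc_getElem?_length
    have hzm : z.letters[w.length - 1]? = some (b, false) := by
      rw [hz, Word.snoc_getElem?_of_lt (by omega), hm]
    have hv0 : z.vtx 0 = z.vtx w.length := by
      rw [hz, Word.snoc_vtx_of_le (Nat.zero_le _), Word.snoc_vtx_of_le le_rfl, hw.vtx_eq]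
    have hv1 : z.vtx 1 = z.vtx (w.length + 1) := by
      rw [Word.vtx_succ hz0, Word.vtx_succ hzn]
    have hv : ∀ i j, i < j → j ≤ z.length → z.vtx i = z.vtx j →
        (i = 0 ∧ j = w.length) ∨ (i = 1 ∧ j = w.length + 1) := by
      intro i j hij hj h
      rcases Nat.lt_or_ge j (w.length + 1) with hj' | hj'
      · rw [hz, Word.snoc_vtx_of_le (by omega), Word.snoc_vtx_of_le (by omega)] at h
        exact Or.inl (hw.eq_of_vtx i j hij (by omega) h)
      · obtain rfl : j = w.length + 1 := by omega
        right
        rw [← hv1, hz, Word.snoc_vtx_of_le (by omega), Word.snoc_vtx_of_le (by omega)] at h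
        refine ⟨?_, rfl⟩
        by_contra h1
        rcases lt_or_gt_of_ne h1 with h1 | h1
        · have := hw.eq_of_vtx i 1 h1 (by omega) h; omega
        · have := hw.eq_of_vtx 1 i h1 (by omega) h.symm; omega
    have hba : b ≠ a := by
      rintro rfl
      exact hstep.2.1 rfl
    have hca : c ≠ a := by
      rintro rfl
      exact (hzs.step hz0 hz1).2.1 rfl
    -- the arrows at the ends of the diagram
    have hb0 : ∀ i, ¬ z.Arr b 0 i := by
      rintro i (⟨h0, h⟩ | ⟨h0, h⟩)
      · rw [hz0] at h; simp at h; exact hba h.symm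
      · omega
    have hcn : ∀ i, ¬ z.Arr c i (w.length + 1) := by
      rintro i (⟨h0, h⟩ | ⟨h0, h⟩)
      · obtain rfl : i = w.length := by omega
        rw [hzn] at h; simp at h; exact hca h.symm
      · have := Word.lt_length h; omega
    have hout1 : ∀ γ i, ¬ z.Arr γ 1 i := by
      rintro γ i (⟨h0, h⟩ | ⟨h0, h⟩)
      · rw [hz1] at h; simp at h
      · obtain rfl : i = 0 := by omega
        rw [hz0] at h; simp at h
    have hinto : ∀ γ j, ¬ z.Arr γ j w.length := by
      rintro γ j (⟨h0, h⟩ | ⟨h0, h⟩)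
      · obtain rfl : j = w.length - 1 := by omega
        rw [hzm] at h; simp at h
      · rw [hzn] at h; simp at h
    have hout0 : ∀ γ i, z.Arr γ 0 i → γ = a ∧ i = 1 := by
      rintro γ i (⟨h0, h⟩ | ⟨h0, h⟩)
      · rw [hz0] at h; simp at h; exact ⟨h.symm, h0⟩
      · omega
    have hintoe : ∀ γ j, z.Arr γ j (w.length + 1) → γ = a ∧ j = w.length := by
      rintro γ j (⟨h0, h⟩ | ⟨h0, h⟩)
      · obtain rfl : j = w.length := by omega
        rw [hzn] at h; simp at h; exact ⟨h.symm, rfl⟩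
      · have := Word.lt_length h; omega
    have harrb : z.Arr b w.length (w.length - 1) := Or.inr ⟨by omega, hzm⟩
    have harrc : z.Arr c 2 1 := Or.inr ⟨rfl, hz1⟩
    have harra : z.Arr a 0 1 := Or.inl ⟨rfl, hz0⟩
    have harrn : z.Arr a w.length (w.length + 1) := Or.inl ⟨rfl, hzn⟩
    refine not_isBrickAlgebra_of_string hbrick hzs (fun j => w.length ≤ j) ?_
    intro X _ _ _ _ x hx
    constructor
    · intro f i j hi hj hij hne
      have hvij : z.vtx i = z.vtx j := by
        by_contra h
        exact hne (cvec_eq_zero_of_vtx hx f h)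
      rcases lt_or_gt_of_ne hij with h | h
      · rcases hv i j h hj hvij with ⟨rfl, rfl⟩ | ⟨rfl, rfl⟩ <;> constructor <;> omega
      · exfalso
        rcases hv j i h hi hvij.symm with ⟨rfl, rfl⟩ | ⟨rfl, rfl⟩
        · rw [← hx.cvec_arrow hzs harrb, ← map_smul, hx.arrow_smul_zero hb0, map_zero,
            map_zero] at hne
          exact hne rfl
        · rw [← hx.arrow_smul harrc, map_smul, hx.cvec_arrow_zero hcn] at hne
          exact hne rfl
    · obtain ⟨f, hf⟩ := hx.exists_hom
        (fun j => if j = w.length then bvec x 0 else if j = w.length + 1 then bvec x 1 else 0)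
        (fun j _ => by
          split_ifs with h h
          · rw [h, ← hv0, hx.idemp_smul, if_pos rfl]
          · rw [h, ← hv1, hx.idemp_smul, if_pos rfl]
          · rw [smul_zero])
        (fun γ j i h => by
          have hi : i ≠ w.length := by rintro rfl; exact hinto _ _ h
          rw [if_neg hi]
          by_cases hi' : i = w.length + 1
          · subst hi'
            obtain ⟨rfl, rfl⟩ := hintoe _ _ h
            rw [if_pos rfl, if_pos rfl, hx.arrow_smul harra]
          · rw [if_neg hi']
            split_ifs with h1 h1
            · subst h1
              refine hx.arrow_smul_zero fun i' hi'' => ?_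
              obtain ⟨rfl, rfl⟩ := hout0 _ _ hi''
              exact hi' (hzs.arr_unique h harrn)
            · exact hx.arrow_smul_zero (hout1 γ)
            · rw [smul_zero])
        (fun γ j _ h => by
          split_ifs with h1 h1
          · subst h1
            refine hx.arrow_smul_zero fun i' hi'' => ?_
            obtain ⟨rfl, rfl⟩ := hout0 _ _ hi''
            exact h _ harrn
          · exact hx.arrow_smul_zero (hout1 γ)
          · rw [smul_zero])
      refine ⟨f, fun h => ?_, fun h => ?_⟩
      · have := hf w.length (by omega)
        rw [h, if_pos rfl] at this
        exact bvec_ne_zero x (Nat.zero_le _) this.symm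
      · have := hf 0 (Nat.zero_le _)
        rw [if_neg (by omega), if_neg (by omega)] at this
        exact bvec_ne_zero x (Nat.zero_le _) (h (this.trans (map_zero f).symm))

/-- A string with a repeated vertex contains a simple cycle, and simple cycles contradict the brick
property, according to the directions of their first and last letters. -/
theorem selfAvoiding_of_isBrickAlgebra (hbrick : IsBrickAlgebra (Alg k P)) {w : P.Word}
    (hw : w.IsString) : w.SelfAvoiding := by
  by_contra hsa
  obtain ⟨u, hu⟩ := Word.exists_isSimpleCycle hw hsa
  have hpos := hu.pos
  obtain ⟨⟨α, ε⟩, hl⟩ := Word.exists_letter (w := u) (j := 0) hpos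
  obtain ⟨⟨β, δ⟩, hm⟩ := Word.exists_letter (w := u) (j := u.length - 1) (by omega)
  by_cases h : ε = δ
  · exact IsSimpleCycle.false_of_eq hbrick hu hl hm h
  cases ε with
  | true =>
    obtain rfl : δ = false := by simpa using (Ne.symm h)
    exact IsSimpleCycle.false_of_peak hbrick hu hl hm
  | false =>
    obtain rfl : δ = true := by simpa using (Ne.symm h)
    -- rotate the cycle by one letter, so that it ends with an inverse letter
    have hn1 : u.length ≠ 1 := by
      intro h; rw [h, hl] at hm; simp at hm
    have hstep := hu.step hl hm (by simp)
    obtain ⟨⟨c, ε⟩, hc⟩ := Word.exists_letter (w := u) (j := 1) (by omega)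
    have hle : u.length + 1 ≤ (u.snoc (α, false)).length := (Word.snoc_length u _).ge
    have hlen : (u.rotate (α, false)).length = u.length := Word.slice_length hle
    have h0 : (u.rotate (α, false)).letters[0]? = some (c, ε) := by
      rw [Word.rotate, Word.slice_getElem?_of_lt (by omega), Word.snoc_getElem?_of_lt (by omega)]
      exact hc
    have h1 : (u.rotate (α, false)).letters[(u.rotate (α, false)).length - 1]? =
        some (α, false) := by
      rw [hlen, Word.rotate, Word.slice_getElem?_of_lt (by omega),
        show 1 + (u.length - 1) = u.length by omega, Word.snoc_getElem?_length]
    have hrot := hu.rotate hl hm hstep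
    cases ε with
    | true => exact IsSimpleCycle.false_of_peak hbrick hrot h0 h1
    | false => exact IsSimpleCycle.false_of_eq hbrick hrot h0 h1 rfl

end Cycles

end BoundQuiver

namespace BoundQuiver

/-! ### Sides of a vertex of a gentle bound quiver -/

section Sides

variable {k : Type u} [Field k] {Q : BoundQuiver.{v}}

/-- A set of letters starting at the vertex `i` which can follow the same half of a string ending at
`i`: it contains at most one arrow and at most one inverse arrow, and no string passes through `i` from
one of its members to another one. -/
structure IsSide (σ : Q.Letter → Prop) (i : Q.V) : Prop where
  src : ∀ m, σ m → m.src = i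
  unique : ∀ m m', σ m → σ m' → m.2 = m'.2 → m = m'
  not_step : ∀ m m', σ m → σ m' → m ≠ m' → ¬ Step m.inv m'

theorem eq_of_ncard_le_two {E : Type*} [Finite E] {p : E → Prop} (h : {a | p a}.ncard ≤ 2)
    {a b c : E} (ha : p a) (hb : p b) (hc : p c) (hab : b ≠ a) (hac : c ≠ a) : b = c := by
  by_contra hbc
  have h1 : ({a, b, c} : Set E) ⊆ {a | p a} := by
    rintro z (rfl | rfl | rfl) <;> assumption
  have h2 := Set.ncard_le_ncard h1 (Set.toFinite _)
  rw [Set.ncard_eq_three.2 ⟨a, b, c, hab.symm, hac.symm, hbc, rfl⟩] at h2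
  omega

theorem IsGentle.step_unique (hQ : Q.IsGentle k) {l m m' : Q.Letter} (h : Step l m)
    (h' : Step l m') (hd : m.2 = m'.2) : m = m' := by
  obtain ⟨h1, h2, h3, h4⟩ := h
  obtain ⟨h1', h2', h3', h4'⟩ := h'
  rcases l with ⟨α, _ | _⟩ <;> rcases m with ⟨β, _ | _⟩ <;> rcases m' with ⟨β', _ | _⟩ <;>
    simp_all [Letter.src, Letter.tgt, Letter.inv]
  · exact hQ.not_rel_right α ⟨h1.symm, h4⟩ ⟨h1'.symm, h4'⟩
  · exact eq_of_ncard_le_two (hQ.out_le_two (Q.s α)) (a := α) rfl h1 h1' h2 h2'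
  · exact eq_of_ncard_le_two (hQ.in_le_two (Q.t α)) (a := α) rfl h1 h1' h2 h2'
  · exact hQ.not_rel_left α ⟨h1, h3⟩ ⟨h1', h3'⟩

theorem IsGentle.isSide_step (hQ : Q.IsGentle k) (l : Q.Letter) : IsSide (Step l) l.tgt := by
  refine ⟨fun m h => h.1, fun m m' h h' => hQ.step_unique h h', fun m m' h h' hne hs => ?_⟩
  -- otherwise two of the letters `m`, `m'` and `l⁻¹` have the same direction
  have h1 : m.2 ≠ m'.2 := fun hd => hne (hQ.step_unique h h' hd)
  have h2 : l.inv.2 ≠ m'.2 := fun hd => h'.2.1 (hQ.step_unique h.inv hs hd).symm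
  have h3 : l.inv.2 ≠ m.2 := fun hd => h.2.1
    (hQ.step_unique h'.inv (by simpa using hs.inv) hd).symm
  revert h1 h2 h3
  cases l.inv.2 <;> cases m.2 <;> cases m'.2 <;> simp

/-- The letters starting at a vertex of a gentle bound quiver are divided into two sides, such that
strings can pass from each member of the first side to each member of the second one. -/
theorem IsGentle.exists_sides (hQ : Q.IsGentle k) (i : Q.V) :
    ∃ σ τ : Q.Letter → Prop, IsSide σ i ∧ IsSide τ i ∧
      (∀ m, m.src = i → σ m ∨ τ m) ∧ ∀ m m', σ m → τ m' → Step m.inv m' := by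
  by_cases hex : ∃ m : Q.Letter, m.src = i
  · obtain ⟨l, rfl⟩ := hex
    refine ⟨Step l.inv, fun m => m.src = l.src ∧ ¬ Step l.inv m, ?_, ?_, ?_, ?_⟩
    · simpa using hQ.isSide_step l.inv
    · have hu : ∀ m m' : Q.Letter, m.src = l.src ∧ ¬ Step l.inv m →
          m'.src = l.src ∧ ¬ Step l.inv m' → m.2 = m'.2 → m = m' := by
        rintro m m' ⟨h1, h2⟩ ⟨h1', h2'⟩ hd
        unfold Step at h2 h2'
        rcases l with ⟨α, _ | _⟩ <;> rcases m with ⟨β, _ | _⟩ <;> rcases m' with ⟨β', _ | _⟩ <;>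
          simp_all [Letter.src, Letter.tgt, Letter.inv]
        · exact hQ.rel_left α h2 h2'
        · exact hQ.rel_right α h2 h2'
      have hl : l.src = l.src ∧ ¬ Step l.inv l := ⟨rfl, fun h => h.2.1 (by simp)⟩
      refine ⟨fun m h => h.1, hu, fun m m' h h' hne hs => ?_⟩
      by_cases hml : m = l
      · subst hml; exact h'.2 hs
      by_cases hml' : m' = l
      · subst hml'; exact h.2 (by simpa using hs.inv)
      have h1 : m.2 ≠ l.2 := fun hd => hml (hu _ _ h hl hd)
      have h2 : m'.2 ≠ l.2 := fun hd => hml' (hu _ _ h' hl hd)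
      refine hne (hu _ _ h h' ?_)
      revert h1 h2
      cases l.2 <;> cases m.2 <;> cases m'.2 <;> simp
    · intro m hm
      by_cases h : Step l.inv m
      · exact Or.inl h
      · exact Or.inr ⟨hm, h⟩
    · rintro m m' h ⟨h1, h2⟩
      have hne : m' ≠ m := by rintro rfl; exact h2 h
      refine ⟨by rw [h1, Letter.tgt_inv, h.1, Letter.tgt_inv], by simpa using hne, ?_, ?_⟩ <;>
        unfold Step at h h2 <;>
        rcases l with ⟨α, _ | _⟩ <;> rcases m with ⟨β, _ | _⟩ <;> rcases m' with ⟨γ, _ | _⟩ <;>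
        simp_all [Letter.src, Letter.tgt, Letter.inv]
      · exact fun hr => h.2 (hQ.rel_right γ hr h2)
      · exact fun hr => h.2 (hQ.rel_left γ hr h2)
  · push Not at hex
    exact ⟨fun _ => False, fun _ => False, ⟨fun _ h => h.elim, fun _ _ h => h.elim,
      fun _ _ h => h.elim⟩, ⟨fun _ h => h.elim, fun _ _ h => h.elim, fun _ _ h => h.elim⟩,
      fun m hm => absurd hm (hex m), fun _ _ h => h.elim⟩

/-! ### The filtrations given by half-strings -/

variable {X : Type*} [AddCommGroup X] [Module k X] [Module (Alg k Q) X]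
  [IsScalarTower k (Alg k Q) X]

variable (k X) in
/-- The space `e_i X`. -/
noncomputable def vsp (i : Q.V) : Submodule k X := LinearMap.range (Algebra.lsmul k k X (idemp k Q i))

variable (k X) in
/-- The action of an arrow on a module. -/
noncomputable def act (α : Q.E) : X →ₗ[k] X := Algebra.lsmul k k X (arrow k Q α)

theorem mem_vsp {i : Q.V} {y : X} : y ∈ vsp k X i ↔ idemp k Q i • y = y := by
  constructor
  · rintro ⟨z, rfl⟩
    change idemp k Q i • idemp k Q i • z = idemp k Q i • z
    rw [← mul_smul, idemp_mul_self]
  · intro h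
    exact ⟨y, h⟩

theorem idemp_smul_mem_vsp (i : Q.V) (y : X) : idemp k Q i • y ∈ vsp k X i := ⟨y, rfl⟩

theorem arrow_smul_idemp_smul (α : Q.E) (y : X) :
    arrow k Q α • idemp k Q (Q.s α) • y = arrow k Q α • y := by
  rw [← mul_smul, arrow_mul_idemp]

theorem arrow_smul_mem_vsp (α : Q.E) (y : X) : arrow k Q α • y ∈ vsp k X (Q.t α) := by
  rw [mem_vsp, ← mul_smul, idemp_mul_arrow]

/-- The linear relation given by a letter, applied to a subspace: preimages under arrows, images under
inverse arrows. -/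
noncomputable def pull : Q.Letter → Submodule k X → Submodule k X
  | (b, true), W => vsp k X (Q.s b) ⊓ W.comap (act k X b)
  | (a, false), W => W.map (act k X a)

/-- The subspace obtained by applying the linear relation of a half-string to a subspace which depends
on the side at its end. -/
noncomputable def pullList (base : (Q.Letter → Prop) → Q.V → Submodule k X) :
    (Q.Letter → Prop) → Q.V → List Q.Letter → Submodule k X
  | σ, i, [] => base σ i
  | _, _, l :: C => pull l (pullList base (Step l) l.tgt C)

variable (k X) in
/-- The vectors at `i` that are killed by the arrow on the side `σ`. -/
noncomputable def kerSide (σ : Q.Letter → Prop) (i : Q.V) : Submodule k X :=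
  vsp k X i ⊓ ⨅ b, ⨅ (_ : σ (b, true)), LinearMap.ker (act k X b)

variable (k X) in
/-- The image of the inverse arrow on the side `σ`. -/
noncomputable def imSide (σ : Q.Letter → Prop) (_ : Q.V) : Submodule k X :=
  ⨆ a, ⨆ (_ : σ (a, false)), LinearMap.range (act k X a)

theorem map_act_vsp (a : Q.E) :
    (vsp k X (Q.s a)).map (act k X a) = LinearMap.range (act k X a) := by
  apply le_antisymm LinearMap.map_le_range
  rintro _ ⟨z, rfl⟩
  exact ⟨_, idemp_smul_mem_vsp _ z, arrow_smul_idemp_smul a z⟩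

/-- The half-strings `C` on one side of a vertex give a chain of intervals from `pullList imSide` to
`pullList kerSide` that covers the space at this vertex. -/
theorem exists_pullList (hQ : Q.IsGentle k) (N : ℕ) (σ : Q.Letter → Prop) (i : Q.V)
    (hσ : IsSide σ i)
    (hN : ∀ C : List Q.Letter, (∀ m ∈ C.head?, σ m) → C.IsChain Step → C.length ≤ N)
    (p : Submodule k X → Prop) (h0 : ¬ p ⊥) (h1 : p (vsp k X i)) :
    ∃ C : List Q.Letter, (∀ m ∈ C.head?, σ m) ∧ C.IsChain Step ∧
      ¬ p (pullList (imSide k X) σ i C) ∧ p (pullList (kerSide k X) σ i C) := by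
  induction N generalizing σ i p with
  | zero =>
    have hσ0 : ∀ m, ¬ σ m := fun m hm => by
      have := hN [m] (by simpa using hm) (List.isChain_singleton _)
      simp at this
    refine ⟨[], by simp, List.isChain_nil, ?_, ?_⟩
    · simpa [pullList, imSide, hσ0] using h0
    · simpa [pullList, kerSide, hσ0] using h1
  | succ N ih =>
    have step : ∀ l, σ l → ∀ p : Submodule k X → Prop, ¬ p (pull l ⊥) →
        p (pull l (vsp k X l.tgt)) → ∃ C : List Q.Letter, (∀ m ∈ C.head?, σ m) ∧ C.IsChain Step ∧
      ¬ p (pullList (imSide k X) σ i C) ∧ p (pullList (kerSide k X) σ i C) := by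
      intro l hl p h0 h1
      have cons : ∀ C : List Q.Letter, (∀ m ∈ C.head?, Step l m) → C.IsChain Step →
          (∀ m ∈ (l :: C).head?, σ m) ∧ (l :: C).IsChain Step := by
        intro C hC hC'
        refine ⟨by simpa using hl, ?_⟩
        cases C with
        | nil => exact List.isChain_singleton _
        | cons m C => exact List.isChain_cons_cons.2 ⟨hC m rfl, hC'⟩
      obtain ⟨C, hC1, hC2, hC3, hC4⟩ := ih (Step l) l.tgt (hQ.isSide_step l) (fun C hC hC' => by
        have := hN (l :: C) (cons C hC hC').1 (cons C hC hC').2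
        simpa using this) (fun W => p (pull l W)) h0 h1
      exact ⟨l :: C, (cons C hC1 hC2).1, (cons C hC1 hC2).2, hC3, hC4⟩
    by_cases hi : p (imSide k X σ i)
    · by_cases ha : ∃ a, σ (a, false)
      · obtain ⟨a, ha⟩ := ha
        have him : imSide k X σ i = LinearMap.range (act k X a) := by
          apply le_antisymm
          · refine iSup_le fun a' => iSup_le fun ha' => ?_
            have := hσ.unique _ _ ha' ha rfl
            cases this
            exact le_rfl
          · exact le_iSup_of_le a (le_iSup_of_le ha le_rfl)
        refine step (a, false) ha p ?_ ?_
        · simpa [pull] using h0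
        · change p ((vsp k X (Q.s a)).map (act k X a))
          rwa [map_act_vsp, ← him]
      · push Not at ha
        refine absurd hi ?_
        simpa [imSide, ha] using h0
    · by_cases hk : p (kerSide k X σ i)
      · exact ⟨[], by simp, List.isChain_nil, hi, hk⟩
      · by_cases hb : ∃ b, σ (b, true)
        · obtain ⟨b, hb⟩ := hb
          have hs : Q.s b = i := hσ.src _ hb
          have hker : kerSide k X σ i = vsp k X (Q.s b) ⊓ LinearMap.ker (act k X b) := by
            rw [kerSide, hs]
            congr 1
            apply le_antisymm
            · exact iInf_le_of_le b (iInf_le_of_le hb le_rfl)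
            · refine le_iInf fun b' => le_iInf fun hb' => ?_
              have := hσ.unique _ _ hb' hb rfl
              cases this
              exact le_rfl
          refine step (b, true) hb p ?_ ?_
          · change ¬ p (vsp k X (Q.s b) ⊓ Submodule.comap (act k X b) ⊥)
            rwa [Submodule.comap_bot, ← hker]
          · have : pull (b, true) (vsp k X (Q.t b)) = vsp k X i := by
              change vsp k X (Q.s b) ⊓ Submodule.comap (act k X b) (vsp k X (Q.t b)) = _
              rw [hs]
              exact inf_eq_left.2 fun y _ => arrow_smul_mem_vsp b y
            change p (pull (b, true) (vsp k X (Q.t b)))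
            rwa [this]
        · push Not at hb
          refine absurd h1 ?_
          simpa [kerSide, hb] using hk

theorem pullList_imSide_le {σ : Q.Letter → Prop} {i : Q.V}
    (hσ : ∀ m, σ m → m.src = i) {C : List Q.Letter} (hC : ∀ m ∈ C.head?, σ m) :
    pullList (imSide k X) σ i C ≤ vsp k X i := by
  cases C with
  | nil =>
    refine iSup_le fun a => iSup_le fun ha => ?_
    rintro _ ⟨z, rfl⟩
    rw [← hσ _ ha]
    exact arrow_smul_mem_vsp a z
  | cons l C =>
    rw [← hσ l (hC l rfl)]
    rcases l with ⟨a, _ | _⟩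
    · rintro _ ⟨z, -, rfl⟩
      exact arrow_smul_mem_vsp a z
    · exact inf_le_left

/-! ### Vectors and functionals along a string -/

/-- Vectors `y`, `y'` and functionals `ξ`, `ξ'` at the source and at the target of a letter correspond
to each other. -/
def Link : Q.Letter → X → (X →ₗ[k] k) → X → (X →ₗ[k] k) → Prop
  | (b, true), y, ξ, y', ξ' => y' = arrow k Q b • y ∧ ∀ z, ξ' (arrow k Q b • z) = ξ z
  | (a, false), y, ξ, y', ξ' => y = arrow k Q a • y' ∧ ∀ z, ξ (arrow k Q a • z) = ξ' z

/-- The vector `y` is killed by an arrow, respectively the functional `ξ` vanishes on the image of an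
arrow. -/
def Killed : Q.Letter → X → (X →ₗ[k] k) → Prop
  | (b, true), y, _ => arrow k Q b • y = 0
  | (a, false), _, ξ => ∀ z, ξ (arrow k Q a • z) = 0

theorem Link.inv {l : Q.Letter} {y y' : X} {ξ ξ' : X →ₗ[k] k} (h : Link l y ξ y' ξ') :
    Link l.inv y' ξ' y ξ := by
  rcases l with ⟨a, _ | _⟩ <;> exact h

theorem Link.apply_eq {l : Q.Letter} {y y' : X} {ξ ξ' : X →ₗ[k] k} (h : Link l y ξ y' ξ') :
    ξ' y' = ξ y := by
  rcases l with ⟨a, _ | _⟩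
  · rw [h.1, h.2]
  · rw [h.1, h.2]

theorem Link.killed {l m : Q.Letter} {y y' : X} {ξ ξ' : X →ₗ[k] k} (h : Link l y ξ y' ξ')
    (hsrc : m.src = l.src) (hne : m ≠ l) (hs : ¬ Step l.inv m) : Killed m y ξ := by
  unfold Step at hs
  rcases l with ⟨a, _ | _⟩ <;> rcases m with ⟨b, _ | _⟩ <;>
    simp_all [Letter.src, Letter.tgt, Letter.inv]
  · change arrow k Q b • y = 0
    rw [h.1, ← mul_smul, arrow_mul_arrow hs, zero_smul]
  · intro z
    rw [← h.2, ← mul_smul, arrow_mul_arrow hs, zero_smul, map_zero]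

/-- The letter `m` belongs to the diagram of `w` at position `j`. -/
def InDiag (w : Q.Word) (j : ℕ) (m : Q.Letter) : Prop :=
  w.letters[j]? = some m ∨ ∃ c, j = c + 1 ∧ w.letters[c]? = some m.inv

/-- Compatible vectors and functionals at the positions of the word `w`. -/
structure Realizes (w : Q.Word) (y : ℕ → X) (ξ : ℕ → X →ₗ[k] k) : Prop where
  vec : ∀ j ≤ w.length, idemp k Q (w.vtx j) • y j = y j
  dual : ∀ j ≤ w.length, ∀ z, ξ j (idemp k Q (w.vtx j) • z) = ξ j z
  link : ∀ j l, w.letters[j]? = some l → Link l (y j) (ξ j) (y (j + 1)) (ξ (j + 1))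

theorem vtx_cons {i : Q.V} {l : Q.Letter} {C : List Q.Letter} {j : ℕ} (hj : j ≤ C.length) :
    Word.vtx ⟨i, l :: C⟩ (j + 1) = Word.vtx ⟨l.tgt, C⟩ j := by
  cases j with
  | zero => rfl
  | succ j =>
    obtain ⟨m, hm⟩ := Word.exists_letter (w := ⟨l.tgt, C⟩) (j := j) (by simpa [Word.length] using hj)
    rw [Word.vtx_succ hm, Word.vtx_succ (l := m) (by simpa using hm)]

/-- A functional that vanishes on `pull l W` extends along the letter `l` to a functional that
vanishes on `W`; a vector in `pull l W'` extends to a vector in `W'`. -/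
theorem exists_link (l : Q.Letter) {W W' : Submodule k X} (hW : W ≤ vsp k X l.tgt)
    {y : X} {ξ : X →ₗ[k] k} (hξ : ∀ z, ξ (idemp k Q l.src • z) = ξ z) (hy : y ∈ pull l W')
    (h0 : ∀ z ∈ pull l W, ξ z = 0) :
    ∃ (y' : X) (ξ' : X →ₗ[k] k), Link l y ξ y' ξ' ∧ y' ∈ W' ∧ (∀ z ∈ W, ξ' z = 0) ∧
      ∀ z, ξ' (idemp k Q l.tgt • z) = ξ' z := by
  rcases l with ⟨a, _ | _⟩
  · obtain ⟨y', hy', rfl⟩ := hy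
    refine ⟨y', ξ ∘ₗ act k X a, ⟨rfl, fun z => rfl⟩, hy', fun z hz => h0 _ ⟨z, hz, rfl⟩, fun z => ?_⟩
    exact congrArg ξ (arrow_smul_idemp_smul a z)
  · have hker : LinearMap.ker (W.mkQ ∘ₗ act k X a) ≤ LinearMap.ker ξ := by
      intro z hz
      rw [LinearMap.mem_ker, LinearMap.comp_apply, Submodule.mkQ_apply,
        Submodule.Quotient.mk_eq_zero] at hz
      rw [LinearMap.mem_ker, ← hξ]
      refine h0 _ ⟨idemp_smul_mem_vsp _ z, ?_⟩
      change arrow k Q a • idemp k Q (Q.s a) • z ∈ W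
      rw [arrow_smul_idemp_smul]
      exact hz
    have : ξ ∈ LinearMap.range (W.mkQ ∘ₗ act k X a).dualMap := by
      rw [LinearMap.range_dualMap_eq_dualAnnihilator_ker, Submodule.mem_dualAnnihilator]
      exact fun z hz => hker hz
    obtain ⟨η, hη⟩ := this
    have hη' : ∀ z, η (W.mkQ (arrow k Q a • z)) = ξ z := fun z => LinearMap.congr_fun hη z
    refine ⟨arrow k Q a • y, η ∘ₗ W.mkQ ∘ₗ Algebra.lsmul k k X (idemp k Q (Q.t a)),
      ⟨rfl, fun z => ?_⟩, hy.2, fun z hz => ?_, fun z => ?_⟩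
    · rw [← hη']
      change η (W.mkQ (idemp k Q (Q.t a) • arrow k Q a • z)) = _
      rw [← mul_smul, idemp_mul_arrow]
    · have hz' : idemp k Q (Q.t a) • z = z := mem_vsp.1 (hW hz)
      change η (W.mkQ (idemp k Q (Q.t a) • z)) = _
      rw [hz', Submodule.mkQ_apply, (Submodule.Quotient.mk_eq_zero W).2 hz, map_zero]
    · change η (W.mkQ (idemp k Q (Q.t a) • idemp k Q (Q.t a) • z)) =
        η (W.mkQ (idemp k Q (Q.t a) • z))
      rw [← mul_smul, idemp_mul_self]

theorem pullList_kerSide_le {σ : Q.Letter → Prop} {i : Q.V}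
    (hσ : ∀ m, σ m → m.src = i) {C : List Q.Letter} (hC : ∀ m ∈ C.head?, σ m) :
    pullList (kerSide k X) σ i C ≤ vsp k X i := by
  cases C with
  | nil => exact inf_le_left
  | cons l C =>
    rw [← hσ l (hC l rfl)]
    rcases l with ⟨a, _ | _⟩
    · rintro _ ⟨z, -, rfl⟩
      exact arrow_smul_mem_vsp a z
    · exact inf_le_left

/-- A vector in the upper and a functional vanishing on the lower end of the interval given by a
half-string extend along this half-string, up to its end. -/
theorem exists_realizes (hQ : Q.IsGentle k) (C : List Q.Letter) (σ : Q.Letter → Prop) (i : Q.V)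
    (hσ : IsSide σ i) (hC : ∀ m ∈ C.head?, σ m) (hC' : C.IsChain Step) (y₀ : X) (ξ₀ : X →ₗ[k] k)
    (hy : y₀ ∈ pullList (kerSide k X) σ i C)
    (hξ : ∀ z ∈ pullList (imSide k X) σ i C, ξ₀ z = 0)
    (hi : ∀ z, ξ₀ (idemp k Q i • z) = ξ₀ z) :
    ∃ (y : ℕ → X) (ξ : ℕ → X →ₗ[k] k), y 0 = y₀ ∧ ξ 0 = ξ₀ ∧ Realizes ⟨i, C⟩ y ξ ∧
      ∀ j ≤ C.length, ∀ m : Q.Letter, m.src = Word.vtx ⟨i, C⟩ j → (j = 0 → σ m) →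
        InDiag ⟨i, C⟩ j m ∨ Killed m (y j) (ξ j) := by
  induction C generalizing σ i y₀ ξ₀ with
  | nil =>
    refine ⟨fun _ => y₀, fun _ => ξ₀, rfl, rfl, ⟨fun j hj => ?_, fun j hj => ?_, fun j l h => ?_⟩,
      fun j hj m _ hm => Or.inr ?_⟩
    · obtain rfl : j = 0 := by simpa [Word.length] using hj
      exact mem_vsp.1 hy.1
    · obtain rfl : j = 0 := by simpa [Word.length] using hj
      exact hi
    · simp at h
    · replace hm := hm (by simpa using hj)
      rcases m with ⟨a, _ | _⟩
      · intro z
        exact hξ _ (Submodule.mem_iSup_of_mem a (Submodule.mem_iSup_of_mem hm ⟨z, rfl⟩))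
      · exact (Submodule.mem_iInf _).1 ((Submodule.mem_iInf _).1 hy.2 a) hm
  | cons l C ih =>
    have hl : σ l := hC l rfl
    obtain rfl : l.src = i := hσ.src l hl
    have hhead : ∀ m ∈ C.head?, Step l m := by
      cases C with
      | nil => simp
      | cons m C =>
        intro m' hm'
        cases hm'
        exact (List.isChain_cons_cons.1 hC').1
    have hside := hQ.isSide_step l
    obtain ⟨y₁, ξ₁, hlink, hy₁, hξ₁, hi₁⟩ := exists_link l
      (pullList_imSide_le hside.src hhead) hi hy hξ
    obtain ⟨y, ξ, rfl, rfl, hr, hk⟩ := ih (Step l) l.tgt hside hhead hC'.tail y₁ ξ₁ hy₁ hξ₁ hi₁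
    refine ⟨fun j => j.casesOn y₀ y, fun j => j.casesOn ξ₀ ξ, rfl, rfl,
      ⟨fun j hj => ?_, fun j hj => ?_, fun j m hm => ?_⟩, fun j hj m hm hm0 => ?_⟩
    · cases j with
      | zero => exact mem_vsp.1 (pullList_kerSide_le hσ.src hC hy)
      | succ j =>
        have hj' : j ≤ C.length := by simpa [Word.length] using hj
        rw [vtx_cons hj']
        exact hr.vec j hj'
    · cases j with
      | zero => exact hi
      | succ j =>
        have hj' : j ≤ C.length := by simpa [Word.length] using hj
        rw [vtx_cons hj']
        exact hr.dual j hj'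
    · cases j with
      | zero =>
        obtain rfl : l = m := by simpa using hm
        exact hlink
      | succ j => exact hr.link j m (by simpa using hm)
    · cases j with
      | zero =>
        by_cases hml : m = l
        · subst hml; exact Or.inl (Or.inl rfl)
        · exact Or.inr (hlink.killed hm hml (hσ.not_step _ _ hl (hm0 rfl) (Ne.symm hml)))
      | succ j =>
        have hj' : j ≤ C.length := by simpa using hj
        rw [vtx_cons hj'] at hm
        by_cases hst : j = 0 → Step l m
        · rcases hk j hj' m hm hst with (h | ⟨c, rfl, h⟩) | h
          · exact Or.inl (Or.inl (by simpa using h))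
          · exact Or.inl (Or.inr ⟨c + 1, rfl, by simpa using h⟩)
          · exact Or.inr h
        · push Not at hst
          obtain ⟨rfl, hst⟩ := hst
          by_cases hml : m = l.inv
          · exact Or.inl (Or.inr ⟨0, rfl, by simp [hml]⟩)
          · refine Or.inr (hlink.inv.killed ?_ hml (by simpa using hst))
            rw [hm, Letter.src_inv]; rfl

/-! ### String modules as direct summands -/

theorem Realizes.apply_eq {w : Q.Word} {y : ℕ → X} {ξ : ℕ → X →ₗ[k] k} (h : Realizes w y ξ) :
    ∀ j ≤ w.length, ξ j (y j) = ξ 0 (y 0) := by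
  intro j
  induction j with
  | zero => intro _; rfl
  | succ j ih =>
    intro hj
    obtain ⟨l, hl⟩ := Word.exists_letter (w := w) (j := j) (by omega)
    rw [(h.link j l hl).apply_eq, ih (by omega)]

/-- Compatible vectors and functionals along a self-avoiding string, which are killed by all arrows
outside of the diagram, exhibit the string module as a direct summand. -/
theorem Realizes.isSummand {w : Q.Word} {y : ℕ → X} {ξ : ℕ → X →ₗ[k] k} (h : Realizes w y ξ)
    (hw : w.IsString) (hsa : w.SelfAvoiding)
    (hk : ∀ j ≤ w.length, ∀ m : Q.Letter, m.src = w.vtx j → InDiag w j m ∨ Killed m (y j) (ξ j))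
    (h1 : ξ 0 (y 0) = 1) {M : Type*} [AddCommGroup M] [Module k M] [Module (Alg k Q) M]
    [IsScalarTower k (Alg k Q) M] {x : Module.Basis (Fin (w.length + 1)) k M}
    (hx : IsStringBasis w x) : IsSummand (Alg k Q) M X := by
  have harr : ∀ {α j i}, w.Arr α j i →
      arrow k Q α • y j = y i ∧ ∀ z, ξ i (arrow k Q α • z) = ξ j z := by
    rintro α j i (⟨rfl, hl⟩ | ⟨rfl, hl⟩)
    · have := h.link _ _ hl
      exact ⟨this.1.symm, this.2⟩
    · have := h.link _ _ hl
      exact ⟨this.1.symm, this.2⟩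
  obtain ⟨s, hs⟩ := hx.exists_hom y h.vec (fun α j i hα => (harr hα).1) (fun α j hj hα => by
    by_cases hsrc : Q.s α = w.vtx j
    · rcases hk j hj (α, true) hsrc with (hd | ⟨c, rfl, hd⟩) | hd
      · exact absurd (Or.inl ⟨rfl, hd⟩) (hα (j + 1))
      · exact absurd (Or.inr ⟨rfl, hd⟩) (hα c)
      · exact hd
    · rw [← h.vec j hj, ← arrow_smul_idemp_smul, ← mul_smul (idemp k Q (Q.s α)),
        idemp_mul_of_ne hsrc, zero_smul, smul_zero])
  have hdual : ∀ α, ∀ i ≤ w.length, (∀ j, ¬ w.Arr α j i) → ∀ z, ξ i (arrow k Q α • z) = 0 := by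
    intro α i hi hα z
    by_cases htgt : Q.t α = w.vtx i
    · rcases hk i hi (α, false) htgt with (hd | ⟨c, rfl, hd⟩) | hd
      · exact absurd (Or.inr ⟨rfl, hd⟩) (hα (i + 1))
      · exact absurd (Or.inl ⟨rfl, hd⟩) (hα c)
      · exact hd z
    · rw [← h.dual i hi, ← mem_vsp.1 (arrow_smul_mem_vsp α z), ← mul_smul,
        idemp_mul_of_ne (Ne.symm htgt), zero_smul, map_zero]
  let r₀ : X →ₗ[k] M := ∑ j : Fin (w.length + 1), (ξ j).smulRight (bvec x j)
  have hr₀ : ∀ z, r₀ z = ∑ j : Fin (w.length + 1), ξ j z • bvec x j := fun z => by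
    simp [r₀, LinearMap.sum_apply]
  have hcr : ∀ i ≤ w.length, ∀ z, cvec x i (r₀ z) = ξ i z := by
    intro i hi z
    rw [hr₀, map_sum, Finset.sum_eq_single ⟨i, Nat.lt_succ_of_le hi⟩]
    · rw [map_smul, cvec_bvec x hi, if_pos rfl]; simp
    · intro j _ hj
      rw [map_smul, cvec_bvec x (Nat.le_of_lt_succ j.2), if_neg, smul_zero]
      rintro rfl
      exact hj rfl
    · simp
  have hext : ∀ m m' : M, (∀ i ≤ w.length, cvec x i m = cvec x i m') → m = m' := by
    intro m m' hmm
    rw [← sum_cvec x m, ← sum_cvec x m']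
    exact Finset.sum_congr rfl fun i _ => by rw [hmm i (Nat.le_of_lt_succ i.2)]
  have hxc : ∀ i ≤ w.length, ∀ v, ∀ m : M, cvec x i (idemp k Q v • m) =
      open Classical in if w.vtx i = v then cvec x i m else 0 := by
    intro i hi v m
    split_ifs with hv
    · subst hv
      have h2 : cvec x i m = cvec x i (∑ v : Q.V, idemp k Q v • m) := by rw [sum_idemp_smul]
      rw [h2, map_sum, Finset.sum_eq_single (w.vtx i)]
      · intro v _ hv
        exact hx.cvec_idemp v i m (Ne.symm hv)
      · simp
    · exact hx.cvec_idemp v i m hv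
  let r : X →ₗ[Alg k Q] M := homOfGenerators r₀
    (fun v z => hext _ _ fun i hi => by
      rw [hcr i hi, hxc i hi]
      split_ifs with hv
      · rw [← hv, h.dual i hi, hcr i hi]
      · rw [← h.dual i hi, ← mul_smul, idemp_mul_of_ne hv, zero_smul, map_zero])
    (fun α z => hext _ _ fun i hi => by
      rw [hcr i hi]
      by_cases hα : ∃ j, w.Arr α j i
      · obtain ⟨j, hj⟩ := hα
        rw [(harr hj).2, hx.cvec_arrow hw hj, hcr j hj.le.1]
      · push Not at hα
        rw [hdual α i hi hα, hx.cvec_arrow_zero hα])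
  have hrs : r.restrictScalars k ∘ₗ s.restrictScalars k = LinearMap.id := by
    apply x.ext
    intro j
    have hj := Nat.le_of_lt_succ j.2
    rw [← bvec_val x j]
    change r₀ (s (bvec x j)) = bvec x j
    rw [hs j hj]
    refine hext _ _ fun i hi => ?_
    rw [hcr i hi, cvec_bvec x hj]
    split_ifs with hij
    · rw [hij, h.apply_eq j hj, h1]
    · rw [← h.dual i hi, ← h.vec j hj, ← mul_smul, idemp_mul_of_ne, zero_smul, map_zero]
      intro hv
      exact hij (hsa _ _ hi hj hv)
  exact ⟨s, r, fun m => LinearMap.congr_fun hrs m⟩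

/-- Every nonzero module over a gentle algebra all of whose strings are self-avoiding has a string
module as a direct summand. -/
theorem exists_string_isSummand (hQ : Q.IsGentle k)
    (hsa : ∀ w : Q.Word, w.IsString → w.SelfAvoiding) [Nontrivial X] :
    ∃ w : Q.Word, w.IsString ∧ ∀ (M : Type (max u v)) [AddCommGroup M] [Module k M]
      [Module (Alg k Q) M] [IsScalarTower k (Alg k Q) M]
      (x : Module.Basis (Fin (w.length + 1)) k M), IsStringBasis w x →
      IsSummand (Alg k Q) M X := by
  have hX : ∃ i : Q.V, vsp k X i ≠ (⊥ : Submodule k X) := by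
    by_contra! h
    obtain ⟨z, hz⟩ := exists_ne (0 : X)
    refine hz ?_
    rw [← sum_idemp_smul (k := k) (P := Q) z]
    refine Finset.sum_eq_zero fun i _ => ?_
    have := idemp_smul_mem_vsp (k := k) i z
    rwa [h i] at this
  obtain ⟨i, hi⟩ := hX
  obtain ⟨σ, τ, hσ, hτ, hcov, hcross⟩ := hQ.exists_sides i
  have hbound : ∀ ρ : Q.Letter → Prop, IsSide ρ i → ∀ C : List Q.Letter, (∀ m ∈ C.head?, ρ m) →
      C.IsChain Step → C.length ≤ Fintype.card Q.V := by
    intro ρ hρ C h1 h2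
    have hs : Word.IsString ⟨i, C⟩ := ⟨fun l hl => hρ.src l (h1 l hl), h2⟩
    have hinj : Function.Injective (fun j : Fin (C.length + 1) => Word.vtx ⟨i, C⟩ j) :=
      fun a b hab => Fin.ext (hsa _ hs _ _ (Nat.le_of_lt_succ a.2) (Nat.le_of_lt_succ b.2) hab)
    have := Fintype.card_le_of_injective _ hinj
    rw [Fintype.card_fin] at this
    omega
  -- the interval of `C` contains nonzero vectors, but its lower end vanishes
  obtain ⟨C, hC1, hC2, hC3, hC4⟩ := exists_pullList hQ _ σ i hσ (hbound σ hσ)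
    (fun W => W ≠ (⊥ : Submodule k X)) (by simp) hi
  set U := pullList (kerSide k X) σ i C with hU
  have hUi : U ≤ vsp k X i := pullList_kerSide_le hσ.src hC1
  -- inside of the upper end `U` for `C`, the same is achieved on the other side of `i`
  obtain ⟨D, hD1, hD2, hD3, hD4⟩ := exists_pullList hQ _ τ i hτ (hbound τ hτ)
    (fun W => W ⊓ U ≠ ⊥) (by simp) (by rwa [inf_eq_right.2 hUi])
  rw [not_not] at hC3 hD3
  obtain ⟨y₀, ⟨hyD, hyC⟩, hy0⟩ := Submodule.exists_mem_ne_zero_of_ne_bot hD4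
  have hyim : y₀ ∉ pullList (imSide k X) τ i D := fun h => hy0 (by
    have : y₀ ∈ pullList (imSide k X) τ i D ⊓ U := ⟨h, hyC⟩
    rwa [hD3] at this)
  obtain ⟨ξ', hξy, hξ'⟩ := Submodule.exists_dual_map_eq_bot_of_notMem hyim inferInstance
  have hyi : idemp k Q i • y₀ = y₀ := mem_vsp.1 (hUi hyC)
  obtain ⟨ξ₀, hξ₀⟩ : ∃ ξ₀ : X →ₗ[k] k, ∀ z, ξ₀ z = (ξ' y₀)⁻¹ * ξ' (idemp k Q i • z) :=
    ⟨(ξ' y₀)⁻¹ • ξ' ∘ₗ Algebra.lsmul k k X (idemp k Q i), fun z => rfl⟩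
  have hξi : ∀ z, ξ₀ (idemp k Q i • z) = ξ₀ z := fun z => by
    rw [hξ₀, hξ₀, ← mul_smul, idemp_mul_self]
  have hξD : ∀ z ∈ pullList (imSide k X) τ i D, ξ₀ z = 0 := by
    intro z hz
    have hzi : idemp k Q i • z = z := mem_vsp.1 (pullList_imSide_le hτ.src hD1 hz)
    have h2 : ξ' z ∈ (pullList (imSide k X) τ i D).map ξ' := ⟨z, hz, rfl⟩
    rw [hξ', Submodule.mem_bot] at h2
    rw [hξ₀, hzi, h2, mul_zero]
  have hξ1 : ξ₀ y₀ = 1 := by rw [hξ₀, hyi, inv_mul_cancel₀ hξy]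
  obtain ⟨yC, ξC, rfl, rfl, hrC, hkC⟩ := exists_realizes hQ C σ i hσ hC1 hC2 y₀ ξ₀ hyC
    (by rw [hC3]; intro z hz; rw [(Submodule.mem_bot k).1 hz, map_zero]) hξi
  obtain ⟨yD, ξD, hyD0, hξD0, hrD, hkD⟩ := exists_realizes hQ D τ i hτ hD1 hD2 (yC 0) (ξC 0) hyD hξD hξi
  -- glue the two half-strings at the vertex `i`
  set c : Q.Word := ⟨i, C⟩ with hc
  set n := C.length with hn
  have hcn : c.length = n := rfl
  have hcs : c.IsString := ⟨fun l hl => hσ.src l (hC1 l hl), hC2⟩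
  have hcin : c.inv.letters.length = n := by
    have := Word.inv_length c
    rwa [hcn] at this
  let w : Q.Word := ⟨c.inv.start, c.inv.letters ++ D⟩
  have hwlen : w.length = n + D.length := by
    change (c.inv.letters ++ D).length = _
    rw [List.length_append, hcin]
  have hwl : ∀ a b, a + b + 1 = n → ∀ l, w.letters[a]? = some l ↔ C[b]? = some l.inv := by
    intro a b hab l
    change (c.inv.letters ++ D)[a]? = _ ↔ _
    rw [List.getElem?_append_left (by omega)]
    exact Word.inv_getElem?_eq_some (by rw [hcn]; omega)
  have hwr : ∀ a, w.letters[n + a]? = D[a]? := by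
    intro a
    change (c.inv.letters ++ D)[n + a]? = _
    rw [List.getElem?_append_right (by omega), hcin, Nat.add_sub_cancel_left]
  have hDhead : ∀ m, D[0]? = some m → τ m := fun m hm => hD1 m (by rwa [List.head?_eq_getElem?])
  have hChead : ∀ m, C[0]? = some m → σ m := fun m hm => hC1 m (by rwa [List.head?_eq_getElem?])
  have hcinv := hcs.inv
  have hw : w.IsString := by
    rw [Word.isString_iff]
    constructor
    · intro l hl
      rcases Nat.eq_zero_or_pos n with h0 | h0
      · have h2 := hwr 0
        rw [h0, Nat.zero_add, hl] at h2
        rw [hτ.src l (hDhead l h2.symm)]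
        have h3 : c.inv.start = c.vtx c.length := Word.finish_eq c
        change i = c.inv.start
        rw [h3, hcn, h0]; rfl
      · refine hcinv.1 l ?_
        rw [List.head?_eq_getElem?, ← List.getElem?_append_left (l₂ := D) (by omega)]
        exact hl
    · intro j l m hl hm
      rcases lt_trichotomy (j + 1) n with hj | hj | hj
      · change (c.inv.letters ++ D)[j]? = _ at hl
        change (c.inv.letters ++ D)[j + 1]? = _ at hm
        rw [List.getElem?_append_left (by omega)] at hl hm
        exact hcinv.step hl hm
      · rw [hwl j 0 (by omega)] at hl
        rw [hj, ← Nat.add_zero n, hwr 0] at hm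
        simpa using hcross _ _ (hChead _ hl) (hDhead _ hm)
      · obtain ⟨a, rfl⟩ := Nat.exists_eq_add_of_le (show n ≤ j by omega)
        rw [hwr] at hl
        rw [add_assoc, hwr] at hm
        obtain ⟨h1, rfl⟩ := List.getElem?_eq_some_iff.1 hl
        obtain ⟨h2, rfl⟩ := List.getElem?_eq_some_iff.1 hm
        exact List.isChain_iff_getElem.1 hD2 a h2
  have hvl : ∀ a b, a + b = n → w.vtx a = c.vtx b := by
    intro a b hab
    cases b with
    | succ b =>
      cases a with
      | zero =>
        have h3 : c.inv.start = c.vtx c.length := Word.finish_eq c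
        rw [show b + 1 = c.length by rw [hcn]; omega, ← h3]; rfl
      | succ a =>
        obtain ⟨l, hl⟩ := Word.exists_letter (w := w) (j := a) (by omega)
        have h2 := (hwl a (b + 1) (by omega) l).1 hl
        rw [Word.vtx_succ hl, hcs.vtx_eq h2, Letter.src_inv]
    | zero =>
      cases a with
      | zero =>
        have h3 : c.inv.start = c.vtx c.length := Word.finish_eq c
        rw [show c.length = 0 by rw [hcn]; omega] at h3
        exact h3
      | succ a =>
        obtain ⟨l, hl⟩ := Word.exists_letter (w := w) (j := a) (by omega)
        have h2 := (hwl a 0 (by omega) l).1 hl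
        rw [Word.vtx_succ hl, hcs.vtx_eq h2, Letter.src_inv]
  have hvr : ∀ a ≤ D.length, w.vtx (n + a) = Word.vtx ⟨i, D⟩ a := by
    intro a ha
    cases a with
    | zero => rw [Nat.add_zero, hvl n 0 rfl]; rfl
    | succ a =>
      obtain ⟨l, hl⟩ := Word.exists_letter (w := ⟨i, D⟩) (j := a)
        (show a + 1 ≤ D.length from ha)
      rw [Word.vtx_succ hl, ← add_assoc, Word.vtx_succ (l := l) (by rw [hwr]; exact hl)]
  refine ⟨w, hw, ?_⟩
  intro M _ _ _ _ x hx
  let y : ℕ → X := fun j => if j ≤ n then yC (n - j) else yD (j - n)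
  let ξ : ℕ → X →ₗ[k] k := fun j => if j ≤ n then ξC (n - j) else ξD (j - n)
  have hyl : ∀ a b, a + b = n → y a = yC b ∧ ξ a = ξC b := by
    intro a b hab
    simp only [y, ξ, if_pos (show a ≤ n by omega), show n - a = b by omega, and_self]
  have hyr : ∀ a, y (n + a) = yD a ∧ ξ (n + a) = ξD a := by
    intro a
    rcases Nat.eq_zero_or_pos a with rfl | h0
    · have := hyl n 0 rfl
      rw [Nat.add_zero, this.1, this.2, hyD0, hξD0]
      exact ⟨rfl, rfl⟩
    · simp only [y, ξ, if_neg (show ¬ n + a ≤ n by omega), Nat.add_sub_cancel_left, and_self]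
  have hcases : ∀ j ≤ w.length, (∃ b, j + b = n ∧ b ≠ 0) ∨ ∃ a ≤ D.length, j = n + a := by
    intro j hj
    rcases lt_or_ge j n with h | h
    · exact Or.inl ⟨n - j, by omega, by omega⟩
    · exact Or.inr ⟨j - n, by omega, by omega⟩
  have hdl : ∀ a b, a + b = n → ∀ m, InDiag c b m → InDiag w a m := by
    rintro a b hab m (h | ⟨b, rfl, h⟩)
    · have hb := Word.lt_length h
      rw [hcn] at hb
      exact Or.inr ⟨a - 1, by omega, (hwl (a - 1) b (by omega) m.inv).2 (by simpa using h)⟩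
    · exact Or.inl ((hwl a b (by omega) m).2 h)
  have hdr : ∀ a m, InDiag ⟨i, D⟩ a m → InDiag w (n + a) m := by
    rintro a m (h | ⟨a, rfl, h⟩)
    · exact Or.inl ((hwr a).trans h)
    · exact Or.inr ⟨n + a, by omega, (hwr a).trans h⟩
  have hreal : Realizes w y ξ := by
    refine ⟨fun j hj => ?_, fun j hj => ?_, fun j l hl => ?_⟩
    · rcases hcases j hj with ⟨b, hb, -⟩ | ⟨a, ha, rfl⟩
      · rw [hvl j b hb, (hyl j b hb).1]
        exact hrC.vec b (by rw [hcn]; omega)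
      · rw [hvr a ha, (hyr a).1]
        exact hrD.vec a ha
    · rcases hcases j hj with ⟨b, hb, -⟩ | ⟨a, ha, rfl⟩
      · rw [hvl j b hb, (hyl j b hb).2]
        exact hrC.dual b (by rw [hcn]; omega)
      · rw [hvr a ha, (hyr a).2]
        exact hrD.dual a ha
    · rcases hcases j (Word.lt_length hl).le with ⟨b, hb, hb0⟩ | ⟨a, ha, rfl⟩
      · obtain ⟨b, rfl⟩ := Nat.exists_eq_succ_of_ne_zero hb0
        rw [hwl j b (by omega)] at hl
        rw [(hyl j (b + 1) hb).1, (hyl j (b + 1) hb).2, (hyl (j + 1) b (by omega)).1,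
          (hyl (j + 1) b (by omega)).2]
        simpa using (hrC.link b _ hl).inv
      · rw [hwr] at hl
        rw [add_assoc, (hyr a).1, (hyr a).2, (hyr (a + 1)).1, (hyr (a + 1)).2]
        exact hrD.link a l hl
  refine hreal.isSummand hw (hsa w hw) (fun j hj m hm => ?_) ?_ hx
  · rcases hcases j hj with ⟨b, hb, hb0⟩ | ⟨a, ha, rfl⟩
    · rw [hvl j b hb] at hm
      rw [(hyl j b hb).1, (hyl j b hb).2]
      exact (hkC b (by omega) m hm (fun h => absurd h hb0)).imp_left (hdl j b hb m)
    · rw [hvr a ha] at hm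
      by_cases hd : a = 0 → τ m
      · rw [(hyr a).1, (hyr a).2]
        exact (hkD a ha m hm hd).imp_left (hdr a m)
      · push Not at hd
        obtain ⟨rfl, hd⟩ := hd
        rw [Nat.add_zero, (hyl n 0 rfl).1, (hyl n 0 rfl).2]
        exact (hkC 0 (Nat.zero_le _) m hm
          (fun _ => (hcov m hm).resolve_right hd)).imp_left (hdl n 0 rfl m)
  · rw [← hreal.apply_eq n (by omega), (hyl n 0 rfl).1, (hyl n 0 rfl).2]
    exact hξ1

/-- Classification: every finitely generated module over a gentle algebra all of whose strings are
self-avoiding is a direct sum of string modules. -/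
theorem addStrings_of_finite (hQ : Q.IsGentle k)
    (hsa : ∀ w : Q.Word, w.IsString → w.SelfAvoiding) {X : ModuleCat.{max u v} (Alg k Q)}
    (hX : ModuleCat.isFG (Alg k Q) X) : addStrings k {w | w.IsString} X := by
  have : Module.Finite k (Alg k Q) := hQ.finite
  have : Module.Finite (Alg k Q) X := hX
  have : IsArtinianRing (Alg k Q) := IsArtinianRing.of_finite k _
  obtain ⟨n, hn⟩ := ENat.ne_top_iff_exists.1 (Module.length_ne_top (R := Alg k Q) (M := X))
  induction n using Nat.strong_induction_on generalizing X with
  | _ n ih =>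
    rcases subsingleton_or_nontrivial X with hs | hs
    · exact addClosure_of_subsingleton
    let _ : Module k X := Module.compHom X (algebraMap k (Alg k Q))
    have : IsScalarTower k (Alg k Q) X := IsScalarTower.of_algebraMap_smul fun c x => rfl
    obtain ⟨w, hw, h⟩ := exists_string_isSummand (X := X) hQ hsa
    obtain ⟨M, hM⟩ := exists_isStringModule k hw
    obtain ⟨_, _, x, hx⟩ := hM.exists_basis
    obtain ⟨s, p, hsp⟩ := h M x hx
    let e := prodKerEquiv s p hsp
    let K := ModuleCat.of (Alg k Q) (LinearMap.ker p)
    have hKf : Module.Finite (Alg k Q) K := inferInstanceAs (Module.Finite _ (LinearMap.ker p))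
    obtain ⟨m, hm⟩ := ENat.ne_top_iff_exists.1 (Module.length_ne_top (R := Alg k Q) (M := K))
    have hle : Module.length (Alg k Q) X = Module.length (Alg k Q) M + Module.length (Alg k Q) K := by
      rw [e.length_eq, Module.length_prod]
    have hMn : Nontrivial M := hM.nontrivial
    have h1 : 0 < Module.length (Alg k Q) M := Module.length_pos
    have hlt : m < n := by
      rw [← hn, ← hm] at hle
      cases hl : Module.length (Alg k Q) M with
      | top => rw [hl, top_add] at hle; exact absurd hle (ENat.natCast_ne_top n)
      | coe l =>
        rw [hl] at hle h1
        norm_cast at hle h1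
        omega
    exact addClosure_prod (le_addClosure ⟨w, hw, hM⟩) (ih m hlt hKf hKf hm)
      (IsSummand.of_equiv e)

end Sides

end BoundQuiver

namespace BoundQuiver

/-! ### String modules up to isomorphism -/

/-- No arrow of the diagram of `w` enters the interval `[a, b]`, so that the string module of the
subword on `[a, b]` is a quotient of the string module of `w`. -/
structure Word.IsFactor {P : BoundQuiver.{v}} (w : P.Word) (a b : ℕ) : Prop where
  le : a ≤ b
  le_length : b ≤ w.length
  left : ∀ c l, c + 1 = a → w.letters[c]? = some l → l.2 = false
  right : ∀ l, w.letters[b]? = some l → l.2 = true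

theorem Word.isFactor_self {P : BoundQuiver.{v}} (w : P.Word) : w.IsFactor 0 w.length :=
  ⟨Nat.zero_le _, le_rfl, fun c _ h => absurd h (Nat.succ_ne_zero c),
    fun _ h => absurd (Word.lt_length h) (lt_irrefl _)⟩

namespace IsStringModule

variable {k : Type u} [Field k] {P : BoundQuiver.{v}} {w u : P.Word}
  {X Y Z : ModuleCat.{max u v} (Alg k P)}

theorem of_equiv (h : IsStringModule k w X) (e : X ≃ₗ[Alg k P] Y) : IsStringModule k w Y := by
  obtain ⟨i1, i2, x, hx⟩ := h.exists_basis
  let _ : Module k Y := Module.compHom Y (algebraMap k (Alg k P))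
  have : IsScalarTower k (Alg k P) Y := IsScalarTower.of_algebraMap_smul fun c x => rfl
  obtain ⟨y, hy, -⟩ := hx.map e
  exact isStringModule_of_basis hy

theorem nonempty_equiv (hX : IsStringModule k w X) (hY : IsStringModule k w Y) :
    Nonempty (X ≃ₗ[Alg k P] Y) := by
  obtain ⟨_, _, x, hx⟩ := hX.exists_basis
  obtain ⟨_, _, y, hy⟩ := hY.exists_basis
  exact hx.exists_equiv hy

theorem inv (hX : IsStringModule k w X) (hw : w.IsString) : IsStringModule k w.inv X := by
  obtain ⟨_, _, x, hx⟩ := hX.exists_basis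
  obtain ⟨y, hy, -⟩ := hx.inv hw
  exact isStringModule_of_basis hy

/-- Self-avoiding strings with the same string module are equal or inverse to each other. -/
theorem eq_or_eq_inv (hX : IsStringModule k w X) (hX' : IsStringModule k u X) (hw : w.IsString)
    (hu : u.IsString) (hws : w.SelfAvoiding) (hus : u.SelfAvoiding) : w = u ∨ w = u.inv := by
  obtain ⟨i1, i2, x, hx⟩ := hX.exists_basis
  obtain ⟨i3, i4, y, hy⟩ := hX'.exists_basis
  obtain rfl := module_unique i1 i3 i2 i4
  exact Word.eq_or_eq_inv_of_occurs (hx.occurs hy) (hy.occurs hx) hw hu hws hus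

theorem bijective_of_ne_zero (hX : IsStringModule k w X) (hsa : w.SelfAvoiding)
    (f : X →ₗ[Alg k P] X) (hf : f ≠ 0) : Function.Bijective f := by
  obtain ⟨_, _, x, hx⟩ := hX.exists_basis
  exact hx.bijective_of_ne_zero hsa f hf

theorem indecomposable (hX : IsStringModule k w X) (hsa : w.SelfAvoiding) : Indecomposable X := by
  have := hX.nontrivial
  exact indecomposable_of_bijective (hX.bijective_of_ne_zero hsa)

theorem length_ne_top (hX : IsStringModule k w X) : Module.length (Alg k P) X ≠ ⊤ := by
  obtain ⟨_, _, x, hx⟩ := hX.exists_basis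
  have : Module.Finite k X := Module.Finite.of_basis x
  have : IsNoetherian (Alg k P) X := isNoetherian_of_tower k inferInstance
  have : IsArtinian (Alg k P) X := isArtinian_of_tower k inferInstance
  exact Module.length_ne_top

theorem exists_surjective_slice (hX : IsStringModule k w X) (hw : w.IsString) {a b : ℕ}
    (h : w.IsFactor a b) (hY : IsStringModule k (w.slice a b) Y) :
    ∃ f : X →ₗ[Alg k P] Y, Function.Surjective f := by
  obtain ⟨_, _, x, hx⟩ := hX.exists_basis
  obtain ⟨_, _, y, hy⟩ := hY.exists_basis
  obtain ⟨p, hp⟩ := IsStringBasis.exists_sliceProj hx hy hw h.le_length (by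
    rintro α j i (⟨rfl, hl⟩ | ⟨rfl, hl⟩) h1 h2
    · refine ⟨?_, by omega⟩
      by_contra h3
      have := h.left j _ (by omega) hl
      simp at this
    · refine ⟨by omega, ?_⟩
      by_contra h3
      have : i = b := by omega
      subst this
      have := h.right _ hl
      simp at this)
  exact ⟨p, Function.RightInverse.surjective (g := sliceIncl x y) fun m => by
      rw [hp, sliceProj_sliceIncl h.le h.le_length]⟩

/-- A string `v γ u` with a direct letter `γ`: the module `M(v)` is a submodule with quotient `M(u)`. -/
theorem exists_exact_of_direct (hX : IsStringModule k w X) (hw : w.IsString) {c : ℕ} {α : P.E}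
    (hl : w.letters[c]? = some (α, true)) (hY : IsStringModule k (w.slice 0 c) Y)
    (hZ : IsStringModule k (w.slice (c + 1) w.length) Z) :
    ∃ (s : Z →ₗ[Alg k P] X) (p : X →ₗ[Alg k P] Y), Function.Injective s ∧
      Function.Surjective p ∧ Function.Exact s p := by
  obtain ⟨_, _, x, hx⟩ := hX.exists_basis
  obtain ⟨_, _, y, hy⟩ := hY.exists_basis
  obtain ⟨_, _, z, hz⟩ := hZ.exists_basis
  have hc := Word.lt_length hl
  refine IsStringBasis.exists_exact hx hz hy hw hc le_rfl (Nat.zero_le _) hc.le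
    (fun j hj => by omega) fun β j i hβ h1 h2 => ⟨?_, hβ.le.2⟩
  rcases hβ with ⟨rfl, hβ⟩ | ⟨rfl, hβ⟩
  · omega
  · by_contra h3
    have : i = c := by omega
    subst this
    rw [hl] at hβ
    simp at hβ

/-- A string `v γ⁻¹ u` with an inverse letter `γ⁻¹`: the module `M(u)` is a submodule with quotient
`M(v)`. -/
theorem exists_exact_of_inverse (hX : IsStringModule k w X) (hw : w.IsString) {c : ℕ} {α : P.E}
    (hl : w.letters[c]? = some (α, false)) (hY : IsStringModule k (w.slice 0 c) Y)
    (hZ : IsStringModule k (w.slice (c + 1) w.length) Z) :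
    ∃ (s : Y →ₗ[Alg k P] X) (p : X →ₗ[Alg k P] Z), Function.Injective s ∧
      Function.Surjective p ∧ Function.Exact s p := by
  obtain ⟨_, _, x, hx⟩ := hX.exists_basis
  obtain ⟨_, _, y, hy⟩ := hY.exists_basis
  obtain ⟨_, _, z, hz⟩ := hZ.exists_basis
  have hc := Word.lt_length hl
  refine IsStringBasis.exists_exact hx hy hz hw (Nat.zero_le _) hc.le hc le_rfl
    (fun j hj => by omega) fun β j i hβ h1 h2 => ⟨Nat.zero_le _, ?_⟩
  rcases hβ with ⟨rfl, hβ⟩ | ⟨rfl, hβ⟩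
  · by_contra h3
    have : j = c := by omega
    subst this
    rw [hl] at hβ
    simp at hβ
  · omega

/-- A submodule `N` of the module of a self-avoiding string is spanned by basis vectors; the runs of
the set `χ` of their positions give direct summands of `N` and of the quotient by `N`. -/
theorem exists_runs (hX : IsStringModule k w X) (hw : w.IsString) (hsa : w.SelfAvoiding)
    (N : Submodule (Alg k P) X) : ∃ χ : ℕ → Prop,
      (∀ a b, IsRun χ w.length a b → χ a → ∀ Y : ModuleCat.{max u v} (Alg k P),
        IsStringModule k (w.slice a b) Y → IsSummand (Alg k P) Y N) ∧
      (∀ a b, IsRun χ w.length a b → ¬ χ a → ∀ Y : ModuleCat.{max u v} (Alg k P),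
        IsStringModule k (w.slice a b) Y → IsSummand (Alg k P) Y (X ⧸ N)) ∧
      (∀ α j i, w.Arr α j i → χ j → χ i) ∧ (N ≠ ⊤ → ∃ j ≤ w.length, ¬ χ j) := by
  obtain ⟨_, _, x, hx⟩ := hX.exists_basis
  refine ⟨fun j => bvec x j ∈ N, fun a b hr ha Y hY => ?_, fun a b hr ha Y hY => ?_,
    fun α j i h hj => ?_, fun hN => ?_⟩
  · obtain ⟨_, _, y, hy⟩ := hY.exists_basis
    exact hx.exists_retract_sub hy hw hsa N hr ha
  · obtain ⟨_, _, y, hy⟩ := hY.exists_basis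
    exact hx.exists_retract_quot hy hw hsa N hr ha
  · change bvec x i ∈ N
    rw [← hx.arrow_smul h]
    exact N.smul_mem _ hj
  · by_contra! h
    refine hN (eq_top_iff.2 fun z _ => ?_)
    rw [← x.sum_repr z]
    refine N.sum_mem fun j _ => (N.restrictScalars k).smul_mem _ ?_
    rw [← bvec_val x j]
    exact h j (Nat.le_of_lt_succ j.2)

end IsStringModule

/-! ### Specialization and lifts of words -/

section Lifts

variable {Q : BoundQuiver.{v}}

theorem specializeLetter_src (l : Q.double.Letter) : (specializeLetter l).src = l.src := by
  rcases l with ⟨_ | _, _ | _⟩ <;> rfl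

theorem specializeLetter_tgt (l : Q.double.Letter) : (specializeLetter l).tgt = l.tgt := by
  rcases l with ⟨_ | _, _ | _⟩ <;> rfl

theorem specializeLetter_inv (l : Q.double.Letter) :
    specializeLetter l.inv = (specializeLetter l).inv := by
  rcases l with ⟨_ | _, _ | _⟩ <;> rfl

/-- A letter of the doubled quiver is determined by its specialization and its direction. -/
theorem letter_ext {l m : Q.double.Letter} (h : specializeLetter l = specializeLetter m)
    (h2 : l.2 = m.2) : l = m := by
  rcases l with ⟨_ | _, _ | _⟩ <;> rcases m with ⟨_ | _, _ | _⟩ <;>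
    simp_all [specializeLetter]

@[simp] theorem specialize_length (w : Q.double.Word) : (specialize w).length = w.length := by
  simp [specialize, Word.length]

theorem specialize_getElem? (w : Q.double.Word) (j : ℕ) :
    (specialize w).letters[j]? = (w.letters[j]?).map specializeLetter := by
  simp [specialize]

theorem specialize_vtx (w : Q.double.Word) (j : ℕ) : (specialize w).vtx j = w.vtx j := by
  have : (specialize w).vertices = w.vertices := by
    simp only [Word.vertices, specialize, List.map_map]
    congr 1
    exact List.map_congr_left fun l _ => specializeLetter_tgt l
  unfold Word.vtx
  rw [this]
  rfl

theorem specialize_slice (w : Q.double.Word) (a b : ℕ) :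
    specialize (w.slice a b) = (specialize w).slice a b := by
  ext1
  · exact (specialize_vtx w a).symm
  · simp [specialize, Word.slice, List.map_take, List.map_drop]

theorem specialize_finish (w : Q.double.Word) : (specialize w).finish = w.finish := by
  rw [Word.finish_eq, Word.finish_eq, specialize_length]
  exact specialize_vtx w _

theorem specialize_inv (w : Q.double.Word) : specialize w.inv = (specialize w).inv := by
  ext1
  · exact (specialize_finish w).symm
  · simp only [specialize, Word.inv, List.map_reverse, List.map_map]
    congr 1
    exact List.map_congr_left fun l _ => specializeLetter_inv l

theorem Step.of_specializeLetter {l m : Q.double.Letter}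
    (h : Step (specializeLetter l) (specializeLetter m)) : Step l m := by
  obtain ⟨h1, h2, h3, h4⟩ := h
  refine ⟨?_, ?_, ?_, ?_⟩
  · exact (specializeLetter_src m).symm.trans (h1.trans (specializeLetter_tgt l))
  · rintro rfl
    exact h2 (specializeLetter_inv l)
  · rcases l with ⟨l, ε⟩
    rcases m with ⟨m, δ⟩
    rintro ⟨h5, h6, ⟨β, α, h⟩ | ⟨β, α, h⟩⟩ <;> simp_all [specializeLetter]
  · rcases l with ⟨l, ε⟩
    rcases m with ⟨m, δ⟩
    rintro ⟨h5, h6, ⟨β, α, h⟩ | ⟨β, α, h⟩⟩ <;> simp_all [specializeLetter]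

/-- Every word of the doubled quiver which specializes to a string is itself a string: no relation
involves both an arrow and a dual arrow. -/
theorem IsLiftedString.of_specialize {w : Q.double.Word} (h : (specialize w).IsString) :
    IsLiftedString w := by
  refine ⟨Word.isString_iff.2 ⟨fun l hl => ?_, fun j l m hl hm => ?_⟩, h⟩
  · have := (Word.isString_iff.1 h).1 (specializeLetter l) (by rw [specialize_getElem?, hl]; rfl)
    exact (specializeLetter_src l).symm.trans this
  · exact Step.of_specializeLetter (h.step (j := j) (by rw [specialize_getElem?, hl]; rfl)
      (by rw [specialize_getElem?, hm]; rfl))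

theorem IsLiftedString.slice {w : Q.double.Word} (h : IsLiftedString w) (a b : ℕ) :
    IsLiftedString (w.slice a b) :=
  .of_specialize (by rw [specialize_slice]; exact h.2.slice a b)

theorem selfAvoiding_of_specialize {w : Q.double.Word} (h : (specialize w).SelfAvoiding) :
    w.SelfAvoiding := fun i j hi hj hij =>
  h i j (by rwa [specialize_length]) (by rwa [specialize_length])
    ((specialize_vtx w i).trans (hij.trans (specialize_vtx w j).symm))

/-- The letter of the doubled quiver with the given specialization, and with direction `o`. -/
def liftLetter (o : Bool) (l : Q.Letter) : Q.double.Letter :=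
  (if l.2 = o then Sum.inl l.1 else Sum.inr l.1, o)

theorem specializeLetter_liftLetter (o : Bool) (l : Q.Letter) :
    specializeLetter (liftLetter o l) = l := by
  rcases l with ⟨a, _ | _⟩ <;> cases o <;> rfl

/-- The lift of a word to the doubled quiver whose `j`-th letter has the direction `o j`. -/
def liftWord (o : ℕ → Bool) (w : Q.Word) : Q.double.Word :=
  ⟨w.start, w.letters.mapIdx fun j l => liftLetter (o j) l⟩

theorem liftWord_getElem? (o : ℕ → Bool) (w : Q.Word) (j : ℕ) :
    (liftWord o w).letters[j]? = (w.letters[j]?).map (liftLetter (o j)) := by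
  simp [liftWord]

theorem specialize_liftWord (o : ℕ → Bool) (w : Q.Word) : specialize (liftWord o w) = w := by
  ext1
  · rfl
  · apply List.ext_getElem?
    intro j
    rw [specialize_getElem?, liftWord_getElem?, Option.map_map]
    have : (specializeLetter ∘ liftLetter (o j) : Q.Letter → Q.Letter) = id :=
      funext fun l => specializeLetter_liftLetter _ _
    rw [this, Option.map_id]; rfl

/-- The lift of a word of `Q` to the doubled quiver that involves no dual arrows. -/
def inclWord (w : Q.Word) : Q.double.Word :=
  ⟨w.start, w.letters.map fun l => (Sum.inl l.1, l.2)⟩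

theorem specialize_inclWord (w : Q.Word) : specialize (inclWord w) = w := by
  ext1
  · rfl
  · simp only [inclWord, specialize, List.map_map]
    exact List.map_id _

theorem concat_slice_left (v u : Q.Word) (l : Q.Letter) :
    (Word.concat v l u).slice 0 u.length = u := by
  ext1
  · rfl
  · simp [Word.slice, Word.concat, Word.length]

theorem concat_letter (v u : Q.Word) (l : Q.Letter) :
    (Word.concat v l u).letters[u.length]? = some l := by
  simp [Word.concat, Word.length]

theorem concat_slice_right {v u : Q.Word} {l : Q.Letter} (h : l.tgt = v.start) :
    (Word.concat v l u).slice (u.length + 1) (Word.concat v l u).length = v := by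
  ext1
  · exact (Word.vtx_succ (concat_letter v u l)).trans h
  · have h1 : (Word.concat v l u).length = u.length + 1 + v.length := by
      simp [Word.concat, Word.length]; omega
    have h2 : (Word.concat v l u).letters = (u.letters ++ [l]) ++ v.letters := by
      simp [Word.concat]
    have h3 : (u.letters ++ [l]).length = u.length + 1 := by simp [Word.length]
    rw [Word.slice, h1, h2, ← h3, List.drop_left, h3, Nat.add_sub_cancel_left]
    exact List.take_length

end Lifts

end BoundQuiver

/-! ### Constructing torsion classes -/

theorem finite_of_exact {Λ X Y Z : Type*} [Ring Λ] [AddCommGroup X] [Module Λ X] [AddCommGroup Y]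
    [Module Λ Y] [AddCommGroup Z] [Module Λ Z] (f : X →ₗ[Λ] Y) (g : Y →ₗ[Λ] Z)
    (hg : Function.Surjective g) (h : Function.Exact f g) (hX : Module.Finite Λ X)
    (hZ : Module.Finite Λ Z) : Module.Finite Λ Y := by
  refine ⟨Submodule.fg_of_fg_map_of_fg_inf_ker g ?_ ?_⟩
  · rw [Submodule.map_top, LinearMap.range_eq_top.2 hg]
    exact hZ.1
  · rw [top_inf_eq, h.linearMap_ker_eq, ← Submodule.map_top]
    exact hX.1.map f

theorem IsTorsionClass.of_linearMap {Λ : Type w} [Ring Λ] {T : ObjectProperty (ModuleCat.{w} Λ)}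
    (hfg : T ≤ ModuleCat.isFG Λ) (h0 : ∀ X : ModuleCat.{w} Λ, Subsingleton X → T X)
    (hq : ∀ (X Y : ModuleCat.{w} Λ) (f : X →ₗ[Λ] Y), Function.Surjective f → T X → T Y)
    (he : ∀ (X Y Z : ModuleCat.{w} Λ) (f : X →ₗ[Λ] Y) (g : Y →ₗ[Λ] Z), Function.Injective f →
      Function.Surjective g → Function.Exact f g → T X → T Z → T Y) : IsTorsionClass T where
  le_fg := hfg
  zero := ⟨⟨ModuleCat.of Λ PUnit, ModuleCat.isZero_of_subsingleton _,
    h0 _ (inferInstanceAs (Subsingleton PUnit))⟩⟩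
  quotients := ⟨fun f hf hX => hq _ _ f.hom ((ModuleCat.epi_iff_surjective f).1 hf) hX⟩
  extensions := ⟨fun {S} hS h1 h3 => he _ _ _ S.f.hom S.g.hom hS.moduleCat_injective_f
    hS.moduleCat_surjective_g
    ((ShortComplex.ShortExact.moduleCat_exact_iff_function_exact S).1 hS.exact) h1 h3⟩

namespace BoundQuiver

/-! ### String modules in torsion classes -/

namespace Word

variable {P : BoundQuiver.{v}} {w : P.Word}

theorem IsFactor.trans {a b c d : ℕ} (h : w.IsFactor a b) (h' : (w.slice a b).IsFactor c d) :
    w.IsFactor (a + c) (a + d) := by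
  have hab := h.le
  have hb := h.le_length
  have hd := h'.le_length
  rw [slice_length hb] at hd
  refine ⟨by have := h'.le; omega, by omega, fun e l he hl => ?_, fun l hl => ?_⟩
  · rcases Nat.eq_zero_or_pos c with rfl | hc
    · exact h.left e l he hl
    · have hcd := h'.le
      refine h'.left (c - 1) l (by omega) ?_
      rw [slice_getElem?_of_lt (by omega), ← hl]
      congr 1; omega
  · rcases eq_or_lt_of_le hd with rfl | hd
    · rw [Nat.add_sub_cancel' hab] at hl
      exact h.right l hl
    · exact h'.right l (by rwa [slice_getElem?_of_lt hd])

end Word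

section ContainsString

variable {k : Type u} [Field k] {P : BoundQuiver.{v}}

/-- The string module of `w` belongs to the subcategory `T`. -/
def ContainsString (T : ObjectProperty (ModuleCat.{max u v} (Alg k P))) (w : P.Word) : Prop :=
  ∃ X, IsStringModule k w X ∧ T X

variable {T : ObjectProperty (ModuleCat.{max u v} (Alg k P))} {w : P.Word}

theorem ContainsString.prop (hT : IsTorsionClass T) (h : ContainsString T w)
    {X : ModuleCat.{max u v} (Alg k P)} (hX : IsStringModule k w X) : T X := by
  obtain ⟨Y, hY, hTY⟩ := h
  obtain ⟨e⟩ := hY.nonempty_equiv hX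
  exact hT.of_surjective e.toLinearMap e.surjective hTY

theorem ContainsString.inv (h : ContainsString T w) (hw : w.IsString) :
    ContainsString T w.inv := by
  obtain ⟨Y, hY, hTY⟩ := h
  exact ⟨Y, hY.inv hw, hTY⟩

theorem ContainsString.slice (hT : IsTorsionClass T) (h : ContainsString T w) (hw : w.IsString)
    {a b : ℕ} (hab : w.IsFactor a b) : ContainsString T (w.slice a b) := by
  obtain ⟨X, hX, hTX⟩ := h
  obtain ⟨Y, hY⟩ := exists_isStringModule k (hw.slice a b)
  obtain ⟨f, hf⟩ := hX.exists_surjective_slice hw hab hY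
  exact ⟨Y, hY, hT.of_surjective f hf hTX⟩

theorem ContainsString.of_slices (hT : IsTorsionClass T) (hw : w.IsString) {c : ℕ}
    (hc : c < w.length) (h1 : ContainsString T (w.slice 0 c))
    (h2 : ContainsString T (w.slice (c + 1) w.length)) : ContainsString T w := by
  obtain ⟨Y, hY, hTY⟩ := h1
  obtain ⟨Z, hZ, hTZ⟩ := h2
  obtain ⟨X, hX⟩ := exists_isStringModule k hw
  refine ⟨X, hX, ?_⟩
  obtain ⟨⟨α, ε⟩, hl⟩ := Word.exists_letter hc
  cases ε with
  | true =>
    obtain ⟨s, p, hs, hp, h⟩ := hX.exists_exact_of_direct hw hl hY hZ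
    exact hT.of_exact s p hs hp h hTZ hTY
  | false =>
    obtain ⟨s, p, hs, hp, h⟩ := hX.exists_exact_of_inverse hw hl hY hZ
    exact hT.of_exact s p hs hp h hTY hTZ

end ContainsString

section Shadows

variable {k : Type u} [Field k] {Q : BoundQuiver.{v}}
  {T T' : ObjectProperty (ModuleCat.{max u v} (PiAlg k Q))}

theorem mem_stringsOf {w : Q.Word} : w ∈ stringsOf k T ↔
    w.IsString ∧ ∃ w' : Q.double.Word, specialize w' = w ∧ ContainsString T w' := by
  constructor
  · rintro ⟨w', h, rfl, h'⟩
    exact ⟨h.2, w', rfl, h'⟩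
  · rintro ⟨h, w', rfl, h'⟩
    exact ⟨w', .of_specialize h, rfl, h'⟩

theorem stringsOf_inf_shadowCat : stringsOf k (T ⊓ shadowCat k Q) = stringsOf k T := by
  ext w
  constructor
  · rintro ⟨w', h, hw, X, hX, hTX⟩
    exact ⟨w', h, hw, X, hX, hTX.1⟩
  · rintro ⟨w', h, hw, X, hX, hTX⟩
    exact ⟨w', h, hw, X, hX, hTX, le_addClosure ⟨w', h, hX⟩⟩

theorem stringsOf_mono (h : T ≤ T') : stringsOf k T ⊆ stringsOf k T' := by
  rintro w ⟨w', hw', hw, X, hX, hTX⟩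
  exact ⟨w', hw', hw, X, hX, h X hTX⟩

theorem concat_mem_stringsOf (hT : IsTorsionClass T) {u v : Q.Word} {l : Q.Letter}
    (hu : u ∈ stringsOf k T) (hv : v ∈ stringsOf k T) (hl : l.tgt = v.start)
    (hw : (Word.concat v l u).IsString) : Word.concat v l u ∈ stringsOf k T := by
  obtain ⟨-, u', rfl, hu'⟩ := mem_stringsOf.1 hu
  obtain ⟨-, v', rfl, hv'⟩ := mem_stringsOf.1 hv
  let l' : Q.double.Letter := (Sum.inl l.1, l.2)
  have hl' : specializeLetter l' = l := rfl
  have hspec : specialize (Word.concat v' l' u') =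
      Word.concat (specialize v') l (specialize u') := by
    ext1
    · rfl
    · simp [specialize, Word.concat, hl']
  have htgt : l'.tgt = v'.start := (specializeLetter_tgt l').symm.trans hl
  refine mem_stringsOf.2 ⟨hw, _, hspec, ?_⟩
  have hs : IsLiftedString (Word.concat v' l' u') := .of_specialize (by rwa [hspec])
  refine .of_slices hT hs.1 (c := u'.length) ?_ ?_ ?_
  · exact Word.lt_length (concat_letter v' u' l')
  · rwa [concat_slice_left]
  · rwa [concat_slice_right htgt]

/-- The strings of `A` that occur in a torsion class of `Π(A)` form a biclosed set: the class is closed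
under extensions, and a string `v γ u` always has `u` or `v` as a quotient. -/
theorem isBiclosed_stringsOf (hT : IsTorsionClass T) : IsBiclosed (stringsOf k T) where
  isString w hw := (mem_stringsOf.1 hw).1
  inv_mem w hw := by
    obtain ⟨h, w', rfl, hw'⟩ := mem_stringsOf.1 hw
    exact mem_stringsOf.2 ⟨h.inv, w'.inv, specialize_inv w',
      hw'.inv (IsLiftedString.of_specialize h).1⟩
  closed u hu v hv l _ hl hw := concat_mem_stringsOf hT hu hv hl hw
  coclosed u hu v hv l _ hl hw := by
    refine ⟨hw, fun h => ?_⟩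
    obtain ⟨-, w', hw', h'⟩ := mem_stringsOf.1 h
    have hs : IsLiftedString w' := .of_specialize (by rwa [hw'])
    have hlen : w'.length = (Word.concat v l u).length := by rw [← hw', specialize_length]
    have hlet := concat_letter v u l
    have hc := Word.lt_length hlet
    rw [← hlen] at hc
    obtain ⟨⟨α, ε⟩, hα⟩ := Word.exists_letter hc
    cases ε with
    | true =>
      refine hu.2 (mem_stringsOf.2 ⟨hu.1, w'.slice 0 u.length, ?_, h'.slice hT hs.1
        ⟨Nat.zero_le _, hc.le, fun c _ h0 => absurd h0 (Nat.succ_ne_zero c), fun m hm => ?_⟩⟩)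
      · rw [specialize_slice, hw', concat_slice_left]
      · rw [hα] at hm
        rw [← Option.some_inj.1 hm]
    | false =>
      refine hv.2 (mem_stringsOf.2 ⟨hv.1, w'.slice (u.length + 1) w'.length, ?_, h'.slice hT hs.1
        ⟨hc, le_rfl, fun c m h0 hm => ?_, fun m hm => absurd (Word.lt_length hm) (lt_irrefl _)⟩⟩)
      · rw [specialize_slice, hw', hlen, concat_slice_right hl]
      · obtain rfl : c = u.length := by omega
        rw [hα] at hm
        rw [← Option.some_inj.1 hm]

/-- Two lifts of a word which differ at a position have letters of opposite directions there. -/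
theorem direction_of_ne {w' w'' : Q.double.Word} (h : specialize w'' = specialize w') {j : ℕ}
    (hj : w'.letters[j]? ≠ w''.letters[j]?) :
    (∀ l, w'.letters[j]? = some l → ∀ m, w''.letters[j]? = some m → l.2 = !m.2) ∧
      j < w'.length := by
  have hlen : w''.length = w'.length := by rw [← specialize_length, h, specialize_length]
  constructor
  · intro l hl m hm
    have h2 : specializeLetter l = specializeLetter m := by
      have h3 := congrArg (fun u : Q.Word => u.letters[j]?) h
      simp only [specialize_getElem?, hl, hm, Option.map_some, Option.some_inj] at h3
      exact h3.symm
    have h3 : l.2 ≠ m.2 := fun h4 => hj (by rw [hl, hm, letter_ext h2 h4])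
    rcases l with ⟨l, _ | _⟩ <;> rcases m with ⟨m, _ | _⟩ <;> simp_all
  · by_contra hn
    refine hj ?_
    have h1 : w'.letters[j]? = none := List.getElem?_eq_none (not_lt.1 hn)
    have h2 : w''.letters[j]? = none := List.getElem?_eq_none (not_lt.1 (by
      change ¬ j < w''.length
      rwa [hlen]))
    rw [h1, h2]

/-- Any two lifts `w'` and `w''` of a word share a subword which is a quotient of `w''` and a submodule
of `w'`; the remaining pieces of `w'` are quotients of `w'`. -/
theorem exists_common_slice {w' w'' : Q.double.Word} (h : specialize w'' = specialize w') :
    ∃ a b, w''.IsFactor a b ∧ w''.slice a b = w'.slice a b ∧ b ≤ w'.length ∧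
      (∀ c, c + 1 = a → w'.IsFactor 0 c) ∧ (b < w'.length → w'.IsFactor (b + 1) w'.length) := by
  classical
  have hlen : w''.length = w'.length := by rw [← specialize_length, h, specialize_length]
  have hvtx : ∀ j, w''.vtx j = w'.vtx j := fun j => by
    have h1 := specialize_vtx w'' j
    have h2 := specialize_vtx w' j
    rw [h] at h1
    exact h1.symm.trans h2
  let D : ℕ → Prop := fun j => w'.letters[j]? ≠ w''.letters[j]?
  -- `b` is the first position where the letters differ and that of `w''` points to the right
  have hb : ∃ b, b = w'.length ∨ D b ∧ ∀ m, w''.letters[b]? = some m → m.2 = true :=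
    ⟨_, Or.inl rfl⟩
  let b := Nat.find hb
  have hbn : b ≤ w'.length := Nat.find_min' hb (Or.inl rfl)
  have hbspec : b = w'.length ∨ D b ∧ ∀ m, w''.letters[b]? = some m → m.2 = true :=
    Nat.find_spec hb
  have hbmin : ∀ j < b, ¬ (j = w'.length ∨ D j ∧ ∀ m, w''.letters[j]? = some m → m.2 = true) :=
    fun j hj => Nat.find_min hb hj
  -- `b - c` follows the last position before `b` where the letters differ
  have ha : ∃ c, c ≤ b ∧ (c = b ∨ D (b - c - 1)) := ⟨b, le_rfl, Or.inl rfl⟩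
  obtain ⟨hc1, hc2⟩ := Nat.find_spec ha
  have hcmin : ∀ m < Nat.find ha, ¬ (m ≤ b ∧ (m = b ∨ D (b - m - 1))) :=
    fun m hm => Nat.find_min ha hm
  set c := Nat.find ha with hc
  have hagree : ∀ j, b - c ≤ j → j < b → w'.letters[j]? = w''.letters[j]? := by
    intro j h1 h2
    by_contra hn
    refine hcmin (b - 1 - j) (by omega) ⟨by omega, Or.inr ?_⟩
    rwa [show b - (b - 1 - j) - 1 = j by omega]
  -- by minimality of `b`, the letter of `w''` at the last difference points to the left
  have hleft : ∀ e, e + 1 = b - c → D e ∧ ∀ m, w''.letters[e]? = some m → m.2 = false := by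
    intro e he
    have hD : D e := by
      rcases hc2 with h0 | h0
      · omega
      · rwa [show b - c - 1 = e by omega] at h0
    refine ⟨hD, fun m hm => ?_⟩
    by_contra hm2
    refine hbmin e (by omega) (Or.inr ⟨hD, fun m' hm' => ?_⟩)
    rw [hm] at hm'
    rw [← Option.some_inj.1 hm']
    simpa using hm2
  refine ⟨b - c, b, ⟨by omega, by omega, fun e l he hl => (hleft e he).2 l hl, fun l hl => ?_⟩,
    ?_, hbn, fun e he => ⟨Nat.zero_le _, by omega, fun d _ h0 => absurd h0 (Nat.succ_ne_zero d),
      fun l hl => ?_⟩, fun hbl => ⟨hbl, le_rfl, fun e l he hl => ?_,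
        fun l hl => absurd (Word.lt_length hl) (lt_irrefl _)⟩⟩
  · rcases hbspec with h0 | h0
    · have := Word.lt_length hl
      omega
    · exact h0.2 l hl
  · ext1
    · exact hvtx _
    · apply List.ext_getElem?
      intro j
      rw [Word.slice_getElem?, Word.slice_getElem?]
      split_ifs with hj
      · exact (hagree _ (by omega) (by omega)).symm
      · rfl
  · obtain ⟨m, hm⟩ := Word.exists_letter (w := w'') (j := e) (by omega)
    rw [(direction_of_ne h (hleft e he).1).1 l hl m hm, (hleft e he).2 m hm]
    rfl
  · obtain rfl : e = b := by omega
    obtain ⟨m, hm⟩ := Word.exists_letter (w := w'') (j := b) (by omega)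
    have h0 := hbspec.resolve_left (by omega)
    rw [(direction_of_ne h h0.1).1 l hl m hm, h0.2 m hm]
    rfl

/-- A torsion class of `Π(A)` contains the module of a lifted string as soon as every factor of the
string has some lift, with arbitrary directions, in the class. -/
theorem containsString_of_factors (hT : IsTorsionClass T) {w' : Q.double.Word}
    (hw' : IsLiftedString w')
    (h : ∀ a b, w'.IsFactor a b → specialize (w'.slice a b) ∈ stringsOf k T) :
    ContainsString T w' := by
  induction hn : w'.length using Nat.strong_induction_on generalizing w' with
  | _ n ih =>
    subst hn
    have hself := h _ _ w'.isFactor_self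
    rw [Word.slice_self] at hself
    obtain ⟨-, w'', hspec, hw''⟩ := mem_stringsOf.1 hself
    obtain ⟨a, b, hfac, heq, hb, hl, hr⟩ := exists_common_slice hspec
    have hs'' : IsLiftedString w'' := .of_specialize (by rw [hspec]; exact hw'.2)
    have hmid : ContainsString T (w'.slice a b) := heq ▸ hw''.slice hT hs''.1 hfac
    have hpiece : ∀ c d, w'.IsFactor c d → d - c < w'.length → ContainsString T (w'.slice c d) := by
      intro c d hcd hlt
      refine ih _ ?_ (hw'.slice c d) (fun p q hpq => ?_) rfl
      · rwa [Word.slice_length hcd.le_length]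
      · have h1 := hpq.le_length
        rw [Word.slice_length hcd.le_length] at h1
        have h2 := hcd.le
        rw [Word.slice_slice (by omega) hpq.le hcd.le_length]
        exact h _ _ (hcd.trans hpq)
    have hstep : ContainsString T (w'.slice 0 b) := by
      have hab := hfac.le
      rcases Nat.eq_zero_or_pos a with rfl | ha
      · exact hmid
      · obtain ⟨c, rfl⟩ : ∃ c, a = c + 1 := ⟨a - 1, by omega⟩
        refine .of_slices hT (hw'.1.slice 0 b) (c := c) ?_ ?_ ?_
        · rw [Word.slice_length hb]; omega
        · rw [Word.slice_slice (by omega) (Nat.zero_le _) hb, Nat.zero_add, Nat.zero_add]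
          exact hpiece 0 c (hl c rfl) (by omega)
        · rw [Word.slice_length hb, Word.slice_slice (by omega) (by omega) hb, Nat.zero_add,
            Nat.zero_add]
          exact hmid
    rcases eq_or_lt_of_le hb with rfl | hlt
    · rwa [Word.slice_self] at hstep
    · exact .of_slices hT hw'.1 hlt hstep (hpiece _ _ (hr hlt) (by omega))

/-- In particular, the torsion shadow of a torsion class of `Π(A)` is determined by its strings. -/
theorem inf_shadowCat_le (hsa : ∀ w : Q.Word, w.IsString → w.SelfAvoiding) (hT : IsTorsionClass T)
    (hT' : IsTorsionClass T') (h : stringsOf k T ⊆ stringsOf k T') :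
    T ⊓ shadowCat k Q ≤ T' := by
  rintro X ⟨hTX, hX⟩
  have hX' := addClosure_summands (fun Y hY f hf => by
    obtain ⟨w', hw', hY⟩ := hY
    exact hY.bijective_of_ne_zero (selfAvoiding_of_specialize (hsa _ hw'.2)) f hf)
    (fun Y hY => by obtain ⟨w', hw', hY⟩ := hY; exact hY.length_ne_top) hX
  refine hT'.addClosure_le X (addClosure_mono ?_ hX')
  rintro Y ⟨⟨w', hw', hY⟩, hYX⟩
  have hTY : ContainsString T w' := ⟨Y, hY, hT.of_isSummand hYX hTX⟩
  refine ContainsString.prop hT' (containsString_of_factors hT' hw' fun a b hab => h ?_) hY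
  exact mem_stringsOf.2 ⟨(hw'.slice a b).2, _, rfl, hTY.slice hT hw'.1 hab⟩

/-! ### The torsion class of a biclosed set -/

/-- The modules in `mod Π(A)` such that every quotient which is the module of a lifted string
specializes to a string in `B`. -/
def torsOf (k : Type u) [Field k] (B : Set Q.Word) :
    ObjectProperty (ModuleCat.{max u v} (PiAlg k Q)) :=
  fun X => ModuleCat.isFG (PiAlg k Q) X ∧
    ∀ w' : Q.double.Word, IsLiftedString w' → ∀ Y : ModuleCat.{max u v} (PiAlg k Q),
      IsStringModule k w' Y → ∀ f : X →ₗ[PiAlg k Q] Y, Function.Surjective f → specialize w' ∈ B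

theorem torsOf_mono {B B' : Set Q.Word} (h : B ⊆ B') : torsOf k B ≤ torsOf k B' :=
  fun _ hX => ⟨hX.1, fun w' hw' Y hY f hf => h (hX.2 w' hw' Y hY f hf)⟩

/-- Extensions: the image in `M(w')` of the submodule of an extension is spanned by basis vectors, and
`w'` is the concatenation of strings whose modules are quotients of the submodule or of the quotient. -/
theorem isTorsionClass_torsOf (hsa : ∀ w : Q.Word, w.IsString → w.SelfAvoiding) {B : Set Q.Word}
    (hB : IsClosedSet B) : IsTorsionClass (torsOf k B) := by
  refine .of_linearMap (fun X hX => hX.1) (fun X hX => ⟨?_, fun w' _ Y hY f hf => ?_⟩)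
    (fun X Y f hf hX => ⟨?_, fun w' hw' Z hZ g hg => ?_⟩)
    (fun X Y Z f g hf hg h hX hZ => ⟨?_, fun w' hw' W hW p hp => ?_⟩)
  · exact inferInstanceAs (Module.Finite (PiAlg k Q) X)
  · have := hY.nontrivial
    exact absurd hf.subsingleton (not_subsingleton Y)
  · have : Module.Finite (PiAlg k Q) X := hX.1
    exact Module.Finite.of_surjective f hf
  · exact hX.2 w' hw' Z hZ (g ∘ₗ f) (hg.comp hf)
  · exact finite_of_exact f g hg h hX.1 hZ.1
  · have hsa' := selfAvoiding_of_specialize (hsa _ hw'.2)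
    let N := LinearMap.range (p ∘ₗ f)
    obtain ⟨χ, hχ1, hχ2, -, -⟩ := hW.exists_runs hw'.1 hsa' N
    refine hB.mem_of_runs hw'.2 χ fun a b hr => ?_
    rw [specialize_length] at hr
    rw [← specialize_slice]
    obtain ⟨Y', hY'⟩ := exists_isStringModule k (hw'.1.slice a b)
    by_cases ha : χ a
    · obtain ⟨s, r, hsr⟩ := hχ1 a b hr ha Y' hY'
      exact hX.2 _ (hw'.slice a b) Y' hY' (r ∘ₗ (p ∘ₗ f).rangeRestrict)
        ((Function.RightInverse.surjective (g := s) hsr).comp (p ∘ₗ f).surjective_rangeRestrict)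
    · obtain ⟨s, r, hsr⟩ := hχ2 a b hr ha Y' hY'
      -- the map `Y → W / N` vanishes on the image of `X`, and so factors through `Z`
      let q : Y →ₗ[PiAlg k Q] W ⧸ N := N.mkQ ∘ₗ p
      have hq : LinearMap.ker g ≤ LinearMap.ker q := by
        intro y hy
        obtain ⟨x, rfl⟩ := (h y).1 hy
        exact (Submodule.Quotient.mk_eq_zero N).2 ⟨x, rfl⟩
      let e := g.quotKerEquivOfSurjective hg
      let q' : Z →ₗ[PiAlg k Q] W ⧸ N := (LinearMap.ker g).liftQ q hq ∘ₗ e.symm.toLinearMap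
      have hq' : ∀ y, q' (g y) = q y := by
        intro y
        have : e.symm (g y) = Submodule.Quotient.mk y := by
          rw [LinearEquiv.symm_apply_eq]; rfl
        change (LinearMap.ker g).liftQ q hq (e.symm (g y)) = q y
        rw [this]; rfl
      have hq's : Function.Surjective q' := by
        intro m
        obtain ⟨m, rfl⟩ := N.mkQ_surjective m
        obtain ⟨y, rfl⟩ := hp m
        exact ⟨g y, hq' y⟩
      exact hZ.2 _ (hw'.slice a b) Y' hY' (r ∘ₗ q')
        ((Function.RightInverse.surjective (g := s) hsr).comp hq's)

/-- If a quotient of the module of a self-avoiding string is the module of a self-avoiding string `u`,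
then `u` is, up to inversion, a factor of the string. -/
theorem IsStringModule.exists_factor {P : BoundQuiver.{v}} {w u : P.Word}
    {X Y : ModuleCat.{max u v} (Alg k P)} (hX : IsStringModule k w X) (hw : w.IsString)
    (hws : w.SelfAvoiding) (hY : IsStringModule k u Y) (hu : u.IsString) (hus : u.SelfAvoiding)
    (f : X →ₗ[Alg k P] Y) (hf : Function.Surjective f) :
    ∃ a b, w.IsFactor a b ∧ (u = w.slice a b ∨ u = (w.slice a b).inv) := by
  have hYn := hY.nontrivial
  obtain ⟨χ, -, hχ2, hχ3, hχ4⟩ := hX.exists_runs hw hws (LinearMap.ker f)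
  obtain ⟨j, hj, hjχ⟩ := hχ4 (fun h => by
    obtain ⟨y, hy⟩ := exists_ne (0 : Y)
    obtain ⟨x, rfl⟩ := hf y
    exact hy (LinearMap.congr_fun (LinearMap.ker_eq_top.1 h) x))
  obtain ⟨a, b, haj, hjb, hr⟩ := exists_run χ hj
  have ha : ¬ χ a := fun h => hjχ ((hr.const j haj hjb).2 h)
  have hb : ¬ χ b := fun h => ha ((hr.const b hr.le le_rfl).1 h)
  refine ⟨a, b, ⟨hr.le, hr.le_length, ?_, ?_⟩, ?_⟩
  · rintro c ⟨α, ε⟩ rfl hl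
    have hc : χ c := by
      have := hr.left (Nat.succ_ne_zero c)
      rw [Nat.add_sub_cancel] at this
      tauto
    cases ε with
    | false => rfl
    | true => exact absurd (hχ3 α c (c + 1) (Or.inl ⟨rfl, hl⟩) hc) ha
  · rintro ⟨α, ε⟩ hl
    have hc : χ (b + 1) := by
      have := hr.right (Word.lt_length hl).ne
      tauto
    cases ε with
    | true => rfl
    | false => exact absurd (hχ3 α (b + 1) b (Or.inr ⟨rfl, hl⟩) hc) hb
  · obtain ⟨Z, hZ⟩ := exists_isStringModule k (hw.slice a b)
    have hZn := hZ.nontrivial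
    have hs := (hχ2 a b hr ha Z hZ).trans
      (IsSummand.of_equiv (f.quotKerEquivOfSurjective hf))
    obtain ⟨e⟩ := bijective_of_isSummand (hY.bijective_of_ne_zero hus) hs
    exact hY.eq_or_eq_inv (hZ.of_equiv e) hu (hw.slice a b) hus (hws.slice hr.le hr.le_length)

/-- Consider the lift of `w ∈ B` whose `j`-th letter points to the right if and only if the subword of
`w` on `[0, j]` belongs to `B`. As `B` is biclosed, all factors of this lift specialize into `B`, so the
module of the lift belongs to `torsOf k B`. -/
theorem stringsOf_torsOf (hsa : ∀ w : Q.Word, w.IsString → w.SelfAvoiding) {B : Set Q.Word}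
    (hB : IsBiclosed B) : stringsOf k (torsOf k B) = B := by
  classical
  ext w
  constructor
  · rintro ⟨w', hw', rfl, X, hX, hT⟩
    exact hT.2 w' hw' X hX LinearMap.id Function.surjective_id
  · intro hwB
    have hw := hB.isString w hwB
    let w' := liftWord (fun j => decide (w.slice 0 j ∈ B)) w
    have hspec : specialize w' = w := specialize_liftWord _ w
    have hw' : IsLiftedString w' := .of_specialize (by rwa [hspec])
    have hlen : w'.length = w.length := by rw [← specialize_length, hspec]
    have hlet : ∀ j l, w'.letters[j]? = some l → l.2 = decide (w.slice 0 j ∈ B) := by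
      intro j l hl
      have h1 : w'.letters[j]? = _ := liftWord_getElem? _ w j
      rw [hl] at h1
      obtain ⟨m, -, hm⟩ := Option.map_eq_some_iff.1 h1.symm
      rw [← hm]; rfl
    have hsa' := selfAvoiding_of_specialize (hsa _ hw'.2)
    obtain ⟨X, hX⟩ := exists_isStringModule k hw'.1
    refine ⟨w', hw', hspec, X, hX, hX.isFG, fun u hu Y hY f hf => ?_⟩
    obtain ⟨a, b, hab, huw⟩ := hX.exists_factor hw'.1 hsa' hY hu.1
      (selfAvoiding_of_specialize (hsa _ hu.2)) f hf
    have hbn := hab.le_length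
    rw [hlen] at hbn
    have hab' := hab.le
    have hb : w.slice 0 b ∈ B := by
      rcases eq_or_lt_of_le hbn with rfl | hb
      · rwa [Word.slice_self]
      · obtain ⟨l, hl⟩ := Word.exists_letter (w := w') (j := b) (by omega)
        have := hab.right l hl
        rw [hlet b l hl] at this
        simpa using this
    -- the subword on `[0, b]` is in `B` and the subword on `[0, a - 1]` is not, so the one on `[a, b]` is
    have key : w.slice a b ∈ B := by
      rcases Nat.eq_zero_or_pos a with rfl | ha
      · exact hb
      · obtain ⟨c, rfl⟩ : ∃ c, a = c + 1 := ⟨a - 1, by omega⟩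
        obtain ⟨l', hl'⟩ := Word.exists_letter (w := w') (j := c) (by omega)
        have hc : w.slice 0 c ∉ B := by
          have := hab.left c l' rfl hl'
          rw [hlet c l' hl'] at this
          simpa using this
        by_contra hn
        obtain ⟨l, hl⟩ := Word.exists_letter (w := w) (j := c) (by omega)
        have hcat := Word.slice_concat (w := w) (Nat.zero_le c) (show c < b by omega) hl
        refine (hB.coclosed (w.slice 0 c) ⟨hw.slice _ _, hc⟩ (w.slice (c + 1) b)
          ⟨hw.slice _ _, hn⟩ l ?_ ?_ ?_).2 ?_
        · rw [Word.slice_finish (Nat.zero_le _) (by omega), hw.vtx_eq hl]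
        · exact (Word.vtx_succ hl).symm
        · rw [hcat]; exact hw.slice _ _
        · rwa [hcat]
    rcases huw with rfl | rfl
    · rwa [specialize_slice, hspec]
    · rw [specialize_inv, specialize_slice, hspec]
      exact hB.inv_mem _ key

end Shadows

end BoundQuiver

/-! ### Complete lattices of torsion shadows -/

/-- The infimum of a set of torsion shadows is the shadow of the intersection of all torsion classes
whose shadow belongs to the set. The condition of finite generation matters for the empty set. -/
theorem exists_isGLB_torsionShadow {Λ : Type w} [Ring Λ] (M : ObjectProperty (ModuleCat.{w} Λ))
    (s : Set (TorsionShadow M)) : ∃ S, IsGLB s S := by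
  let T : ObjectProperty (ModuleCat.{w} Λ) := fun X => ModuleCat.isFG Λ X ∧
    ∀ (T : ObjectProperty (ModuleCat.{w} Λ)) (hT : IsTorsionClass T),
      (⟨T ⊓ M, T, hT, rfl⟩ : TorsionShadow M) ∈ s → T X
  have hT : IsTorsionClass T := by
    refine .of_linearMap (fun X hX => hX.1)
      (fun X hX => ⟨inferInstanceAs (Module.Finite Λ X), fun T hT _ => hT.of_subsingleton X⟩)
      (fun X Y f hf hX => ⟨?_, fun T hT h => hT.of_surjective f hf (hX.2 T hT h)⟩)
      (fun X Y Z f g hf hg h hX hZ => ⟨finite_of_exact f g hg h hX.1 hZ.1,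
        fun T hT h' => hT.of_exact f g hf hg h (hX.2 T hT h') (hZ.2 T hT h')⟩)
    have : Module.Finite Λ X := hX.1
    exact Module.Finite.of_surjective f hf
  refine ⟨⟨T ⊓ M, T, hT, rfl⟩, fun S hS => ?_, fun S hS X hX => ?_⟩
  · obtain ⟨S, T', hT', rfl⟩ := S
    exact fun X hX => ⟨hX.1.2 T' hT' hS, hX.2⟩
  · obtain ⟨S, T', hT', rfl⟩ := S
    exact ⟨⟨hT'.le_fg X hX.1, fun T'' hT'' h => (hS h X hX).1⟩, hX.2⟩

theorem exists_isLUB_of_exists_isGLB {α : Type*} [Preorder α]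
    (h : ∀ s : Set α, ∃ a, IsGLB s a) (s : Set α) : ∃ a, IsLUB s a := by
  obtain ⟨a, ha⟩ := h (upperBounds s)
  exact ⟨a, isGLB_upperBounds.1 ha⟩

/-! ### Biclosed subcategories -/

theorem addClosure_le_isFG {Λ : Type w} [Ring Λ] {P : ObjectProperty (ModuleCat.{w} Λ)}
    (h : P ≤ ModuleCat.isFG Λ) : addClosure P ≤ ModuleCat.isFG Λ := by
  intro X hX
  obtain ⟨n, Y, hY, s, p, hsp⟩ := addClosure_iff.1 hX
  have : ∀ i, Module.Finite Λ (Y i) := fun i => h _ (hY i)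
  exact Module.Finite.of_surjective p (Function.RightInverse.surjective hsp)

section Complement

variable {Λ : Type w} [Ring Λ] {C : ObjectProperty (ModuleCat.{w} Λ)}

/-- On modules all of whose nonzero endomorphisms are bijective, the complement of an additive
subcategory is the logical complement. -/
theorem complementSubcategory_iff (hC : addClosure C ≤ C) {X : ModuleCat.{w} Λ}
    (hfg : ModuleCat.isFG Λ X) [Nontrivial X]
    (hX : ∀ f : X →ₗ[Λ] X, f ≠ 0 → Function.Bijective f)
    (hlen : Module.length Λ X ≠ ⊤) : complementSubcategory C X ↔ ¬ C X := by
  constructor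
  · intro h hCX
    exact not_subsingleton X (ModuleCat.subsingleton_of_isZero (h.2 X (le_addClosure rfl) hCX))
  · refine fun h => ⟨hfg, fun Y hY hCY => ?_⟩
    rcases subsingleton_or_nontrivial Y with hs | hs
    · exact ModuleCat.isZero_of_subsingleton Y
    have := addClosure_summands (P := fun Z => Z = X) (fun Z hZ => by subst hZ; exact hX)
      (fun Z hZ => by subst hZ; exact hlen) hY
    obtain ⟨n, Z, hZ, s, p, hsp⟩ := addClosure_iff.1 this
    cases n with
    | zero =>
      obtain ⟨y, hy⟩ := exists_ne (0 : Y)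
      refine absurd ?_ hy
      rw [← hsp y, Subsingleton.elim (s y) 0, map_zero]
    | succ n =>
      obtain ⟨h1, h2⟩ := hZ 0
      rw [h1] at h2
      exact absurd (hC X (addClosure_of_isSummand (le_addClosure hCY) h2)) h

end Complement

namespace BoundQuiver

section AddStrings

variable {k : Type u} [Field k] {Q : BoundQuiver.{v}} {B : Set Q.Word}
  {X Y : ModuleCat.{max u v} (Alg k Q)}

theorem IsStringModule.complementSubcategory_iff {C : ObjectProperty (ModuleCat.{max u v} (Alg k Q))}
    (hC : addClosure C ≤ C) {w : Q.Word} (hX : IsStringModule k w X) (hsa : w.SelfAvoiding) :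
    complementSubcategory C X ↔ ¬ C X := by
  have := hX.nontrivial
  exact _root_.complementSubcategory_iff hC hX.isFG (hX.bijective_of_ne_zero hsa) hX.length_ne_top

theorem addStrings_summands (hsa : ∀ w ∈ B, w.SelfAvoiding) (hX : addStrings k B X) :
    addClosure (fun Y => (∃ w ∈ B, IsStringModule k w Y) ∧ IsSummand (Alg k Q) Y X) X :=
  addClosure_summands (fun Y hY f hf => by
    obtain ⟨w, hw, hY⟩ := hY
    exact hY.bijective_of_ne_zero (hsa w hw) f hf)
    (fun Y hY => by obtain ⟨w, hw, hY⟩ := hY; exact hY.length_ne_top) hX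

theorem exists_isStringModule_of_indecomposable (hsa : ∀ w ∈ B, w.SelfAvoiding)
    (hX : addStrings k B X) (hi : Indecomposable X) : ∃ w ∈ B, IsStringModule k w X := by
  have := nontrivial_of_indecomposable hi
  obtain ⟨n, Y, hY, s, p, hsp⟩ := addClosure_iff.1 (addStrings_summands hsa hX)
  cases n with
  | zero =>
    obtain ⟨y, hy⟩ := exists_ne (0 : X)
    refine absurd ?_ hy
    rw [← hsp y, Subsingleton.elim (s y) 0, map_zero]
  | succ n =>
    obtain ⟨⟨w, hw, h1⟩, h2⟩ := hY 0
    have := h1.nontrivial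
    obtain ⟨e⟩ := nonempty_equiv_of_indecomposable hi h2
    exact ⟨w, hw, h1.of_equiv e⟩

theorem exists_isStringModule_of_finite (hQ : Q.IsGentle k)
    (hsa : ∀ w : Q.Word, w.IsString → w.SelfAvoiding) (hX : ModuleCat.isFG (Alg k Q) X)
    (hi : Indecomposable X) : ∃ w : Q.Word, w.IsString ∧ IsStringModule k w X :=
  exists_isStringModule_of_indecomposable (B := {w | w.IsString}) hsa
    (addStrings_of_finite hQ hsa hX) hi

/-- A Krull–Schmidt statement: up to inversion, `w` is determined by `M(w)`, and `M(w)` is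
indecomposable. -/
theorem mem_of_addStrings (hs : ∀ w ∈ B, w.IsString) (hsa : ∀ w : Q.Word, w.IsString → w.SelfAvoiding)
    (hinv : ∀ w ∈ B, w.inv ∈ B) {w : Q.Word} (hw : w.IsString) (hX : IsStringModule k w X)
    (h : addStrings k B X) : w ∈ B := by
  obtain ⟨u, hu, hXu⟩ := exists_isStringModule_of_indecomposable (fun w hw => hsa w (hs w hw)) h
    (hX.indecomposable (hsa w hw))
  rcases hX.eq_or_eq_inv hXu hw (hs u hu) (hsa w hw) (hsa u (hs u hu)) with rfl | rfl
  · exact hu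
  · exact hinv u hu

/-- If `B` is closed, then `add (⨁ M(w) | w ∈ B)` is weakly extension-closed: the middle term of a
short exact sequence is a string module, and its string is the concatenation of strings whose modules
are direct summands of the outer terms. -/
theorem isWeaklyExtensionClosed_addStrings (hQ : Q.IsGentle k)
    (hsa : ∀ w : Q.Word, w.IsString → w.SelfAvoiding) (hs : ∀ w ∈ B, w.IsString)
    (hinv : ∀ w ∈ B, w.inv ∈ B) (hB : IsClosedSet B) :
    IsWeaklyExtensionClosed (addStrings k B) := by
  intro S hS hf1 hf2 hf3 hi1 hi2 hi3 h1 h3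
  obtain ⟨w, hw, hX⟩ := exists_isStringModule_of_finite hQ hsa hf2 hi2
  refine le_addClosure ⟨w, ?_, hX⟩
  let f := S.f.hom
  let g := S.g.hom
  have hf : Function.Injective f := hS.moduleCat_injective_f
  have hg : Function.Surjective g := hS.moduleCat_surjective_g
  have hfg : Function.Exact f g :=
    (ShortComplex.ShortExact.moduleCat_exact_iff_function_exact S).1 hS.exact
  obtain ⟨χ, hχ1, hχ2, -, -⟩ := hX.exists_runs hw (hsa w hw) (LinearMap.range f)
  refine hB.mem_of_runs hw χ fun a b hr => ?_
  obtain ⟨Y, hY⟩ := exists_isStringModule k (hw.slice a b)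
  refine mem_of_addStrings hs hsa hinv (hw.slice a b) hY ?_
  by_cases ha : χ a
  · exact addClosure_of_isSummand h1 ((hχ1 a b hr ha Y hY).trans
      (IsSummand.of_equiv (LinearEquiv.ofInjective f hf).symm))
  · refine addClosure_of_isSummand h3 ((hχ2 a b hr ha Y hY).trans (IsSummand.of_equiv ?_))
    exact (Submodule.quotEquivOfEq _ _ hfg.linearMap_ker_eq.symm).trans
      (g.quotKerEquivOfSurjective hg)

theorem isBiclosedSubcategory_addStrings (hQ : Q.IsGentle k)
    (hsa : ∀ w : Q.Word, w.IsString → w.SelfAvoiding) (hB : IsBiclosed B) :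
    IsBiclosedSubcategory (addStrings k B) where
  le_fg := addClosure_le_isFG fun X hX => by
    obtain ⟨w, -, hX⟩ := hX
    exact hX.isFG
  additive := addClosure_addClosure
  closed := isWeaklyExtensionClosed_addStrings hQ hsa hB.isString hB.inv_mem hB.closed
  coclosed := by
    intro S hS hf1 hf2 hf3 hi1 hi2 hi3 h1 h3
    have hmem : ∀ X : ModuleCat.{max u v} (Alg k Q), ModuleCat.isFG (Alg k Q) X →
        Indecomposable X →
        (complementSubcategory (addStrings k B) X ↔ addStrings k {w | w.IsString ∧ w ∉ B} X) := by
      intro X hf hi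
      obtain ⟨w, hw, hX⟩ := exists_isStringModule_of_finite hQ hsa hf hi
      rw [hX.complementSubcategory_iff (C := addStrings k B) addClosure_addClosure (hsa w hw)]
      constructor
      · exact fun h => le_addClosure ⟨w, ⟨hw, fun hwB => h (le_addClosure ⟨w, hwB, hX⟩)⟩, hX⟩
      · intro h h'
        obtain ⟨u, hu, hXu⟩ := exists_isStringModule_of_indecomposable
          (fun w hw => hsa w hw.1) h hi
        exact hu.2 (mem_of_addStrings hB.isString hsa hB.inv_mem hu.1 hXu h')
    rw [hmem _ hf1 hi1] at h1
    rw [hmem _ hf3 hi3] at h3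
    rw [hmem _ hf2 hi2]
    refine isWeaklyExtensionClosed_addStrings (B := {w | w.IsString ∧ w ∉ B}) hQ hsa
      (fun w hw => hw.1)
      (fun w hw => ⟨hw.1.inv, fun h => hw.2 ?_⟩) hB.coclosed S hS hf1 hf2 hf3 hi1 hi2 hi3 h1 h3
    rw [← hw.1.inv_inv]
    exact hB.inv_mem _ h

/-- A string `v γ^{±1} u` gives a short exact sequence of the indecomposable modules `M(u)`, `M(v)` and
`M(v γ^{±1} u)`. -/
theorem isClosedSet_of_isWeaklyExtensionClosed {C : ObjectProperty (ModuleCat.{max u v} (Alg k Q))}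
    (hsa : ∀ w : Q.Word, w.IsString → w.SelfAvoiding) (hC : IsWeaklyExtensionClosed C) :
    IsClosedSet {w : Q.Word | w.IsString ∧
      ∀ X : ModuleCat.{max u v} (Alg k Q), IsStringModule k w X → C X} := by
  intro u hu v hv l _ hl hw
  refine ⟨hw, fun X hX => ?_⟩
  obtain ⟨Y, hY⟩ := exists_isStringModule k hu.1
  obtain ⟨Z, hZ⟩ := exists_isStringModule k hv.1
  have hY' := hY
  have hZ' := hZ
  rw [← concat_slice_left v u l] at hY'
  rw [← concat_slice_right (u := u) hl] at hZ'
  have hlet := concat_letter v u l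
  have key : ∀ (Y Z : ModuleCat.{max u v} (Alg k Q)) (s : Y →ₗ[Alg k Q] X) (p : X →ₗ[Alg k Q] Z),
      Function.Injective s → Function.Surjective p → Function.Exact s p →
      ModuleCat.isFG (Alg k Q) Y → ModuleCat.isFG (Alg k Q) Z → Indecomposable Y →
      Indecomposable Z → C Y → C Z → C X := by
    intro Y Z s p hs hp h hfY hfZ hiY hiZ hCY hCZ
    let S : ShortComplex (ModuleCat.{max u v} (Alg k Q)) :=
      ShortComplex.mk (ModuleCat.ofHom s) (ModuleCat.ofHom p)
        (by ext x; exact (h (s x)).2 ⟨x, rfl⟩)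
    have hS : S.ShortExact := ModuleCat.shortComplex_shortExact S h hs hp
    exact hC S hS hfY hX.isFG hfZ hiY (hX.indecomposable (hsa _ hw)) hiZ hCY hCZ
  have hiY := hY.indecomposable (hsa u hu.1)
  have hiZ := hZ.indecomposable (hsa v hv.1)
  rcases l with ⟨α, _ | _⟩
  · obtain ⟨s, p, hs, hp, h⟩ := hX.exists_exact_of_inverse hw hlet hY' hZ'
    exact key Y Z s p hs hp h hY.isFG hZ.isFG hiY hiZ (hu.2 Y hY) (hv.2 Z hZ)
  · obtain ⟨s, p, hs, hp, h⟩ := hX.exists_exact_of_direct hw hlet hY' hZ'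
    exact key Z Y s p hs hp h hZ.isFG hY.isFG hiZ hiY (hv.2 Z hZ) (hu.2 Y hY)

/-- The biclosed subcategories of `mod A` are the subcategories `add (⨁ M(w) | w ∈ B)` with `B` a
biclosed set of strings. -/
theorem exists_isBiclosed_of_subcategory (hQ : Q.IsGentle k)
    (hsa : ∀ w : Q.Word, w.IsString → w.SelfAvoiding)
    {C : ObjectProperty (ModuleCat.{max u v} (Alg k Q))} (hC : IsBiclosedSubcategory C) :
    ∃ B : Set Q.Word, IsBiclosed B ∧ C = addStrings k B := by
  have hsum : ∀ {X Y : ModuleCat.{max u v} (Alg k Q)}, IsSummand (Alg k Q) Y X → C X → C Y :=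
    fun h hX => hC.additive _ (addClosure_of_isSummand (le_addClosure hX) h)
  have hiff : ∀ {w : Q.Word} {X : ModuleCat.{max u v} (Alg k Q)}, IsStringModule k w X → C X →
      ∀ Y : ModuleCat.{max u v} (Alg k Q), IsStringModule k w Y → C Y := by
    intro w X hX hCX Y hY
    obtain ⟨e⟩ := hY.nonempty_equiv hX
    exact hsum (IsSummand.of_equiv e) hCX
  let B : Set Q.Word := {w | w.IsString ∧
    ∀ X : ModuleCat.{max u v} (Alg k Q), IsStringModule k w X → C X}
  have hcompl : {w : Q.Word | w.IsString ∧ w ∉ B} = {w : Q.Word | w.IsString ∧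
      ∀ X : ModuleCat.{max u v} (Alg k Q), IsStringModule k w X → complementSubcategory C X} := by
    ext w
    refine and_congr_right fun hw => ⟨fun h X hX => ?_, fun h h' => ?_⟩
    · rw [hX.complementSubcategory_iff hC.additive (hsa w hw)]
      exact fun hCX => h ⟨hw, hiff hX hCX⟩
    · obtain ⟨X, hX⟩ := exists_isStringModule k hw
      exact (hX.complementSubcategory_iff hC.additive (hsa w hw)).1 (h X hX) (h'.2 X hX)
  refine ⟨B, ⟨fun w hw => hw.1, fun w hw => ⟨hw.1.inv, fun X hX => ?_⟩,
    isClosedSet_of_isWeaklyExtensionClosed hsa hC.closed, ?_⟩, ?_⟩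
  · have := hX.inv hw.1.inv
    rw [hw.1.inv_inv] at this
    exact hw.2 X this
  · rw [hcompl]
    exact isClosedSet_of_isWeaklyExtensionClosed hsa hC.coclosed
  · refine le_antisymm (fun X hX => ?_) (fun X hX => hC.additive X (addClosure_mono ?_ hX))
    · refine addClosure_mono ?_ (addStrings_summands hsa
        (addStrings_of_finite hQ hsa (hC.le_fg X hX)))
      rintro Y ⟨⟨w, hw, hY⟩, hYX⟩
      exact ⟨w, ⟨hw, hiff hY (hsum hYX hX)⟩, hY⟩
    · rintro Y ⟨w, hw, hY⟩
      exact hw.2 Y hY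

end AddStrings

end BoundQuiver

namespace BoundQuiver

/-! ### Restriction along the projection `Π(A) → A` -/

section Restriction

variable {k : Type u} [Field k] {Q : BoundQuiver.{v}}

theorem proj_idemp (i : Q.V) : proj k Q (idemp k Q.double i) = idemp k Q i := by
  simp [proj, idemp, projGen]

theorem proj_arrow_inl (α : Q.E) : proj k Q (arrow k Q.double (Sum.inl α)) = arrow k Q α := by
  simp [proj, arrow, projGen]

theorem proj_arrow_inr (α : Q.E) : proj k Q (arrow k Q.double (Sum.inr α)) = 0 := by
  simp [proj, arrow, projGen]

theorem proj_surjective : Function.Surjective (proj k Q) := by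
  intro a
  refine alg_induction (p := fun a => ∃ b, proj k Q b = a) ?_ ?_ ?_ ?_ ?_ a
  · exact fun c => ⟨algebraMap k _ c, AlgHom.commutes _ c⟩
  · exact fun i => ⟨_, proj_idemp i⟩
  · exact fun α => ⟨_, proj_arrow_inl α⟩
  · rintro _ _ ⟨a, rfl⟩ ⟨b, rfl⟩
    exact ⟨a * b, map_mul _ a b⟩
  · rintro _ _ ⟨a, rfl⟩ ⟨b, rfl⟩
    exact ⟨a + b, map_add _ a b⟩

variable (k Q) in
/-- The embedding of `Mod A` into `Mod Π(A)`. -/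
noncomputable abbrev resProj : ModuleCat.{max u v} (Alg k Q) ⥤ ModuleCat.{max u v} (PiAlg k Q) :=
  ModuleCat.restrictScalars (proj k Q : PiAlg k Q →+* Alg k Q)

variable {X Y Z : ModuleCat.{max u v} (Alg k Q)}

theorem resProj_smul (a : PiAlg k Q) (x : (resProj k Q).obj X) :
    a • x = (show X from proj k Q a • (show X from x)) := rfl

/-- A homomorphism of `A`-modules, regarded as a homomorphism of `Π(A)`-modules. -/
noncomputable def resMap (f : X →ₗ[Alg k Q] Y) :
    (resProj k Q).obj X →ₗ[PiAlg k Q] (resProj k Q).obj Y :=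
  ((resProj k Q).map (ModuleCat.ofHom f)).hom

/-- A homomorphism of `Π(A)`-modules between `A`-modules is `A`-linear. -/
noncomputable def unresMap (f : (resProj k Q).obj X →ₗ[PiAlg k Q] (resProj k Q).obj Y) :
    X →ₗ[Alg k Q] Y where
  toFun x := f x
  map_add' x y := f.map_add x y
  map_smul' a x := by
    obtain ⟨b, rfl⟩ := proj_surjective a
    exact f.map_smul b x

theorem isTorsionClass_interMod {T : ObjectProperty (ModuleCat.{max u v} (PiAlg k Q))}
    (hT : IsTorsionClass T) : IsTorsionClass (interMod k Q T) := by
  refine .of_linearMap (fun X hX => hX.1)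
    (fun X hX => ⟨inferInstanceAs (Module.Finite (Alg k Q) X), ?_⟩)
    (fun X Y f hf hX => ⟨?_, ?_⟩)
    (fun X Y Z f g hf hg h hX hZ => ⟨finite_of_exact f g hg h hX.1 hZ.1, ?_⟩)
  · have : Subsingleton ((resProj k Q).obj X) := hX
    exact hT.of_subsingleton _
  · have : Module.Finite (Alg k Q) X := hX.1
    exact Module.Finite.of_surjective f hf
  · exact hT.of_surjective (resMap f) hf hX.2
  · exact hT.of_exact (resMap f) (resMap g) hf hg h hX.2 hZ.2

theorem inclWord_getElem?_eq_some {w : Q.Word} {j : ℕ} {l : Q.double.Letter} :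
    (inclWord w).letters[j]? = some l ↔
      ∃ m, w.letters[j]? = some m ∧ l = (Sum.inl m.1, m.2) := by
  have : (inclWord w).letters[j]? =
      (w.letters[j]?).map fun m => ((Sum.inl m.1, m.2) : Q.double.Letter) := List.getElem?_map
  rw [this, Option.map_eq_some_iff]
  exact exists_congr fun m => and_congr_right fun _ => eq_comm

theorem inclWord_arr_inl {w : Q.Word} {α : Q.E} {j i : ℕ} :
    (inclWord w).Arr (Sum.inl α) j i ↔ w.Arr α j i := by
  have h : ∀ (c : ℕ) (ε : Bool),
      (inclWord w).letters[c]? = some ((Sum.inl α, ε) : Q.double.Letter) ↔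
      w.letters[c]? = some (α, ε) := by
    intro c ε
    rw [inclWord_getElem?_eq_some]
    constructor
    · rintro ⟨⟨β, δ⟩, h, h'⟩
      cases h'
      exact h
    · exact fun h => ⟨_, h, rfl⟩
  exact or_congr (and_congr_right fun _ => h _ _) (and_congr_right fun _ => h _ _)

theorem not_inclWord_arr_inr {w : Q.Word} {α : Q.E} {j i : ℕ} :
    ¬ (inclWord w).Arr (Sum.inr α) j i := by
  have h : ∀ (c : ℕ) (ε : Bool),
      (inclWord w).letters[c]? ≠ some ((Sum.inr α, ε) : Q.double.Letter) := by
    intro c ε h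
    obtain ⟨⟨β, δ⟩, -, h'⟩ := inclWord_getElem?_eq_some.1 h
    cases h'
  rintro (⟨-, h'⟩ | ⟨-, h'⟩)
  · exact h _ _ h'
  · exact h _ _ h'

theorem IsStringBasis.inclWord {w : Q.Word} {X Y : Type*} [AddCommGroup X] [Module k X]
    [Module (Alg k Q) X] [IsScalarTower k (Alg k Q) X] [AddCommGroup Y] [Module k Y]
    [Module (PiAlg k Q) Y] [IsScalarTower k (PiAlg k Q) Y]
    {x : Module.Basis (Fin (w.length + 1)) k X} (hx : IsStringBasis w x) (e : X ≃ₗ[k] Y)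
    (he : ∀ (a : PiAlg k Q) (z : X), a • e z = e (proj k Q a • z)) :
    ∃ y : Module.Basis (Fin ((inclWord w).length + 1)) k Y, IsStringBasis (inclWord w) y := by
  have hlen : (BoundQuiver.inclWord w).length = w.length := by
    simp [BoundQuiver.inclWord, Word.length]
  have hvtx : ∀ j, (BoundQuiver.inclWord w).vtx j = w.vtx j := fun j => by
    have := specialize_vtx (BoundQuiver.inclWord w) j
    rw [specialize_inclWord] at this
    exact this.symm
  let y := (x.map e).reindex (finCongr (by rw [hlen] :
    w.length + 1 = (BoundQuiver.inclWord w).length + 1))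
  have hy : ∀ j, bvec y j = e (bvec x j) := by
    intro j
    rcases lt_or_ge w.length j with hj | hj
    · rw [bvec_of_lt _ (by rwa [hlen]), bvec_of_lt _ hj, map_zero]
    · rw [bvec_of_le _ (by rwa [hlen]), bvec_of_le _ hj]
      simp [y]
  refine ⟨y, fun j i => ?_, fun {α j i} h => ?_, fun {α j} h => ?_⟩
  · have h1 := (he (idemp k Q.double i) (bvec x j)).trans
      ((congrArg (fun a => e (a • bvec x j)) (proj_idemp (Q := Q) i)).trans
        (congrArg e (hx.idemp_smul j i)))
    rw [hy]
    refine h1.trans ?_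
    rw [apply_ite e, map_zero, ← hvtx j]
    rfl
  · rcases α with α | α
    · rw [hy, hy, he, proj_arrow_inl, hx.arrow_smul (inclWord_arr_inl.1 h)]
    · exact absurd h not_inclWord_arr_inr
  · rcases α with α | α
    · rw [hy, he, proj_arrow_inl, hx.arrow_smul_zero fun i hi => h i (inclWord_arr_inl.2 hi),
        map_zero]
    · rw [hy, he, proj_arrow_inr, zero_smul, map_zero]

theorem IsStringModule.inclWord {w : Q.Word} {Y : ModuleCat.{max u v} (PiAlg k Q)}
    (hX : IsStringModule k w X) (e : X ≃+ Y)
    (he : ∀ (a : PiAlg k Q) (z : X), a • e z = e (proj k Q a • z)) :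
    IsStringModule k (inclWord w) Y := by
  obtain ⟨_, _, x, hx⟩ := hX.exists_basis
  let _ : Module k Y := Module.compHom Y (algebraMap k (PiAlg k Q))
  have : IsScalarTower k (PiAlg k Q) Y := IsScalarTower.of_algebraMap_smul fun c z => rfl
  let e' : X ≃ₗ[k] Y :=
    { e with
      map_smul' := fun c z => by
        change e (c • z) = algebraMap k (PiAlg k Q) c • e z
        rw [he, AlgHom.commutes, algebraMap_smul] }
  obtain ⟨y, hy⟩ := hx.inclWord e' he
  exact isStringModule_of_basis hy

theorem IsStringModule.resProj {w : Q.Word} (hX : IsStringModule k w X) :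
    IsStringModule k (BoundQuiver.inclWord w) ((resProj k Q).obj X) :=
  hX.inclWord (AddEquiv.refl X) fun _ _ => rfl

theorem isLiftedString_inclWord {w : Q.Word} (hw : w.IsString) : IsLiftedString (inclWord w) :=
  .of_specialize (by rwa [specialize_inclWord])

/-- All modules in `mod A` belong to the subcategory `M` of `mod Π(A)`, by the classification. -/
theorem shadowCat_resProj (hQ : Q.IsGentle k) (hsa : ∀ w : Q.Word, w.IsString → w.SelfAvoiding)
    (hX : ModuleCat.isFG (Alg k Q) X) : shadowCat k Q ((resProj k Q).obj X) := by
  obtain ⟨n, Y, hY, s, p, hsp⟩ := addClosure_iff.1 (addStrings_of_finite hQ hsa hX)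
  refine addClosure_iff.2 ⟨n, fun i => (resProj k Q).obj (Y i), fun i => ?_, ?_⟩
  · obtain ⟨w, hw, hYw⟩ := hY i
    exact ⟨inclWord w, isLiftedString_inclWord hw, hYw.resProj⟩
  · exact ⟨{ toFun := fun x => s x
             map_add' := s.map_add
             map_smul' := fun a x => s.map_smul (proj k Q a) x },
           { toFun := fun x => p x
             map_add' := p.map_add
             map_smul' := fun a x => p.map_smul (proj k Q a) x }, hsp⟩

theorem interMod_inf_shadowCat (hQ : Q.IsGentle k)
    (hsa : ∀ w : Q.Word, w.IsString → w.SelfAvoiding)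
    (T : ObjectProperty (ModuleCat.{max u v} (PiAlg k Q))) :
    interMod k Q (T ⊓ shadowCat k Q) = interMod k Q T :=
  le_antisymm (fun _ hX => ⟨hX.1, hX.2.1⟩)
    fun _ hX => ⟨hX.1, hX.2, shadowCat_resProj hQ hsa hX.1⟩

/-- Dual arrows act as zero on quotients of `A`-modules, so that a string module which is such a
quotient belongs to a word without dual arrows. -/
theorem eq_inclWord_of_surjective {w' : Q.double.Word}
    {Y : ModuleCat.{max u v} (PiAlg k Q)} (hY : IsStringModule k w' Y)
    (f : (resProj k Q).obj X →ₗ[PiAlg k Q] Y) (hf : Function.Surjective f) :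
    w' = inclWord (specialize w') := by
  obtain ⟨_, _, y, hy⟩ := hY.exists_basis
  have harr : ∀ α j i, ¬ w'.Arr (Sum.inr α) j i := by
    intro α j i h
    refine bvec_ne_zero y h.le.2 ?_
    obtain ⟨z, hz⟩ := hf (bvec y j)
    rw [← hy.arrow_smul h, ← hz, ← map_smul, resProj_smul, proj_arrow_inr]
    exact (congrArg f (zero_smul (Alg k Q) (show X from z))).trans (map_zero f)
  ext1
  · rfl
  · simp only [inclWord, specialize, List.map_map]
    symm
    refine (List.map_congr_left fun l hl => ?_).trans (List.map_id _)
    obtain ⟨j, hj⟩ := List.mem_iff_getElem?.1 hl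
    rcases l with ⟨α | α, ε⟩
    · rfl
    · cases ε with
      | true => exact absurd (Or.inl ⟨rfl, hj⟩) (harr α j (j + 1))
      | false => exact absurd (Or.inr ⟨rfl, hj⟩) (harr α (j + 1) j)

theorem shadowCat_le_isFG : shadowCat k Q ≤ ModuleCat.isFG (PiAlg k Q) :=
  addClosure_le_isFG fun _ hX => by
    obtain ⟨w, -, hX⟩ := hX
    exact hX.isFG

/-- A string module which is a quotient of an `A`-module is itself an `A`-module, so it makes no
difference whether quotients are tested over `A` or over `Π(A)`. -/
theorem interMod_torsOf (hQ : Q.IsGentle k) (hsa : ∀ w : Q.Word, w.IsString → w.SelfAvoiding)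
    {B : Set Q.Word} (hB : IsBiclosed B) : interMod k Q (torsOf k B) = bicToTors k B := by
  refine le_antisymm ?_ ?_
  · refine fun X hX => ⟨hX.1, fun Y f hf => ?_⟩
    have hfs : Function.Surjective f.hom := (ModuleCat.epi_iff_surjective f).1 hf
    have : Module.Finite (Alg k Q) X := hX.1
    have hY : ModuleCat.isFG (Alg k Q) Y := Module.Finite.of_surjective f.hom hfs
    refine addClosure_mono ?_ (addStrings_summands (B := {w | w.IsString}) hsa
      (addStrings_of_finite hQ hsa hY))
    rintro Z ⟨⟨w, hw, hZ⟩, s, p, hsp⟩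
    refine ⟨w, ?_, hZ⟩
    have := hX.2.2 _ (isLiftedString_inclWord hw) _ hZ.resProj (resMap (p ∘ₗ f.hom))
      ((Function.RightInverse.surjective (g := s) hsp).comp hfs)
    rwa [specialize_inclWord] at this
  · refine fun X hX => ⟨hX.1, shadowCat_le_isFG _ (shadowCat_resProj hQ hsa hX.1),
      fun w' hw' Y hY f hf => ?_⟩
    obtain ⟨M, hM⟩ := exists_isStringModule k hw'.2
    have hM' := hM.resProj
    rw [← eq_inclWord_of_surjective hY f hf] at hM'
    obtain ⟨e⟩ := hY.nonempty_equiv hM'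
    let g : X →ₗ[Alg k Q] M := unresMap (e.toLinearMap ∘ₗ f)
    have hg : Function.Surjective g := e.surjective.comp hf
    exact mem_of_addStrings hB.isString hsa hB.inv_mem hw'.2 hM
      (hX.2 M (ModuleCat.ofHom g) ((ModuleCat.epi_iff_surjective _).2 hg))

end Restriction

/-! ### The isomorphism between biclosed sets and torsion shadows -/

section ShadowEquiv

variable {k : Type u} [Field k] {Q : BoundQuiver.{v}}

variable (k) in
/-- The order isomorphism that sends a biclosed set `B` to the torsion shadow of the torsion class
`torsOf k B`. -/
noncomputable def shadowEquiv (hsa : ∀ w : Q.Word, w.IsString → w.SelfAvoiding) :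
    Q.Bic ≃o Q.TorShad k where
  toFun B := ⟨torsOf k B.1 ⊓ shadowCat k Q, torsOf k B.1, isTorsionClass_torsOf hsa B.2.closed, rfl⟩
  invFun S := ⟨stringsOf k S.1, by
    obtain ⟨S, T, hT, rfl⟩ := S
    rw [stringsOf_inf_shadowCat]
    exact isBiclosed_stringsOf hT⟩
  left_inv B := Subtype.ext (stringsOf_inf_shadowCat.trans (stringsOf_torsOf hsa B.2))
  right_inv S := by
    obtain ⟨S, T, hT, rfl⟩ := S
    refine Subtype.ext ?_
    have hB := isBiclosed_stringsOf hT
    have hT' := isTorsionClass_torsOf (k := k) hsa hB.closed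
    have h := stringsOf_torsOf (k := k) hsa hB
    change torsOf k (stringsOf k (T ⊓ shadowCat k Q)) ⊓ shadowCat k Q = T ⊓ shadowCat k Q
    rw [stringsOf_inf_shadowCat]
    exact le_antisymm (le_inf (inf_shadowCat_le hsa hT' hT h.le) inf_le_right)
      (le_inf (inf_shadowCat_le hsa hT hT' h.ge) inf_le_right)
  map_rel_iff' {B B'} := by
    constructor
    · intro h
      change B.1 ≤ B'.1
      have h' := stringsOf_mono (k := k) (show torsOf k B.1 ⊓ shadowCat k Q ≤
        torsOf k B'.1 ⊓ shadowCat k Q from h)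
      rwa [stringsOf_inf_shadowCat, stringsOf_inf_shadowCat, stringsOf_torsOf hsa B.2,
        stringsOf_torsOf hsa B'.2] at h'
    · exact fun h => inf_le_inf_right (shadowCat k Q) (torsOf_mono h)

end ShadowEquiv

end BoundQuiver

theorem mainTheorem1 {k : Type u} [Field k] (Q : BoundQuiver.{v})
    (hgentle : Q.IsGentle k) (hbrick : IsBrickAlgebra (Q.Alg k)) :
    (∀ s : Set Q.Bic, (∃ B, IsLUB s B) ∧ ∃ B, IsGLB s B) ∧
    (∀ s : Set (Q.TorShad k), (∃ S, IsLUB s S) ∧ ∃ S, IsGLB s S) ∧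
    ∃ Φ : Q.Bic ≃o Q.TorShad k,
      (∀ S : Q.TorShad k, (Φ.symm S).1 = BoundQuiver.stringsOf k S.1) ∧
      (∀ B : Q.Bic, BoundQuiver.specialization k (Φ B).1 = BoundQuiver.addStrings k B.1) ∧
      {C : ObjectProperty (ModuleCat.{max u v} (Q.Alg k)) | IsBiclosedSubcategory C} =
        Set.range (fun S : Q.TorShad k => BoundQuiver.specialization k S.1) ∧
      (∀ T : ObjectProperty (ModuleCat.{max u v} (Q.PiAlg k)), IsTorsionClass T →
        IsTorsionClass (Q.interMod k T) ∧
        Q.interMod k (T ⊓ Q.shadowCat k) = Q.interMod k T) ∧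
      (∀ B : Q.Bic, IsTorsionClass (BoundQuiver.bicToTors k B.1) ∧
        Q.interMod k (Φ B).1 = BoundQuiver.bicToTors k B.1) := by
  have hsa : ∀ w : Q.Word, w.IsString → w.SelfAvoiding :=
    fun w hw => BoundQuiver.selfAvoiding_of_isBrickAlgebra hbrick hw
  let Φ := BoundQuiver.shadowEquiv k hsa
  have hshad := exists_isGLB_torsionShadow (BoundQuiver.shadowCat k Q)
  have hbic : ∀ s : Set Q.Bic, ∃ B, IsGLB s B := fun s => by
    obtain ⟨S, hS⟩ := hshad (Φ '' s)
    refine ⟨Φ.symm S, Φ.isGLB_image'.1 ?_⟩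
    rwa [Φ.apply_symm_apply]
  have hspec : ∀ B : Q.Bic,
      BoundQuiver.specialization k (Φ B).1 = BoundQuiver.addStrings k B.1 := fun B =>
    congrArg (BoundQuiver.addStrings k) (congrArg Subtype.val (Φ.symm_apply_apply B))
  refine ⟨fun s => ⟨exists_isLUB_of_exists_isGLB hbic s, hbic s⟩,
    fun s => ⟨exists_isLUB_of_exists_isGLB hshad s, hshad s⟩, Φ, fun S => rfl, hspec, ?_,
    fun T hT => ⟨BoundQuiver.isTorsionClass_interMod hT,
      BoundQuiver.interMod_inf_shadowCat hgentle hsa T⟩, fun B => ?_⟩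
  · ext C
    constructor
    · intro hC
      obtain ⟨B, hB, rfl⟩ := BoundQuiver.exists_isBiclosed_of_subcategory hgentle hsa hC
      exact ⟨Φ ⟨B, hB⟩, hspec ⟨B, hB⟩⟩
    · rintro ⟨S, rfl⟩
      obtain ⟨B, rfl⟩ := Φ.surjective S
      change IsBiclosedSubcategory (BoundQuiver.specialization k (Φ B).1)
      rw [hspec]
      exact BoundQuiver.isBiclosedSubcategory_addStrings hgentle hsa B.2
  · have h := BoundQuiver.interMod_torsOf (k := k) hgentle hsa B.2
    refine ⟨?_, (BoundQuiver.interMod_inf_shadowCat hgentle hsa _).trans h⟩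
    rw [← h]
    exact BoundQuiver.isTorsionClass_interMod
      (BoundQuiver.isTorsionClass_torsOf hsa B.2.closed)
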